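/- **Theorem ($\Gamma$-convergence of the diffuse-domain energies, Neumann case).** Let $n\ge 1$, let $\Omega=\prod_{i=1}^n(a_i,b_i)\subset\mathbb R^n$ be an open cuboid, and let $\Omega_1$ be a nonempty bounded open set with $C^3$ boundary and $\overline{\Omega_1}\subset\Omega$; put $\Omega_2=\Omega\setminus\overline{\Omega_1}$. Let $\alpha,\beta,\gamma>0$ be constants, $h,q\in L^2(\Omega)$ and $g\in H^1(\Omega)$. Let $r$ be the signed distance to $\partial\Omega_1$, positive in $\Omega_1$ and negative outside $\overline{\Omega_1}$, and for $\varepsilon\in(0,1)$ set $$\phi_\varepsilon=\tfrac12\Bigl[1+\tanh\Bigl(\frac{r}{\varepsilon}\Bigr)\Bigr],\qquad D_\varepsilon=\alpha+(1-\alpha)\phi_\varepsilon,\qquad c_\varepsilon=\beta+(\gamma-\beta)\phi_\varepsilon,\qquad f_\varepsilon=h+(q-h)\phi_\varepsilon,$$ $$D_0=\chi_{\Omega_1}+\alpha\chi_{\Omega_2},\qquad c_0=\gamma\chi_{\Omega_1}+\beta\chi_{\Omega_2},\qquad f_0=q\chi_{\Omega_1}+h\chi_{\Omega_2}.$$ Define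 $\mathcal F_\varepsilon,\mathcal F_0:L^2(\Omega)\to(-\infty,+\infty]$ by $$\mathcal F_\varepsilon[u]=\int_\Omega\Bigl[\tfrac12\bigl(D_\varepsilon|\nabla u|^2+c_\varepsilon u^2\bigr)-f_\varepsilon u+g\,u\,|\nabla\phi_\varepsilon|\Bigr]dx,$$ $$\mathcal F_0[u]=\int_\Omega\Bigl[\tfrac12\bigl(D_0|\nabla u|^2+c_0u^2\bigr)-f_0u\Bigr]dx+\int_{\partial\Omega_1}g\,u\,dS$$ for $u\in H^1(\Omega)$, and $\mathcal F_\varepsilon[u]=\mathcal F_0[u]=+\infty$ for $u\in L^2(\Omega)\setminus H^1(\Omega)$; in the surface integral ($dS$ is the $(n-1)$-dimensional Hausdorff measure) $g$ and $u$ stand for their traces on $\partial\Omega_1$. Then, as $\varepsilon\to0$, $\mathcal F_\varepsilon$ $\Gamma$-converges to $\mathcal F_0$ in the strong topology of $L^2(\Omega)$. That is, for every sequence $(\varepsilon_k)\subset(0,1)$ with $\varepsilon_k\to0$ and every $u\in L^2(\Omega)$: 1. if $u_k\to u$ in $L^2(\Omega)$, then $\mathcal F_0[u]\le\liminf_{k\to\infty}\mathcal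 F_{\varepsilon_k}[u_k]$; 2. there is a sequence $u_k\to u$ in $L^2(\Omega)$ with $\limsup_{k\to\infty}\mathcal F_{\varepsilon_k}[u_k]\le\mathcal F_0[u]$. -/

import Mathlib

open MeasureTheory Filter Topology
open scoped ContDiff

noncomputable section

namespace DiffuseDomain

/-- Euclidean space `ℝⁿ`. -/
abbrev E (n : ℕ) := EuclideanSpace ℝ (Fin n)

/-- The open cuboid `∏ᵢ (aᵢ, bᵢ)`. -/
def cuboid {n : ℕ} (a b : Fin n → ℝ) : Set (E n) :=
  {x | ∀ i, a i < x i ∧ x i < b i}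

/-- `U` has a boundary of class `C^k`: near every boundary point `p` there is a direction `ν` such
that `U` is the region lying above (in the direction `ν`) the graph of a `C^k` function of the
component of the variable orthogonal to `ν`. -/
def HasCkBoundary {n : ℕ} (k : ℕ∞) (U : Set (E n)) : Prop :=
  ∀ p ∈ frontier U, ∃ (ν : E n) (ψ : E n → ℝ) (ρ : ℝ),
    ‖ν‖ = 1 ∧ ContDiff ℝ k ψ ∧ 0 < ρ ∧
      U ∩ Metric.ball p ρ =
        {x ∈ Metric.ball p ρ | ψ (x - inner ℝ ν x • ν) < inner ℝ ν x}

/-! ### The Sobolev space `H¹` and traces -/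

/-- `G` is a weak gradient of `u` in the open set `U`. -/
def IsWeakGradient {n : ℕ} (U : Set (E n)) (u : E n → ℝ) (G : E n → E n) : Prop :=
  ∀ φ : E n → ℝ, ContDiff ℝ ∞ φ → HasCompactSupport φ → tsupport φ ⊆ U →
    ∀ v : E n, ∫ x in U, u x * fderiv ℝ φ x v = - ∫ x in U, inner ℝ (G x) v * φ x

/-- `u ∈ H¹(U)`. -/
def MemH1 {n : ℕ} (U : Set (E n)) (u : E n → ℝ) : Prop :=
  MemLp u 2 (volume.restrict U) ∧
    ∃ G : E n → E n, MemLp G 2 (volume.restrict U) ∧ IsWeakGradient U u G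

open Classical in
/-- The weak gradient `∇u` of `u ∈ H¹(U)` (unique up to null sets of `U`). -/
def weakGradient {n : ℕ} (U : Set (E n)) (u : E n → ℝ) : E n → E n :=
  if h : MemH1 U u then h.2.choose else 0

/-- The surface measure `dS` on `∂U`: the `(n-1)`-dimensional Hausdorff measure, normalised so that
it agrees with Lebesgue measure on hyperplanes. -/
def surfaceMeasure {n : ℕ} (U : Set (E n)) : Measure (E n) :=
  (Measure.euclideanHausdorffMeasure (n - 1)).restrict (frontier U)

/-- `t ∈ L²(∂U)` is the boundary trace of `u ∈ H¹(U)`: there are smooth functions on `ℝⁿ`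
converging to `u` in `H¹(U)` whose restrictions to `∂U` converge to `t` in `L²(∂U)`. -/
def IsTrace {n : ℕ} (U : Set (E n)) (u t : E n → ℝ) : Prop :=
  MemH1 U u ∧ MemLp t 2 (surfaceMeasure U) ∧
    ∃ v : ℕ → E n → ℝ, (∀ k, ContDiff ℝ ∞ (v k)) ∧
      Tendsto (fun k => eLpNorm (v k - u) 2 (volume.restrict U)) atTop (𝓝 0) ∧
      Tendsto (fun k => eLpNorm (gradient (v k) - weakGradient U u) 2 (volume.restrict U))
        atTop (𝓝 0) ∧
      Tendsto (fun k => eLpNorm (v k - t) 2 (surfaceMeasure U)) atTop (𝓝 0)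

open Classical in
/-- The trace of `u` on `∂U` (unique up to null sets of the surface measure). -/
def trace {n : ℕ} (U : Set (E n)) (u : E n → ℝ) : E n → ℝ :=
  if h : ∃ t, IsTrace U u t then h.choose else 0

/-! ### The phase field and the coefficients -/

open Classical in
/-- The signed distance to `∂U`, nonnegative in `U` and nonpositive outside. -/
def signedDist {n : ℕ} (U : Set (E n)) (x : E n) : ℝ :=
  if x ∈ U then Metric.infDist x (frontier U) else - Metric.infDist x (frontier U)

/-- The phase field `φ_ε = ½ (1 + tanh (r/ε))`. -/
def phase {n : ℕ} (Ω₁ : Set (E n)) (ε : ℝ) (x : E n) : ℝ :=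
  (1 / 2) * (1 + Real.tanh (signedDist Ω₁ x / ε))

/-- `s₂ + (s₁ - s₂) φ_ε`: with `(s₁, s₂) = (1, α), (γ, β), (q, h)` these are `D_ε, c_ε, f_ε`. -/
def diffuseCoeff {n : ℕ} (Ω₁ : Set (E n)) (ε : ℝ) (s₁ s₂ : E n → ℝ) (x : E n) : ℝ :=
  s₂ x + (s₁ x - s₂ x) * phase Ω₁ ε x

/-- `s₁ χ_{Ω₁} + s₂ χ_{Ω₂}` with `Ω₂ = Ω ∖ closure Ω₁`: with
`(s₁, s₂) = (1, α), (γ, β), (q, h)` these are `D₀, c₀, f₀`. -/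
def sharpCoeff {n : ℕ} (Ω Ω₁ : Set (E n)) (s₁ s₂ : E n → ℝ) (x : E n) : ℝ :=
  Ω₁.indicator s₁ x + (Ω \ closure Ω₁).indicator s₂ x

/-! ### The energies on `L²(Ω)` -/

open Classical in
/-- The diffuse-domain energy `F_ε`. -/
def diffuseEnergy {n : ℕ} (Ω Ω₁ : Set (E n)) (α β γ : ℝ) (h q g : E n → ℝ) (ε : ℝ)
    (u : Lp ℝ 2 (volume.restrict Ω)) : EReal :=
  if MemH1 Ω u then
    ((∫ x in Ω,
        ((1 / 2) * (diffuseCoeff Ω₁ ε (fun _ => 1) (fun _ => α) x * ‖weakGradient Ω u x‖ ^ 2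
            + diffuseCoeff Ω₁ ε (fun _ => γ) (fun _ => β) x * u x ^ 2)
          - diffuseCoeff Ω₁ ε q h x * u x
          + g x * u x * ‖gradient (phase Ω₁ ε) x‖) : ℝ) : EReal)
  else ⊤

open Classical in
/-- The sharp-interface energy `F₀`. -/
def sharpEnergy {n : ℕ} (Ω Ω₁ : Set (E n)) (α β γ : ℝ) (h q g : E n → ℝ)
    (u : Lp ℝ 2 (volume.restrict Ω)) : EReal :=
  if MemH1 Ω u then
    (((∫ x in Ω,
        ((1 / 2) * (sharpCoeff Ω Ω₁ (fun _ => 1) (fun _ => α) x * ‖weakGradient Ω u x‖ ^ 2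
            + sharpCoeff Ω Ω₁ (fun _ => γ) (fun _ => β) x * u x ^ 2)
          - sharpCoeff Ω Ω₁ q h x * u x))
      + ∫ x, trace Ω₁ g x * trace Ω₁ u x ∂(surfaceMeasure Ω₁) : ℝ) : EReal)
  else ⊤

/-! ### Γ-convergence -/

/-- `Γ`-convergence of a sequence of functionals on a metric space. -/
def GammaConvergesSeq {X : Type*} [PseudoMetricSpace X] (F : ℕ → X → EReal) (F₀ : X → EReal) :
    Prop :=
  (∀ (u : X) (v : ℕ → X), Tendsto v atTop (𝓝 u) →
      F₀ u ≤ liminf (fun k => F k (v k)) atTop) ∧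
  (∀ u : X, ∃ v : ℕ → X, Tendsto v atTop (𝓝 u) ∧
      limsup (fun k => F k (v k)) atTop ≤ F₀ u)

/-- `Γ`-convergence, as `ε → 0`, of a family indexed by `ε ∈ (0,1)`. -/
def GammaConverges {X : Type*} [PseudoMetricSpace X] (F : ℝ → X → EReal) (F₀ : X → EReal) :
    Prop :=
  ∀ ε : ℕ → ℝ, (∀ k, ε k ∈ Set.Ioo (0 : ℝ) 1) → Tendsto ε atTop (𝓝 0) →
    GammaConvergesSeq (fun k => F (ε k)) F₀

end DiffuseDomain

end

/-
Near `∂Ω₁` the field `φ_ε` increases along directions transversal to the boundary, so the divergence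
theorem rewrites the diffuse surface measures `|∇φ_ε| dx`, localized by a partition of unity, as
volume integrals against `φ_ε`; letting `ε → 0` there shows that they converge to `dS`. The same
transversality bounds the integral of `v²` against them by `‖v‖ ‖∇v‖ + ‖v‖²`, up to a constant
independent of `ε`. Hence the boundary term is continuous along sequences that converge in `L²` with
bounded gradients, and it cannot compensate the gradient energy: bounded energies give bounded
gradients. The lower bound then follows from weak compactness of the gradients and convexity of the
gradient energy, and the constant sequence is a recovery sequence.
-/

noncomputable section

namespace DiffuseDomain

/-! ### The signed distance -/

section SignedDistance

theorem inter_frontier_nonempty_of_isPreconnected {X : Type*} [TopologicalSpace X] {s t : Set X}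
    (ht : IsPreconnected t) (hs : (t ∩ s).Nonempty) (hsc : (t ∩ sᶜ).Nonempty) :
    (t ∩ frontier s).Nonempty := by
  by_contra hempty
  have hcover : t ⊆ interior s ∪ (closure s)ᶜ := fun z hz => by
    by_contra hz'
    simp only [Set.mem_union, Set.mem_compl_iff, not_or, not_not] at hz'
    exact hempty ⟨z, hz, hz'.2, hz'.1⟩
  obtain ⟨x, hxt, hx⟩ := hs
  obtain ⟨y, hyt, hy⟩ := hsc
  obtain ⟨z, -, hz, hz'⟩ := ht _ _ isOpen_interior isClosed_closure.isOpen_compl hcover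
    ⟨x, hxt, (hcover hxt).resolve_right fun h => h (subset_closure hx)⟩
    ⟨y, hyt, (hcover hyt).resolve_left fun h => hy (interior_subset h)⟩
  exact hz' (subset_closure (interior_subset hz))

theorem exists_mem_segment_frontier {V : Type*} [AddCommGroup V] [Module ℝ V] [TopologicalSpace V]
    [IsTopologicalAddGroup V] [ContinuousSMul ℝ V] {s : Set V} {x y : V} (hx : x ∈ s)
    (hy : y ∉ s) : ∃ z ∈ segment ℝ x y, z ∈ frontier s :=
  inter_frontier_nonempty_of_isPreconnected (convex_segment x y).isPreconnected
    ⟨x, left_mem_segment ℝ x y, hx⟩ ⟨y, right_mem_segment ℝ x y, hy⟩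

theorem mem_closure_of_dist_le_infDist_frontier {V : Type*} [NormedAddCommGroup V]
    [NormedSpace ℝ V] {s : Set V} {x z : V} (hx : x ∈ closure s)
    (hz : dist x z ≤ Metric.infDist x (frontier s)) : z ∈ closure s := by
  by_contra hzs
  obtain ⟨w, hw, hwf⟩ := exists_mem_segment_frontier hx hzs
  have hwf : w ∈ frontier s := frontier_closure_subset hwf
  have hxw : dist x z ≤ dist x w := hz.trans (Metric.infDist_le_dist_of_mem hwf)
  have hwz : w = z :=
    dist_le_zero.1 (by linarith [dist_add_dist_of_mem_segment hw])
  exact hzs (hwz ▸ frontier_subset_closure hwf)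

variable {n : ℕ} {U : Set (E n)} {x : E n}

theorem signedDist_of_mem (hx : x ∈ U) : signedDist U x = Metric.infDist x (frontier U) :=
  if_pos hx

theorem signedDist_of_notMem (hx : x ∉ U) : signedDist U x = -Metric.infDist x (frontier U) :=
  if_neg hx

theorem abs_signedDist (U : Set (E n)) (x : E n) :
    |signedDist U x| = Metric.infDist x (frontier U) := by
  unfold signedDist
  split_ifs <;> simp [abs_of_nonneg Metric.infDist_nonneg]

theorem lipschitzWith_signedDist (U : Set (E n)) : LipschitzWith 1 (signedDist U) := by
  refine LipschitzWith.of_le_add fun x y => ?_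
  have hdist : ∀ a b : E n,
      Metric.infDist a (frontier U) ≤ Metric.infDist b (frontier U) + dist a b :=
    fun _ _ => Metric.infDist_le_infDist_add_dist
  by_cases hx : x ∈ U <;> by_cases hy : y ∈ U
  · rw [signedDist_of_mem hx, signedDist_of_mem hy]
    exact hdist x y
  · obtain ⟨z, hz, hzf⟩ := exists_mem_segment_frontier hx hy
    rw [signedDist_of_mem hx, signedDist_of_notMem hy]
    linarith [Metric.infDist_le_dist_of_mem (x := x) hzf,
      Metric.infDist_le_dist_of_mem (x := y) hzf, dist_add_dist_of_mem_segment hz, dist_comm y z]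
  · rw [signedDist_of_notMem hx, signedDist_of_mem hy]
    linarith [Metric.infDist_nonneg (x := x) (s := frontier U),
      Metric.infDist_nonneg (x := y) (s := frontier U), dist_nonneg (x := x) (y := y)]
  · rw [signedDist_of_notMem hx, signedDist_of_notMem hy]
    linarith [hdist y x, dist_comm x y]

end SignedDistance

/-! ### Interior cones at the boundary -/

section Cone

variable {n : ℕ} {U : Set (E n)} {p N : E n} {ρ c : ℝ}

/-- `U` contains, near `p`, the closed cone with axis `N` and slope `δ` (the larger `δ`, the
narrower the cone) issuing from each point of its closure. -/
def ConeCondition (U : Set (E n)) (p N : E n) (ρ δ : ℝ) : Prop :=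
  ∀ x ∈ closure U, ∀ y, x ∈ Metric.ball p ρ → y ∈ Metric.ball p ρ → x ≠ y →
    δ * ‖y - x‖ ≤ inner ℝ N (y - x) → y ∈ U

/-- The open set `U` satisfies near its boundary point `p` the cone condition with unit axis `N`.
The slope `(1 - c) / (1 + c)` is chosen so that the cone contains the balls of radius `c * s` about
its axis points `s • N`. -/
structure IsConeAt (U : Set (E n)) (p N : E n) (ρ c : ℝ) : Prop where
  isOpen : IsOpen U
  mem_frontier : p ∈ frontier U
  norm_axis : ‖N‖ = 1
  radius_pos : 0 < ρ
  rate_pos : 0 < c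
  rate_lt_one : c < 1
  cone : ConeCondition U p N ρ ((1 - c) / (1 + c))

theorem HasCkBoundary.of_le {k m : ℕ∞} (h : HasCkBoundary m U) (hkm : k ≤ m) :
    HasCkBoundary k U := fun p hp =>
  have ⟨ν, ψ, ρ, hν, hψ, hρ, hU⟩ := h p hp
  ⟨ν, ψ, ρ, hν, hψ.of_le (by exact_mod_cast hkm), hρ, hU⟩

theorem HasCkBoundary.exists_contDiff_pos {k : ℕ∞} (hU : HasCkBoundary k U)
    (hp : p ∈ frontier U) :
    ∃ (ν : E n) (Φ : E n → ℝ) (ρ : ℝ), ContDiff ℝ k Φ ∧ (∀ t : ℝ, Φ (p + t • ν) = Φ p + t) ∧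
      0 < ρ ∧ U ∩ Metric.ball p ρ = {x ∈ Metric.ball p ρ | 0 < Φ x} := by
  obtain ⟨ν, ψ, ρ, hν, hψ, hρ, hUψ⟩ := hU p hp
  have hinner : ContDiff ℝ k fun x : E n => inner ℝ ν x := contDiff_const.inner ℝ contDiff_id
  refine ⟨ν, fun x => inner ℝ ν x - ψ (x - inner ℝ ν x • ν), ρ,
    hinner.sub (hψ.comp (contDiff_id.sub (hinner.smul contDiff_const))), fun t => ?_, hρ, ?_⟩
  · have hcoord : inner ℝ ν (p + t • ν) = inner ℝ ν p + t := by
      rw [inner_add_right, inner_smul_right, real_inner_self_eq_norm_sq, hν]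
      ring
    have hproj : p + t • ν - (inner ℝ ν p + t) • ν = p - inner ℝ ν p • ν := by module
    simp only [hcoord, hproj]
    ring
  · simpa only [sub_pos] using hUψ

theorem exists_coneCondition_of_hasStrictFDerivAt {Φ : E n → ℝ} {g : E n} {ρ δ : ℝ}
    (hΦ : Continuous Φ) (hg : HasStrictFDerivAt Φ (InnerProductSpace.toDual ℝ (E n) g) p)
    (hg0 : g ≠ 0) (hρ : 0 < ρ)
    (hU : U ∩ Metric.ball p ρ = {x ∈ Metric.ball p ρ | 0 < Φ x}) (hδ : 0 < δ) :
    ∃ σ > 0, ConeCondition U p (‖g‖⁻¹ • g) σ δ := by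
  have hgpos : 0 < ‖g‖ := norm_pos_iff.2 hg0
  obtain ⟨σ, hσ, hlin⟩ := Metric.eventually_nhds_iff_ball.1
    (hg.isLittleO.def (show 0 < δ * ‖g‖ / 2 by positivity))
  refine ⟨min ρ σ, lt_min hρ hσ, fun x hx y hxb hyb hxy hcone => ?_⟩
  have hsub_ρ : Metric.ball p (min ρ σ) ⊆ Metric.ball p ρ :=
    Metric.ball_subset_ball (min_le_left _ _)
  have hsub_σ : Metric.ball p (min ρ σ) ⊆ Metric.ball p σ :=
    Metric.ball_subset_ball (min_le_right _ _)
  have hΦx : 0 ≤ Φ x := by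
    refine closure_minimal ?_ (isClosed_le continuous_const hΦ)
      (Metric.isOpen_ball.inter_closure ⟨hsub_ρ hxb, hx⟩)
    rw [Set.inter_comm, hU]
    exact fun z hz => hz.2.le
  have hΦxy : inner ℝ g (y - x) - δ * ‖g‖ / 2 * ‖y - x‖ ≤ Φ y - Φ x := by
    have := hlin (y, x) (by rw [← ball_prod_same]; exact ⟨hsub_σ hyb, hsub_σ hxb⟩)
    rw [Real.norm_eq_abs, InnerProductSpace.toDual_apply_apply] at this
    linarith [(abs_le.1 this).1]
  have hinner : δ * ‖g‖ * ‖y - x‖ ≤ inner ℝ g (y - x) := by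
    rw [real_inner_smul_left, inv_mul_eq_div, le_div_iff₀ hgpos] at hcone
    linarith
  have hgap : 0 < δ * ‖g‖ / 2 * ‖y - x‖ := by
    have : 0 < ‖y - x‖ := norm_pos_iff.2 (sub_ne_zero.2 hxy.symm)
    positivity
  have hy : y ∈ U ∩ Metric.ball p ρ := by
    rw [hU]
    exact ⟨hsub_ρ hyb, by linarith⟩
  exact hy.1

theorem HasCkBoundary.exists_isConeAt (hU : HasCkBoundary 1 U) (hUo : IsOpen U)
    (hp : p ∈ frontier U) (hc : 0 < c) (hc1 : c < 1) :
    ∃ (N : E n) (ρ : ℝ), IsConeAt U p N ρ c := by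
  obtain ⟨ν, Φ, ρ, hΦ, hline, hρ, hUΦ⟩ := hU.exists_contDiff_pos hp
  have hstrict : HasStrictFDerivAt Φ (fderiv ℝ Φ p) p :=
    hΦ.contDiffAt.hasStrictFDerivAt (by simp)
  have hν : fderiv ℝ Φ p ν = 1 := by
    have hderiv : HasLineDerivAt ℝ Φ 1 p ν := by
      simpa only [HasLineDerivAt, hline, id] using (hasDerivAt_id (0 : ℝ)).const_add (Φ p)
    exact (hstrict.hasFDerivAt.hasLineDerivAt ν).unique hderiv
  obtain ⟨g, hg⟩ := (InnerProductSpace.toDual ℝ (E n)).surjective (fderiv ℝ Φ p)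
  have hg0 : g ≠ 0 := by
    rintro rfl
    rw [← hg, map_zero] at hν
    exact zero_ne_one hν
  obtain ⟨σ, hσ, hcone⟩ := exists_coneCondition_of_hasStrictFDerivAt hΦ.continuous
    (hg ▸ hstrict) hg0 hρ hUΦ (δ := (1 - c) / (1 + c)) (div_pos (by linarith) (by linarith))
  exact ⟨‖g‖⁻¹ • g, σ, hUo, hp, norm_smul_inv_norm hg0, hσ, hc, hc1, hcone⟩

namespace IsConeAt

theorem slope_le (h : IsConeAt U p N ρ c) : (1 - c) / (1 + c) ≤ 1 - c :=
  div_le_self (by linarith [h.rate_lt_one]) (by linarith [h.rate_pos])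

theorem mem_of_norm_sub_le (h : IsConeAt U p N ρ c) {x y : E n} {s : ℝ} (hx : x ∈ closure U)
    (hxb : x ∈ Metric.ball p ρ) (hyb : y ∈ Metric.ball p ρ) (hs : 0 < s)
    (hy : ‖y - x - s • N‖ ≤ c * s) : y ∈ U := by
  obtain ⟨-, -, hN, -, hc, hc1, hcone⟩ := h
  have hsN : ‖s • N‖ = s := by rw [norm_smul, hN, Real.norm_of_nonneg hs.le, mul_one]
  have hnorm : ‖y - x‖ ≤ s * (1 + c) := by
    linarith [norm_le_norm_add_norm_sub' (y - x) (s • N)]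
  have hinner : s * (1 - c) ≤ inner ℝ N (y - x) := by
    have hsplit : inner ℝ N (y - x) = s + inner ℝ N (y - x - s • N) := by
      rw [inner_sub_right N (y - x), inner_smul_right, real_inner_self_eq_norm_sq, hN]
      ring
    have hCS := abs_real_inner_le_norm N (y - x - s • N)
    rw [hN, one_mul] at hCS
    linarith [(abs_le.1 hCS).1]
  refine hcone x hx y hxb hyb ?_ ?_
  · rintro rfl
    rw [sub_self, inner_zero_right] at hinner
    nlinarith
  · calc (1 - c) / (1 + c) * ‖y - x‖ ≤ (1 - c) / (1 + c) * (s * (1 + c)) := by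
          gcongr
      _ = s * (1 - c) := by field_simp
      _ ≤ _ := hinner

theorem dist_add_smul (h : IsConeAt U p N ρ c) (x : E n) {s : ℝ} (hs : 0 ≤ s) :
    dist x (x + s • N) = s := by
  rw [dist_self_add_right, norm_smul, h.norm_axis, Real.norm_of_nonneg hs, mul_one]

theorem mul_lt_of_mem_ball (h : IsConeAt U p N ρ c) {x : E n} {s : ℝ} (hs : 0 < s)
    (hxb : x ∈ Metric.ball p (ρ / 6)) (hyb : x + s • N ∈ Metric.ball p (ρ / 6)) :
    c * s < ρ / 3 := by
  rw [Metric.mem_ball] at hxb hyb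
  have hs' : c * s < s := mul_lt_of_lt_one_left hs h.rate_lt_one
  linarith [h.dist_add_smul x hs.le, dist_triangle_right x (x + s • N) p]

theorem infDist_add_le_of_mem_closure (h : IsConeAt U p N ρ c) {x : E n} {s : ℝ}
    (hxU : x ∈ closure U) (hs : 0 < s) (hxb : x ∈ Metric.ball p (ρ / 6))
    (hyb : x + s • N ∈ Metric.ball p (ρ / 6)) :
    Metric.infDist x (frontier U) + c * s ≤ Metric.infDist (x + s • N) (frontier U) := by
  refine (Metric.le_infDist ⟨p, h.mem_frontier⟩).2 fun z hz => ?_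
  by_contra! hlt
  have hd : Metric.infDist x (frontier U) ≤ dist x p :=
    Metric.infDist_le_dist_of_mem h.mem_frontier
  have hcs := h.mul_lt_of_mem_ball hs hxb hyb
  obtain ⟨w, hxw, hwz⟩ := exists_dist_le_lt (x := x) (z := z - s • N)
    (Metric.infDist_nonneg (x := x) (s := frontier U)) (mul_pos h.rate_pos hs)
    (by rwa [dist_eq_norm, sub_sub_eq_add_sub, ← dist_eq_norm, add_comm (c * s)])
  rw [Metric.mem_ball] at hxb hyb
  have hzU : z ∈ U := by
    refine h.mem_of_norm_sub_le (mem_closure_of_dist_le_infDist_frontier hxU hxw) ?_ ?_ hs ?_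
    · rw [Metric.mem_ball]
      linarith [h.radius_pos, dist_triangle_left w p x]
    · rw [Metric.mem_ball]
      linarith [h.radius_pos, dist_triangle_left z p (x + s • N)]
    · rw [dist_comm, dist_eq_norm, sub_right_comm] at hwz
      exact hwz.le
  exact (h.isOpen.frontier_eq ▸ hz).2 hzU

theorem infDist_add_le_of_notMem (h : IsConeAt U p N ρ c) {x : E n} {s : ℝ} (hs : 0 < s)
    (hyU : x + s • N ∉ U) (hxb : x ∈ Metric.ball p (ρ / 6))
    (hyb : x + s • N ∈ Metric.ball p (ρ / 6)) :
    Metric.infDist (x + s • N) (frontier U) + c * s ≤ Metric.infDist x (frontier U) := by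
  refine (Metric.le_infDist ⟨p, h.mem_frontier⟩).2 fun z hz => ?_
  by_contra! hlt
  have hd : Metric.infDist (x + s • N) (frontier U) ≤ dist (x + s • N) p :=
    Metric.infDist_le_dist_of_mem h.mem_frontier
  have hcs := h.mul_lt_of_mem_ball hs hxb hyb
  obtain ⟨w, hyw, hwz⟩ := exists_dist_le_lt (x := x + s • N) (z := z + s • N)
    (Metric.infDist_nonneg (x := x + s • N) (s := frontier U)) (mul_pos h.rate_pos hs)
    (by rwa [dist_add_right, add_comm (c * s)])
  rw [Metric.mem_ball] at hxb hyb
  have hwU : w ∉ U := by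
    rw [← frontier_compl] at hyw
    have := mem_closure_of_dist_le_infDist_frontier (subset_closure hyU) hyw
    rwa [h.isOpen.isClosed_compl.closure_eq] at this
  refine hwU (h.mem_of_norm_sub_le (frontier_subset_closure hz) ?_ ?_ hs ?_)
  · rw [Metric.mem_ball]
    linarith [h.radius_pos, dist_triangle_left z p x]
  · rw [Metric.mem_ball]
    linarith [h.radius_pos, dist_triangle_left w p (x + s • N)]
  · rw [dist_eq_norm, ← sub_sub] at hwz
    exact hwz.le

theorem infDist_add_infDist_of_notMem_of_mem (h : IsConeAt U p N ρ c) {x : E n} {s : ℝ}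
    (hs : 0 < s) (hx : x ∉ U) (hy : x + s • N ∈ U) (hxb : x ∈ Metric.ball p (ρ / 6))
    (hyb : x + s • N ∈ Metric.ball p (ρ / 6)) :
    c * s ≤ Metric.infDist x (frontier U) + Metric.infDist (x + s • N) (frontier U) := by
  obtain ⟨z, hz, hzf⟩ := exists_mem_segment_frontier hy hx
  have hzb : z ∈ Metric.ball p (ρ / 6) := (convex_ball p (ρ / 6)).segment_subset hyb hxb hz
  have hzU : z ∉ U := (h.isOpen.frontier_eq ▸ hzf).2
  obtain ⟨t, ⟨ht0, ht1⟩, rfl⟩ : ∃ t ∈ Set.Icc 0 s, x + t • N = z := by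
    rw [segment_symm, segment_eq_image'] at hz
    obtain ⟨θ, ⟨hθ0, hθ1⟩, rfl⟩ := hz
    exact ⟨θ * s, ⟨by positivity, mul_le_of_le_one_left hs.le hθ1⟩, by
      simp only [add_sub_cancel_left, smul_smul]⟩
  have hzero := Metric.infDist_zero_of_mem hzf
  have hbelow : c * t ≤ Metric.infDist x (frontier U) := by
    rcases ht0.eq_or_lt with rfl | ht
    · simpa using Metric.infDist_nonneg
    · linarith [h.infDist_add_le_of_notMem ht hzU hxb hzb]
  have hts : t < s := ht1.lt_of_ne (by rintro rfl; exact hzU hy)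
  have hsum : x + t • N + (s - t) • N = x + s • N := by module
  have habove := h.infDist_add_le_of_mem_closure (frontier_subset_closure hzf) (sub_pos.2 hts)
    hzb (hsum.symm ▸ hyb)
  rw [hsum, hzero] at habove
  linarith

theorem signedDist_add_le (h : IsConeAt U p N ρ c) {x : E n} {s : ℝ} (hs : 0 < s)
    (hxb : x ∈ Metric.ball p (ρ / 6)) (hyb : x + s • N ∈ Metric.ball p (ρ / 6)) :
    signedDist U x + c * s ≤ signedDist U (x + s • N) := by
  by_cases hy : x + s • N ∈ U <;> by_cases hx : x ∈ U
  · rw [signedDist_of_mem hx, signedDist_of_mem hy]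
    exact h.infDist_add_le_of_mem_closure (subset_closure hx) hs hxb hyb
  · rw [signedDist_of_notMem hx, signedDist_of_mem hy]
    linarith [h.infDist_add_infDist_of_notMem_of_mem hs hx hy hxb hyb]
  · have hball : Metric.ball p (ρ / 6) ⊆ Metric.ball p ρ :=
      Metric.ball_subset_ball (by linarith [h.radius_pos])
    refine absurd (h.mem_of_norm_sub_le (subset_closure hx) (hball hxb) (hball hyb) hs ?_) hy
    rw [add_sub_cancel_left, sub_self, norm_zero]
    exact (mul_pos h.rate_pos hs).le
  · rw [signedDist_of_notMem hx, signedDist_of_notMem hy]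
    linarith [h.infDist_add_le_of_notMem hs hy hxb hyb]

end IsConeAt

end Cone

/-! ### The phase field -/

section Gradient

variable {F : Type*} [NormedAddCommGroup F] [InnerProductSpace ℝ F] [CompleteSpace F] {f g : F → ℝ}

theorem norm_gradient (f : F → ℝ) (x : F) : ‖gradient f x‖ = ‖fderiv ℝ f x‖ :=
  LinearIsometryEquiv.norm_map _ _

theorem gradient_sub (hf : Differentiable ℝ f) (hg : Differentiable ℝ g) :
    gradient (f - g) = gradient f - gradient g := by
  funext x
  simp only [gradient, Pi.sub_apply, fderiv_sub (hf x) (hg x), map_sub]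

theorem continuous_gradient (hf : ContDiff ℝ 1 f) : Continuous (gradient f) :=
  (LinearIsometryEquiv.continuous _).comp (hf.continuous_fderiv one_ne_zero)

theorem measurable_norm_gradient [MeasurableSpace F] [BorelSpace F] (f : F → ℝ) :
    Measurable fun x => ‖gradient f x‖ := by
  simpa only [norm_gradient] using (measurable_fderiv ℝ f).norm

end Gradient

section Tanh

theorem one_sub_tanh_sq (t : ℝ) : 1 - Real.tanh t ^ 2 = 1 / Real.cosh t ^ 2 := by
  have hcosh : Real.cosh t ^ 2 ≠ 0 := pow_ne_zero 2 (Real.cosh_pos t).ne'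
  rw [Real.tanh_eq_sinh_div_cosh, div_pow, one_sub_div hcosh, Real.cosh_sq, add_sub_cancel_left]

theorem hasDerivAt_tanh (t : ℝ) : HasDerivAt Real.tanh (1 - Real.tanh t ^ 2) t := by
  have h := (Real.hasDerivAt_sinh t).div (Real.hasDerivAt_cosh t) (Real.cosh_pos t).ne'
  rw [show Real.sinh / Real.cosh = Real.tanh from
    funext fun t => (Real.tanh_eq_sinh_div_cosh t).symm] at h
  rwa [one_sub_tanh_sq, show 1 = Real.cosh t * Real.cosh t - Real.sinh t * Real.sinh t by
    linarith [Real.cosh_sq_sub_sinh_sq t]]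

theorem one_sub_tanh_sq_nonneg (t : ℝ) : 0 ≤ 1 - Real.tanh t ^ 2 :=
  sub_nonneg.2 (Real.tanh_sq_lt_one t).le

theorem one_sub_tanh_sq_le_one (t : ℝ) : 1 - Real.tanh t ^ 2 ≤ 1 :=
  sub_le_self _ (sq_nonneg _)

theorem one_sub_tanh_sq_le {t : ℝ} (ht : t ≠ 0) : 1 - Real.tanh t ^ 2 ≤ 1 / t ^ 2 := by
  rw [one_sub_tanh_sq, Real.cosh_sq]
  have hsinh : |t| ≤ |Real.sinh t| := by
    rw [Real.abs_sinh]
    exact Real.self_le_sinh_iff.2 (abs_nonneg t)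
  exact one_div_le_one_div_of_le (by positivity) ((sq_le_sq.2 hsinh).trans (by linarith))

theorem tendsto_tanh_atTop : Tendsto Real.tanh atTop (𝓝 1) := by
  have hsq : Tendsto (fun t => 1 - Real.tanh t ^ 2) atTop (𝓝 0) := by
    refine squeeze_zero' (.of_forall one_sub_tanh_sq_nonneg)
      ((eventually_ne_atTop 0).mono fun t ht => one_sub_tanh_sq_le ht) ?_
    simpa only [one_div, Pi.inv_def] using (tendsto_pow_atTop two_ne_zero).inv_tendsto_atTop
  have hlow := hsq.const_sub 1
  rw [sub_zero] at hlow
  refine tendsto_of_tendsto_of_tendsto_of_le_of_le' hlow tendsto_const_nhds ?_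
    (.of_forall fun t => (Real.tanh_lt_one t).le)
  filter_upwards [eventually_ge_atTop 0] with t ht
  have hnonneg : 0 ≤ Real.tanh t := by
    rw [Real.tanh_eq_sinh_div_cosh]
    exact div_nonneg (Real.sinh_nonneg_iff.2 ht) (Real.cosh_pos t).le
  nlinarith [Real.tanh_lt_one t]

theorem lipschitzWith_tanh : LipschitzWith 1 Real.tanh := by
  refine lipschitzWith_of_nnnorm_deriv_le (fun t => (hasDerivAt_tanh t).differentiableAt)
    fun t => ?_
  rw [(hasDerivAt_tanh t).deriv, ← NNReal.coe_le_coe, coe_nnnorm,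
    Real.norm_of_nonneg (one_sub_tanh_sq_nonneg t)]
  exact one_sub_tanh_sq_le_one t

end Tanh

section Phase

variable {n : ℕ} {U : Set (E n)} {ε : ℝ}

theorem phase_nonneg (x : E n) : 0 ≤ phase U ε x := by
  unfold phase
  linarith [Real.neg_one_lt_tanh (signedDist U x / ε)]

theorem phase_le_one (x : E n) : phase U ε x ≤ 1 := by
  unfold phase
  linarith [Real.tanh_lt_one (signedDist U x / ε)]

theorem abs_phase_le_one (x : E n) : |phase U ε x| ≤ 1 :=
  (abs_of_nonneg (phase_nonneg x)).trans_le (phase_le_one x)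

theorem exists_lipschitzWith_phase (U : Set (E n)) (ε : ℝ) :
    ∃ C, LipschitzWith C (phase U ε) := by
  have hphase : phase U ε = fun x => (1 / 2 : ℝ) • (1 + Real.tanh (ε⁻¹ • signedDist U x)) := by
    funext x
    rw [phase, smul_eq_mul, smul_eq_mul, div_eq_inv_mul (signedDist U x)]
  rw [hphase]
  exact ⟨_, (lipschitzWith_smul (1 / 2 : ℝ)).comp ((LipschitzWith.const (1 : ℝ)).add
    (lipschitzWith_tanh.comp ((lipschitzWith_smul ε⁻¹).comp (lipschitzWith_signedDist U))))⟩

theorem continuous_phase (U : Set (E n)) (ε : ℝ) : Continuous (phase U ε) :=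
  (exists_lipschitzWith_phase U ε).choose_spec.continuous

theorem tendsto_phase (hne : (frontier U).Nonempty) {x : E n} (hx : x ∉ frontier U) :
    Tendsto (fun ε => phase U ε x) (𝓝[>] 0) (𝓝 (U.indicator (fun _ => 1) x)) := by
  have hd : 0 < Metric.infDist x (frontier U) :=
    (isClosed_frontier.notMem_iff_infDist_pos hne).1 hx
  have hlim : Tendsto (fun ε => Real.tanh (Metric.infDist x (frontier U) / ε)) (𝓝[>] 0) (𝓝 1) :=
    tendsto_tanh_atTop.comp (tendsto_inv_nhdsGT_zero.const_mul_atTop hd)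
  by_cases hxU : x ∈ U
  · simp only [phase, signedDist_of_mem hxU, Set.indicator_of_mem hxU]
    convert (hlim.const_add 1).const_mul (1 / 2) using 2
    norm_num
  · simp only [phase, signedDist_of_notMem hxU, Set.indicator_of_notMem hxU, neg_div,
      Real.tanh_neg]
    convert (hlim.neg.const_add 1).const_mul (1 / 2) using 2
    norm_num

theorem ae_differentiableAt_signedDist (U : Set (E n)) :
    ∀ᵐ x : E n, DifferentiableAt ℝ (signedDist U) x :=
  (lipschitzWith_signedDist U).ae_differentiableAt

theorem norm_gradient_signedDist_le (x : E n) : ‖gradient (signedDist U) x‖ ≤ 1 := by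
  rw [norm_gradient]
  simpa using norm_fderiv_le_of_lipschitz ℝ (lipschitzWith_signedDist U) (x₀ := x)

theorem hasGradientAt_phase {x : E n} (hx : DifferentiableAt ℝ (signedDist U) x) (ε : ℝ) :
    HasGradientAt (phase U ε)
      (((2 * ε)⁻¹ * (1 - Real.tanh (signedDist U x / ε) ^ 2)) • gradient (signedDist U) x) x := by
  have hprofile : HasDerivAt (fun t : ℝ => 1 / 2 * (1 + Real.tanh (t / ε)))
      ((2 * ε)⁻¹ * (1 - Real.tanh (signedDist U x / ε) ^ 2)) (signedDist U x) := by
    have hdiv : HasDerivAt (fun t : ℝ => t / ε) ε⁻¹ (signedDist U x) := by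
      simpa only [id, one_div] using (hasDerivAt_id (signedDist U x)).div_const ε
    refine ((((hasDerivAt_tanh _).comp _ hdiv).const_add 1).const_mul (1 / 2)).congr_deriv ?_
    rw [mul_inv]
    ring
  rw [hasGradientAt_iff_hasFDerivAt, map_smul]
  exact hprofile.comp_hasFDerivAt x hx.hasGradientAt.hasFDerivAt

theorem norm_gradient_phase_le (hε : 0 < ε) {x : E n}
    (hx : DifferentiableAt ℝ (signedDist U) x) :
    ‖gradient (phase U ε) x‖ ≤ (2 * ε)⁻¹ * (1 - Real.tanh (signedDist U x / ε) ^ 2) := by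
  have htanh := one_sub_tanh_sq_nonneg (signedDist U x / ε)
  rw [(hasGradientAt_phase hx ε).gradient, norm_smul, Real.norm_of_nonneg (by positivity)]
  exact mul_le_of_le_one_right (by positivity) (norm_gradient_signedDist_le x)

theorem ae_norm_gradient_phase_le_of_le_infDist (hε : 0 < ε) {d : ℝ} (hd : 0 < d) :
    ∀ᵐ x : E n, d ≤ Metric.infDist x (frontier U) →
      ‖gradient (phase U ε) x‖ ≤ ε / (2 * d ^ 2) := by
  filter_upwards [ae_differentiableAt_signedDist U] with x hx hdx
  rw [← abs_signedDist] at hdx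
  have hr : signedDist U x ≠ 0 := abs_pos.1 (hd.trans_le hdx)
  have hsq : d ^ 2 ≤ signedDist U x ^ 2 := by
    rw [← sq_abs (signedDist U x)]
    gcongr
  calc ‖gradient (phase U ε) x‖
      ≤ (2 * ε)⁻¹ * (1 - Real.tanh (signedDist U x / ε) ^ 2) := norm_gradient_phase_le hε hx
    _ ≤ (2 * ε)⁻¹ * (1 / (signedDist U x / ε) ^ 2) := by
        gcongr
        exact one_sub_tanh_sq_le (div_ne_zero hr hε.ne')
    _ = ε / (2 * signedDist U x ^ 2) := by field_simp
    _ ≤ ε / (2 * d ^ 2) := by gcongr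

theorem ae_norm_gradient_phase_le_inv (hε : 0 < ε) :
    ∀ᵐ x : E n, ‖gradient (phase U ε) x‖ ≤ (2 * ε)⁻¹ := by
  filter_upwards [ae_differentiableAt_signedDist U] with x hx
  exact (norm_gradient_phase_le hε hx).trans
    (mul_le_of_le_one_right (by positivity) (one_sub_tanh_sq_le_one _))

theorem integrable_mul_norm_gradient_phase (hε : 0 < ε) {F : E n → ℝ} {μ : Measure (E n)}
    (hμ : μ ≪ volume) (hF : Integrable F μ) :
    Integrable (fun x => F x * ‖gradient (phase U ε) x‖) μ := by
  refine hF.mul_bdd (c := (2 * ε)⁻¹) (measurable_norm_gradient _).aestronglyMeasurable ?_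
  simp only [norm_norm]
  exact hμ.ae_le (ae_norm_gradient_phase_le_inv hε)

theorem integral_lineDeriv_phase_mul (U : Set (E n)) (ε : ℝ) {F : E n → ℝ} (hF : ContDiff ℝ 1 F)
    (hFc : HasCompactSupport F) (N : E n) :
    ∫ x, lineDeriv ℝ (phase U ε) x N * F x = -∫ x, phase U ε x * fderiv ℝ F x N := by
  obtain ⟨C, hC⟩ := exists_lipschitzWith_phase U ε
  obtain ⟨D, hD⟩ := hF.lipschitzWith_of_hasCompactSupport hFc one_ne_zero
  rw [hC.integral_lineDeriv_mul_eq hD hFc N, ← integral_neg]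
  congr 1
  funext x
  rw [(hF.differentiable one_ne_zero x).lineDeriv_eq_fderiv, map_neg]
  ring

theorem integrable_lineDeriv_phase_mul (U : Set (E n)) (ε : ℝ) {F : E n → ℝ} (hF : Integrable F)
    (N : E n) : Integrable fun x => lineDeriv ℝ (phase U ε) x N * F x := by
  obtain ⟨C, hC⟩ := exists_lipschitzWith_phase U ε
  exact hF.bdd_mul (c := C * ‖N‖) (hC.memLp_lineDeriv (μ := volume) N).1
    (.of_forall fun x => norm_lineDeriv_le_of_lipschitz ℝ hC)

namespace IsConeAt

variable {p N : E n} {ρ c : ℝ}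

theorem le_inner_gradient_signedDist (h : IsConeAt U p N ρ c) {x : E n}
    (hx : x ∈ Metric.ball p (ρ / 6)) (hd : DifferentiableAt ℝ (signedDist U) x) :
    c ≤ inner ℝ (gradient (signedDist U) x) N := by
  rw [inner_gradient_left]
  have hline : HasDerivAt (fun t : ℝ => signedDist U (x + t • N))
      (fderiv ℝ (signedDist U) x N) 0 := hd.hasFDerivAt.hasLineDerivAt N
  have hcont : Tendsto (fun t : ℝ => x + t • N) (𝓝[>] 0) (𝓝 x) :=
    (Continuous.tendsto' (by fun_prop) 0 x (by simp)).mono_left nhdsWithin_le_nhds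
  refine ge_of_tendsto hline.tendsto_slope_zero_right ?_
  filter_upwards [self_mem_nhdsWithin, hcont (Metric.isOpen_ball.mem_nhds hx)] with t ht htb
  have hgrow := h.signedDist_add_le ht hx htb
  simp only [zero_add, zero_smul, add_zero, smul_eq_mul]
  rw [inv_mul_eq_div, le_div_iff₀ ht]
  linarith

theorem ae_lineDeriv_phase_le (h : IsConeAt U p N ρ c) (ε : ℝ) :
    ∀ᵐ x : E n, lineDeriv ℝ (phase U ε) x N ≤ ‖gradient (phase U ε) x‖ := by
  filter_upwards [ae_differentiableAt_signedDist U] with x hx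
  rw [(hasGradientAt_phase hx ε).differentiableAt.lineDeriv_eq_fderiv, ← inner_gradient_left]
  simpa only [h.norm_axis, mul_one] using real_inner_le_norm (gradient (phase U ε) x) N

theorem ae_le_lineDeriv_phase (h : IsConeAt U p N ρ c) (hε : 0 < ε) :
    ∀ᵐ x : E n, x ∈ Metric.ball p (ρ / 6) →
      c * ‖gradient (phase U ε) x‖ ≤ lineDeriv ℝ (phase U ε) x N := by
  filter_upwards [ae_differentiableAt_signedDist U] with x hx hxb
  have hgrad := hasGradientAt_phase hx ε
  have htanh := one_sub_tanh_sq_nonneg (signedDist U x / ε)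
  rw [hgrad.differentiableAt.lineDeriv_eq_fderiv, ← inner_gradient_left, hgrad.gradient,
    norm_smul, real_inner_smul_left, Real.norm_of_nonneg (by positivity), mul_left_comm]
  gcongr
  calc c * ‖gradient (signedDist U) x‖ ≤ c :=
        mul_le_of_le_one_right h.rate_pos.le (norm_gradient_signedDist_le x)
    _ ≤ inner ℝ (gradient (signedDist U) x) N := h.le_inner_gradient_signedDist hxb hx

theorem mul_integral_norm_gradient_phase_le (h : IsConeAt U p N ρ c) (hε : 0 < ε) {F : E n → ℝ}
    (hF : ContDiff ℝ 1 F) (hFc : HasCompactSupport F) (hF0 : ∀ x, 0 ≤ F x)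
    (hFs : tsupport F ⊆ Metric.ball p (ρ / 6)) :
    c * ∫ x, F x * ‖gradient (phase U ε) x‖ ≤ -∫ x, phase U ε x * fderiv ℝ F x N := by
  have hFi : Integrable F := hF.continuous.integrable_of_hasCompactSupport hFc
  rw [← integral_lineDeriv_phase_mul U ε hF hFc N, ← integral_const_mul]
  refine integral_mono_ae ((integrable_mul_norm_gradient_phase hε .rfl hFi).const_mul c)
    (integrable_lineDeriv_phase_mul U ε hFi N) ?_
  filter_upwards [h.ae_le_lineDeriv_phase hε] with x hx
  by_cases hxs : x ∈ tsupport F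
  · rw [mul_left_comm, mul_comm (F x)]
    exact mul_le_mul_of_nonneg_right (hx (hFs hxs)) (hF0 x)
  · simp [image_eq_zero_of_notMem_tsupport hxs]

theorem le_integral_norm_gradient_phase (h : IsConeAt U p N ρ c) (hε : 0 < ε) {F : E n → ℝ}
    (hF : ContDiff ℝ 1 F) (hFc : HasCompactSupport F) (hF0 : ∀ x, 0 ≤ F x) :
    -∫ x, phase U ε x * fderiv ℝ F x N ≤ ∫ x, F x * ‖gradient (phase U ε) x‖ := by
  have hFi : Integrable F := hF.continuous.integrable_of_hasCompactSupport hFc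
  rw [← integral_lineDeriv_phase_mul U ε hF hFc N]
  refine integral_mono_ae (integrable_lineDeriv_phase_mul U ε hFi N)
    (integrable_mul_norm_gradient_phase hε .rfl hFi) ?_
  filter_upwards [h.ae_lineDeriv_phase_le ε] with x hx
  rw [mul_comm]
  exact mul_le_mul_of_nonneg_left hx (hF0 x)

end IsConeAt

end Phase

/-! ### The surface measure and the divergence theorem near the boundary -/

section HausdorffMeasure

variable {X Y : Type*} [EMetricSpace X] [EMetricSpace Y] [MeasurableSpace X] [BorelSpace X]
  [MeasurableSpace Y] [BorelSpace Y] {K : NNReal}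

theorem euclideanHausdorffMeasure_image_le {f : X → Y} (hf : LipschitzWith K f) (d : ℕ)
    (s : Set X) :
    Measure.euclideanHausdorffMeasure d (f '' s) ≤
      (K : ENNReal) ^ d * Measure.euclideanHausdorffMeasure d s := by
  simp_rw [Measure.euclideanHausdorffMeasure_def, Measure.smul_apply, ENNReal.smul_def,
    smul_eq_mul]
  rw [mul_left_comm, ← ENNReal.rpow_natCast]
  gcongr
  exact hf.hausdorffMeasure_image_le (Nat.cast_nonneg d) s

theorem restrict_euclideanHausdorffMeasure_le_map {f : X → Y} {g : Y → X} {A : Set Y}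
    (hf : LipschitzWith K f) (hfg : ∀ y ∈ A, f (g y) = y) (d : ℕ) :
    (Measure.euclideanHausdorffMeasure d).restrict A ≤
      (K : ENNReal) ^ d • ((Measure.euclideanHausdorffMeasure d).restrict (f ⁻¹' A)).map f := by
  have hfm : Measurable f := hf.continuous.measurable
  refine Measure.le_iff.2 fun S hS => ?_
  rw [Measure.smul_apply, Measure.map_apply hfm hS, Measure.restrict_apply (hfm hS),
    Measure.restrict_apply hS, smul_eq_mul, ← Set.preimage_inter]
  have hsub : S ∩ A ⊆ f '' (f ⁻¹' (S ∩ A)) := fun y hy =>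
    ⟨g y, by rwa [Set.mem_preimage, hfg y hy.2], hfg y hy.2⟩
  exact (measure_mono hsub).trans (euclideanHausdorffMeasure_image_le hf d _)

theorem map_restrict_euclideanHausdorffMeasure_le {f : X → Y} {g : Y → X} (hf : Measurable f)
    (hg : LipschitzWith K g) (hgf : Function.LeftInverse g f) (A : Set Y) (d : ℕ) :
    ((Measure.euclideanHausdorffMeasure d).restrict (f ⁻¹' A)).map f ≤
      (K : ENNReal) ^ d • (Measure.euclideanHausdorffMeasure d).restrict A := by
  refine Measure.le_iff.2 fun S hS => ?_
  rw [Measure.smul_apply, Measure.map_apply hf hS, Measure.restrict_apply (hf hS),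
    Measure.restrict_apply hS, smul_eq_mul, ← Set.preimage_inter]
  have hsub : f ⁻¹' (S ∩ A) ⊆ g '' (S ∩ A) := fun x hx => ⟨f x, hx, hgf x⟩
  exact (measure_mono hsub).trans (euclideanHausdorffMeasure_image_le hg d _)

end HausdorffMeasure

section IntegralDeriv

variable {f : ℝ → ℝ} {S : Set ℝ}

theorem integral_indicator_deriv_of_mem_iff (hf : ContDiff ℝ 1 f) (hfc : HasCompactSupport f)
    {a : ℝ} (hS : ∀ s ∈ tsupport f, s ∈ S ↔ a < s) :
    ∫ s, S.indicator (deriv f) s = -f a := by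
  rw [← hfc.integral_Ioi_deriv_eq hf a, ← integral_indicator measurableSet_Ioi]
  congr 1
  funext s
  by_cases hs : s ∈ tsupport f
  · by_cases h : a < s
    · rw [Set.indicator_of_mem ((hS s hs).2 h), Set.indicator_of_mem (Set.mem_Ioi.2 h)]
    · rw [Set.indicator_of_notMem (mt (hS s hs).1 h),
        Set.indicator_of_notMem (mt Set.mem_Ioi.1 h)]
  · have hderiv : deriv f s = 0 := Function.notMem_support.1 fun h => hs (support_deriv_subset h)
    rw [Set.indicator_apply_eq_zero.2 fun _ => hderiv,
      Set.indicator_apply_eq_zero.2 fun _ => hderiv]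

theorem integral_indicator_deriv_eq_zero (hf : ContDiff ℝ 1 f) (hfc : HasCompactSupport f)
    (hS : ∀ s ∈ tsupport f, ∀ t ∈ tsupport f, s ∈ S → t ∈ S) :
    ∫ s, S.indicator (deriv f) s = 0 := by
  suffices ∃ a ∉ tsupport f, ∀ s ∈ tsupport f, s ∈ S ↔ a < s by
    obtain ⟨a, ha, hSa⟩ := this
    rw [integral_indicator_deriv_of_mem_iff hf hfc hSa, image_eq_zero_of_notMem_tsupport ha,
      neg_zero]
  by_cases h : ∃ s ∈ tsupport f, s ∈ S
  · obtain ⟨s, hs, hsS⟩ := h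
    obtain ⟨a, ha⟩ := hfc.isCompact.bddBelow
    exact ⟨a - 1, fun h => by linarith [ha h], fun t ht =>
      ⟨fun _ => by linarith [ha ht], fun _ => hS s hs t ht hsS⟩⟩
  · push Not at h
    obtain ⟨b, hb⟩ := hfc.isCompact.bddAbove
    exact ⟨b + 1, fun h => by linarith [hb h], fun t ht =>
      ⟨fun htS => absurd htS (h t ht), fun hbt => by linarith [hb ht]⟩⟩

end IntegralDeriv

section Coordinates

variable {n : ℕ} {N : E n}

/-- The hyperplane orthogonal to `N`, over which the boundary is represented as a graph. -/
abbrev hyperplane (N : E n) : Submodule ℝ (E n) := (Submodule.span ℝ {N})ᗮ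

/-- The point with coordinate `q.1` along `N` and component `q.2` orthogonal to `N`. -/
def lineCoord (N : E n) (q : ℝ × hyperplane N) : E n := q.2 + q.1 • N

/-- The orthogonal projection onto the hyperplane orthogonal to `N`. -/
def hyperplaneProj (N : E n) : E n →L[ℝ] hyperplane N :=
  (hyperplane N).orthogonalProjectionOnto

/-- The parametrization `y ↦ y + ψ(y) N` of the graph of `ψ` in the direction `N`. -/
def graphMap (N : E n) (ψ : hyperplane N → ℝ) (y : hyperplane N) : E n := lineCoord N (ψ y, y)

theorem exists_measurableEquiv_eq_lineCoord (hN : ‖N‖ = 1) :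
    ∃ m : ℝ × hyperplane N ≃ᵐ E n,
      MeasurePreserving m (volume.prod volume) volume ∧ ⇑m = lineCoord N := by
  let eLine : ℝ ≃ₗᵢ[ℝ] (Submodule.span ℝ {N}) := LinearIsometryEquiv.toSpanUnitSingleton N hN
  let mProd : ℝ × hyperplane N ≃ᵐ (Submodule.span ℝ {N}) × hyperplane N :=
    eLine.toHomeomorph.toMeasurableEquiv.prodCongr (MeasurableEquiv.refl _)
  have hProd : MeasurePreserving mProd (volume.prod volume) (volume.prod volume) :=
    eLine.measurePreserving.prod (MeasurePreserving.id _)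
  have hSplit := ((Submodule.span ℝ {N}).measurePreserving_measurableEquivProd (0 : E n)).symm
  rw [show (Measure.euclideanHausdorffMeasure (Module.finrank ℝ (E n)) : Measure (E n)) = volume
    from InnerProductSpace.euclideanHausdorffMeasure_eq_volume] at hSplit
  refine ⟨mProd.trans ((Submodule.span ℝ {N}).measurableEquivProd (0 : E n)).symm,
    hSplit.comp hProd, funext fun q => ?_⟩
  simp only [MeasurableEquiv.trans_apply, Submodule.measurableEquivProd_symm_apply, vadd_eq_add,
    add_zero, lineCoord]
  exact add_comm _ _

theorem hyperplaneProj_add (hN : ‖N‖ = 1) (x : E n) :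
    (hyperplaneProj N x : E n) + inner ℝ N x • N = x := by
  have h := Submodule.starProjection_add_starProjection_orthogonal (K := Submodule.span ℝ {N}) x
  rwa [Submodule.starProjection_unit_singleton ℝ hN x, add_comm] at h

theorem hyperplaneProj_lineCoord (s : ℝ) (y : hyperplane N) :
    hyperplaneProj N (lineCoord N (s, y)) = y := by
  unfold lineCoord hyperplaneProj
  rw [map_add, map_smul, Submodule.orthogonalProjectionOnto_orthogonalComplement_singleton_eq_zero,
    smul_zero, add_zero, Submodule.orthogonalProjectionOnto_mem_subspace_eq_self]

theorem lipschitzWith_hyperplaneProj (N : E n) : LipschitzWith 1 (hyperplaneProj N) :=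
  Submodule.lipschitzWith_orthogonalProjectionOnto _

theorem lipschitzWith_graphMap (hN : ‖N‖ = 1) {ψ : hyperplane N → ℝ} {K : NNReal}
    (hψ : LipschitzWith K ψ) : LipschitzWith (1 + K) (graphMap N ψ) := by
  have hline := (LinearIsometry.toSpanSingleton ℝ (E n) hN).lipschitz.comp hψ
  rw [one_mul] at hline
  exact (LipschitzWith.subtype_val (hyperplane N : Set (E n))).add hline

theorem euclideanHausdorffMeasure_hyperplane (hN : ‖N‖ = 1) :
    (Measure.euclideanHausdorffMeasure (n - 1) : Measure (hyperplane N)) = volume := by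
  have hN0 : N ≠ 0 := norm_ne_zero_iff.1 (hN ▸ one_ne_zero)
  have hsum := (Submodule.span ℝ {N}).finrank_add_finrank_orthogonal
  rw [finrank_span_singleton hN0, finrank_euclideanSpace_fin] at hsum
  have hrank : 1 + Module.finrank ℝ (hyperplane N) = n := hsum
  rw [show n - 1 = Module.finrank ℝ (hyperplane N) by omega]
  exact InnerProductSpace.euclideanHausdorffMeasure_eq_volume

theorem isometry_lineCoord (hN : ‖N‖ = 1) (y : hyperplane N) :
    Isometry fun s : ℝ => lineCoord N (s, y) :=
  (isometry_add_left (y : E n)).comp (LinearIsometry.toSpanSingleton ℝ (E n) hN).isometry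

theorem contDiff_lineCoord (N : E n) (y : hyperplane N) :
    ContDiff ℝ 1 fun s : ℝ => lineCoord N (s, y) := by
  change ContDiff ℝ 1 fun s : ℝ => (y : E n) + s • N
  fun_prop

theorem deriv_comp_lineCoord {F : E n → ℝ} (hF : Differentiable ℝ F) (y : hyperplane N) (s : ℝ) :
    deriv (fun s => F (lineCoord N (s, y))) s = fderiv ℝ F (lineCoord N (s, y)) N := by
  have hline : HasDerivAt (fun s : ℝ => lineCoord N (s, y)) N s := by
    simpa only [lineCoord, one_smul, id] using ((hasDerivAt_id s).smul_const N).const_add (y : E n)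
  exact ((hF _).hasFDerivAt.comp_hasDerivAt s hline).deriv

theorem exists_eq_lineCoord_of_mem_segment {s t : ℝ} {y : hyperplane N} {z : E n}
    (hz : z ∈ segment ℝ (lineCoord N (s, y)) (lineCoord N (t, y))) :
    ∃ a, z = lineCoord N (a, y) := by
  obtain ⟨a, b, -, -, hab, rfl⟩ := hz
  refine ⟨a * s + b * t, ?_⟩
  simp only [lineCoord, smul_add, smul_smul, add_smul]
  rw [add_add_add_comm, ← add_smul, hab, one_smul]

end Coordinates

theorem lintegral_surfaceMeasure_eq_of_support_subset {n : ℕ} {U B : Set (E n)}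
    (hB : MeasurableSet B) {f : E n → ENNReal} (hf : Function.support f ⊆ B) :
    ∫⁻ x, f x ∂surfaceMeasure U =
      ∫⁻ x, f x ∂(Measure.euclideanHausdorffMeasure (n - 1)).restrict (frontier U ∩ B) := by
  rw [surfaceMeasure, Set.inter_comm, ← Measure.restrict_restrict hB,
    setLIntegral_eq_of_support_subset hf]

theorem support_ofReal_subset_tsupport {X : Type*} [TopologicalSpace X] (f : X → ℝ) :
    (Function.support fun x => ENNReal.ofReal (f x)) ⊆ tsupport f :=
  (Function.support_comp_subset ENNReal.ofReal_zero f).trans (subset_tsupport f)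

namespace IsConeAt

variable {n : ℕ} {U : Set (E n)} {p N : E n} {ρ c : ℝ}

theorem inner_sub_le (h : IsConeAt U p N ρ c) {x x' : E n}
    (hx : x ∈ frontier U ∩ Metric.ball p ρ) (hx' : x' ∈ frontier U ∩ Metric.ball p ρ) :
    inner ℝ N (x' - x) ≤ (1 - c) * ‖x' - x‖ := by
  by_contra! hlt
  have hne : x ≠ x' := by
    rintro rfl
    simp at hlt
  refine (h.isOpen.frontier_eq ▸ hx'.1).2
    (h.cone x (frontier_subset_closure hx.1) x' hx.2 hx'.2 hne (le_trans ?_ hlt.le))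
  exact mul_le_mul_of_nonneg_right h.slope_le (norm_nonneg _)

theorem abs_inner_sub_le (h : IsConeAt U p N ρ c) {x x' : E n}
    (hx : x ∈ frontier U ∩ Metric.ball p ρ) (hx' : x' ∈ frontier U ∩ Metric.ball p ρ) :
    |inner ℝ N (x - x')| ≤ (1 - c) * ‖x - x'‖ := by
  have hneg := h.inner_sub_le hx hx'
  rw [← neg_sub, inner_neg_right, norm_neg] at hneg
  exact abs_le.2 ⟨by linarith, h.inner_sub_le hx' hx⟩

theorem norm_sub_le_hyperplaneProj (h : IsConeAt U p N ρ c) {x x' : E n}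
    (hx : x ∈ frontier U ∩ Metric.ball p ρ) (hx' : x' ∈ frontier U ∩ Metric.ball p ρ) :
    ‖x - x'‖ ≤ c⁻¹ * ‖hyperplaneProj N x - hyperplaneProj N x'‖ := by
  have hsplit : ‖x - x'‖ ≤ ‖hyperplaneProj N (x - x')‖ + |inner ℝ N (x - x')| := by
    calc ‖x - x'‖ = ‖(hyperplaneProj N (x - x') : E n) + inner ℝ N (x - x') • N‖ := by
          rw [hyperplaneProj_add h.norm_axis]
      _ ≤ _ := (norm_add_le _ _).trans_eq (by
          rw [norm_smul, h.norm_axis, mul_one, Submodule.coe_norm, Real.norm_eq_abs])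
  rw [map_sub] at hsplit
  rw [inv_mul_eq_div, le_div_iff₀ h.rate_pos]
  linarith [h.abs_inner_sub_le hx hx']

theorem exists_graph (h : IsConeAt U p N ρ c) :
    ∃ ψ : hyperplane N → ℝ, LipschitzWith (Real.toNNReal c⁻¹) (graphMap N ψ) ∧
      ∀ x ∈ frontier U ∩ Metric.ball p ρ, graphMap N ψ (hyperplaneProj N x) = x := by
  have hc := h.rate_pos
  have hc1 : 0 ≤ 1 - c := by linarith [h.rate_lt_one]
  set A := frontier U ∩ Metric.ball p ρ
  have hinj : Set.InjOn (hyperplaneProj N) A := fun x hx x' hx' heq => by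
    have hle := h.norm_sub_le_hyperplaneProj hx hx'
    rw [heq, sub_self, norm_zero, mul_zero] at hle
    exact sub_eq_zero.1 (norm_le_zero_iff.1 hle)
  have hinv := hinj.leftInvOn_invFunOn
  have hlip : LipschitzOnWith (Real.toNNReal ((1 - c) * c⁻¹))
      (fun y => inner ℝ N (Function.invFunOn (hyperplaneProj N) A y)) (hyperplaneProj N '' A) := by
    refine LipschitzOnWith.of_dist_le_mul ?_
    rintro _ ⟨x, hx, rfl⟩ _ ⟨x', hx', rfl⟩
    rw [Real.coe_toNNReal _ (by positivity), Real.dist_eq, dist_eq_norm, hinv hx, hinv hx',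
      ← inner_sub_right, mul_assoc]
    exact (h.abs_inner_sub_le hx hx').trans
      (mul_le_mul_of_nonneg_left (h.norm_sub_le_hyperplaneProj hx hx') hc1)
  obtain ⟨ψ, hψ, hψeq⟩ := hlip.extend_real
  refine ⟨ψ, (lipschitzWith_graphMap h.norm_axis hψ).weaken ?_, fun x hx => ?_⟩
  · rw [← NNReal.coe_le_coe, NNReal.coe_add, Real.coe_toNNReal _ (by positivity),
      Real.coe_toNNReal _ (by positivity), NNReal.coe_one, sub_mul, mul_inv_cancel₀ hc.ne']
    linarith
  · have hval := hψeq (Set.mem_image_of_mem _ hx)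
    simp only [hinv hx] at hval
    rw [graphMap, lineCoord, ← hval]
    exact hyperplaneProj_add h.norm_axis x

theorem lineCoord_mem (h : IsConeAt U p N ρ c) {s t : ℝ} {y : hyperplane N} (hst : s < t)
    (hs : lineCoord N (s, y) ∈ closure U) (hsb : lineCoord N (s, y) ∈ Metric.ball p ρ)
    (htb : lineCoord N (t, y) ∈ Metric.ball p ρ) : lineCoord N (t, y) ∈ U := by
  refine h.mem_of_norm_sub_le hs hsb htb (sub_pos.2 hst) ?_
  have hzero : lineCoord N (t, y) - lineCoord N (s, y) - (t - s) • N = 0 := by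
    simp only [lineCoord]
    module
  rw [hzero, norm_zero]
  exact mul_nonneg h.rate_pos.le (sub_pos.2 hst).le

theorem lineCoord_mem_iff_lt (h : IsConeAt U p N ρ c) {a s : ℝ} {y : hyperplane N}
    (ha : lineCoord N (a, y) ∈ frontier U ∩ Metric.ball p ρ)
    (hsb : lineCoord N (s, y) ∈ Metric.ball p ρ) : lineCoord N (s, y) ∈ U ↔ a < s := by
  have hnot : lineCoord N (a, y) ∉ U := (h.isOpen.frontier_eq ▸ ha.1).2
  refine ⟨fun hsU => ?_, fun hlt => h.lineCoord_mem hlt (frontier_subset_closure ha.1) ha.2 hsb⟩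
  by_contra! hle
  rcases hle.eq_or_lt with rfl | hlt
  · exact hnot hsU
  · exact hnot (h.lineCoord_mem hlt (subset_closure hsU) hsb ha.2)

theorem integral_indicator_fderiv_lineCoord (h : IsConeAt U p N ρ c) {ψ : hyperplane N → ℝ}
    (hψ : ∀ x ∈ frontier U ∩ Metric.ball p ρ, graphMap N ψ (hyperplaneProj N x) = x)
    {F : E n → ℝ} (hF : ContDiff ℝ 1 F) (hFc : HasCompactSupport F)
    (hFs : tsupport F ⊆ Metric.ball p ρ) (y : hyperplane N) :
    ∫ s, U.indicator (fun x => fderiv ℝ F x N) (lineCoord N (s, y)) =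
      -(frontier U ∩ Metric.ball p ρ).indicator F (graphMap N ψ y) := by
  let f : ℝ → ℝ := fun s => F (lineCoord N (s, y))
  have hf : ContDiff ℝ 1 f := hF.comp (contDiff_lineCoord N y)
  have hfc : HasCompactSupport f :=
    hFc.comp_isClosedEmbedding (isometry_lineCoord h.norm_axis y).isClosedEmbedding
  have hfs : ∀ s ∈ tsupport f, lineCoord N (s, y) ∈ Metric.ball p ρ := fun s hs =>
    hFs (tsupport_comp_subset_preimage F (contDiff_lineCoord N y).continuous hs)
  have hint : (fun s => U.indicator (fun x => fderiv ℝ F x N) (lineCoord N (s, y))) =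
      {s | lineCoord N (s, y) ∈ U}.indicator (deriv f) := by
    classical
    funext s
    simp only [Set.indicator_apply, f, deriv_comp_lineCoord (hF.differentiable one_ne_zero) y s,
      Set.mem_ofPred_eq]
  rw [hint]
  by_cases hy : graphMap N ψ y ∈ frontier U ∩ Metric.ball p ρ
  · rw [Set.indicator_of_mem hy]
    exact integral_indicator_deriv_of_mem_iff hf hfc fun s hs =>
      h.lineCoord_mem_iff_lt hy (hfs s hs)
  · rw [Set.indicator_of_notMem hy, neg_zero]
    refine integral_indicator_deriv_eq_zero hf hfc fun s hs t ht hsU => ?_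
    by_contra htU
    obtain ⟨z, hz, hzf⟩ := exists_mem_segment_frontier
      (x := lineCoord N (s, y)) (y := lineCoord N (t, y)) hsU htU
    have hzb := (convex_ball p ρ).segment_subset (hfs s hs) (hfs t ht) hz
    obtain ⟨a, rfl⟩ := exists_eq_lineCoord_of_mem_segment hz
    have hgraph := hψ _ ⟨hzf, hzb⟩
    rw [hyperplaneProj_lineCoord] at hgraph
    exact hy (hgraph ▸ ⟨hzf, hzb⟩)

theorem integrable_and_setIntegral_fderiv_eq (h : IsConeAt U p N ρ c) {ψ : hyperplane N → ℝ}
    (hψ : ∀ x ∈ frontier U ∩ Metric.ball p ρ, graphMap N ψ (hyperplaneProj N x) = x)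
    {F : E n → ℝ} (hF : ContDiff ℝ 1 F) (hFc : HasCompactSupport F)
    (hFs : tsupport F ⊆ Metric.ball p ρ) :
    Integrable (fun y => (frontier U ∩ Metric.ball p ρ).indicator F (graphMap N ψ y)) ∧
      -∫ x in U, fderiv ℝ F x N =
        ∫ y, (frontier U ∩ Metric.ball p ρ).indicator F (graphMap N ψ y) := by
  have hline := fun y => h.integral_indicator_fderiv_lineCoord hψ hF hFc hFs y
  have hcont : Continuous fun x => fderiv ℝ F x N :=
    (hF.continuous_fderiv one_ne_zero).clm_apply continuous_const
  have hU : Integrable (U.indicator fun x => fderiv ℝ F x N) :=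
    (hcont.integrable_of_hasCompactSupport (hFc.fderiv_apply ℝ N)).indicator h.isOpen.measurableSet
  obtain ⟨m, hm, hmeq⟩ := exists_measurableEquiv_eq_lineCoord h.norm_axis
  have hprod : Integrable (fun q => U.indicator (fun x => fderiv ℝ F x N) (lineCoord N q))
      (volume.prod volume) := by
    rw [← hmeq]
    exact (hm.integrable_comp_emb m.measurableEmbedding).2 hU
  constructor
  · simpa only [hline, neg_neg, Pi.neg_def] using hprod.integral_prod_right.neg
  · rw [← integral_indicator h.isOpen.measurableSet, ← hm.integral_comp m.measurableEmbedding, hmeq,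
      integral_prod_symm _ hprod]
    simp only [hline, integral_neg, neg_neg]

theorem neg_setIntegral_fderiv_nonneg (h : IsConeAt U p N ρ c) {F : E n → ℝ}
    (hF : ContDiff ℝ 1 F) (hFc : HasCompactSupport F) (hF0 : ∀ x, 0 ≤ F x)
    (hFs : tsupport F ⊆ Metric.ball p ρ) : 0 ≤ -∫ x in U, fderiv ℝ F x N := by
  obtain ⟨ψ, -, hψ⟩ := h.exists_graph
  rw [(h.integrable_and_setIntegral_fderiv_eq hψ hF hFc hFs).2]
  exact integral_nonneg fun y => Set.indicator_nonneg (fun x _ => hF0 x) _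

theorem ofReal_neg_setIntegral_fderiv (h : IsConeAt U p N ρ c) {ψ : hyperplane N → ℝ}
    (hψm : Measurable (graphMap N ψ))
    (hψ : ∀ x ∈ frontier U ∩ Metric.ball p ρ, graphMap N ψ (hyperplaneProj N x) = x)
    {F : E n → ℝ} (hF : ContDiff ℝ 1 F) (hFc : HasCompactSupport F) (hF0 : ∀ x, 0 ≤ F x)
    (hFs : tsupport F ⊆ Metric.ball p ρ) :
    ENNReal.ofReal (-∫ x in U, fderiv ℝ F x N) = ∫⁻ x, ENNReal.ofReal (F x)
      ∂((Measure.euclideanHausdorffMeasure (n - 1)).restrict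
        (graphMap N ψ ⁻¹' (frontier U ∩ Metric.ball p ρ))).map (graphMap N ψ) := by
  obtain ⟨hint, heq⟩ := h.integrable_and_setIntegral_fderiv_eq hψ hF hFc hFs
  have hA : MeasurableSet (frontier U ∩ Metric.ball p ρ) :=
    isClosed_frontier.measurableSet.inter measurableSet_ball
  rw [heq, ofReal_integral_eq_lintegral_ofReal hint
      (.of_forall fun y => Set.indicator_nonneg (fun x _ => hF0 x) _),
    lintegral_map hF.continuous.measurable.ennreal_ofReal hψm, ← lintegral_indicator (hψm hA),
    euclideanHausdorffMeasure_hyperplane h.norm_axis]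
  congr 1
  funext y
  by_cases hy : graphMap N ψ y ∈ frontier U ∩ Metric.ball p ρ
  · rw [Set.indicator_of_mem hy, Set.indicator_of_mem (Set.mem_preimage.2 hy)]
  · rw [Set.indicator_of_notMem hy, Set.indicator_of_notMem (mt Set.mem_preimage.1 hy),
      ENNReal.ofReal_zero]

theorem ofReal_neg_setIntegral_fderiv_le (h : IsConeAt U p N ρ c) {F : E n → ℝ}
    (hF : ContDiff ℝ 1 F) (hFc : HasCompactSupport F) (hF0 : ∀ x, 0 ≤ F x)
    (hFs : tsupport F ⊆ Metric.ball p ρ) :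
    ENNReal.ofReal (-∫ x in U, fderiv ℝ F x N) ≤
      ∫⁻ x, ENNReal.ofReal (F x) ∂surfaceMeasure U := by
  obtain ⟨ψ, hlip, hψ⟩ := h.exists_graph
  have hψm : Measurable (graphMap N ψ) := hlip.continuous.measurable
  rw [h.ofReal_neg_setIntegral_fderiv hψm hψ hF hFc hF0 hFs,
    lintegral_surfaceMeasure_eq_of_support_subset measurableSet_ball
      ((support_ofReal_subset_tsupport F).trans hFs)]
  refine lintegral_mono' ((map_restrict_euclideanHausdorffMeasure_le hψm
    (lipschitzWith_hyperplaneProj N) (fun y => hyperplaneProj_lineCoord (ψ y) y) _ _).trans ?_)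
    le_rfl
  rw [ENNReal.coe_one, one_pow, one_smul]

theorem lintegral_surfaceMeasure_le (h : IsConeAt U p N ρ c) {F : E n → ℝ}
    (hF : ContDiff ℝ 1 F) (hFc : HasCompactSupport F) (hF0 : ∀ x, 0 ≤ F x)
    (hFs : tsupport F ⊆ Metric.ball p ρ) :
    ∫⁻ x, ENNReal.ofReal (F x) ∂surfaceMeasure U ≤
      ENNReal.ofReal (c⁻¹ ^ (n - 1) * -∫ x in U, fderiv ℝ F x N) := by
  obtain ⟨ψ, hlip, hψ⟩ := h.exists_graph
  have hc : 0 ≤ c⁻¹ := inv_nonneg.2 h.rate_pos.le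
  rw [ENNReal.ofReal_mul (pow_nonneg hc _), ENNReal.ofReal_pow hc,
    h.ofReal_neg_setIntegral_fderiv hlip.continuous.measurable hψ hF hFc hF0 hFs,
    lintegral_surfaceMeasure_eq_of_support_subset measurableSet_ball
      ((support_ofReal_subset_tsupport F).trans hFs), ← smul_eq_mul, ← lintegral_smul_measure]
  exact lintegral_mono' (restrict_euclideanHausdorffMeasure_le_map hlip hψ _) le_rfl

theorem neg_setIntegral_fderiv_le (h : IsConeAt U p N ρ c) {F : E n → ℝ}
    (hF : ContDiff ℝ 1 F) (hFc : HasCompactSupport F) (hF0 : ∀ x, 0 ≤ F x)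
    (hFs : tsupport F ⊆ Metric.ball p ρ) :
    -∫ x in U, fderiv ℝ F x N ≤ ∫ x, F x ∂surfaceMeasure U := by
  rw [integral_eq_lintegral_of_nonneg_ae (.of_forall hF0) hF.continuous.aestronglyMeasurable,
    ← ENNReal.ofReal_le_iff_le_toReal
      ((h.lintegral_surfaceMeasure_le hF hFc hF0 hFs).trans_lt ENNReal.ofReal_lt_top).ne]
  exact h.ofReal_neg_setIntegral_fderiv_le hF hFc hF0 hFs

theorem integral_surfaceMeasure_le (h : IsConeAt U p N ρ c) {F : E n → ℝ}
    (hF : ContDiff ℝ 1 F) (hFc : HasCompactSupport F) (hF0 : ∀ x, 0 ≤ F x)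
    (hFs : tsupport F ⊆ Metric.ball p ρ) :
    ∫ x, F x ∂surfaceMeasure U ≤ c⁻¹ ^ (n - 1) * -∫ x in U, fderiv ℝ F x N := by
  rw [integral_eq_lintegral_of_nonneg_ae (.of_forall hF0) hF.continuous.aestronglyMeasurable]
  exact ENNReal.toReal_le_of_le_ofReal
    (mul_nonneg (pow_nonneg (inv_nonneg.2 h.rate_pos.le) _)
      (h.neg_setIntegral_fderiv_nonneg hF hFc hF0 hFs))
    (h.lintegral_surfaceMeasure_le hF hFc hF0 hFs)

end IsConeAt

/-! ### Weak convergence of the diffuse surface measures -/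

section Partition

variable {n : ℕ} {U O : Set (E n)} {c : ℝ}

/-- A finite smooth partition of unity near the boundary of `U`, subordinate to `O` and to balls in
which `U` satisfies a cone condition of rate `c`. The balls are shrunk by a factor `6`, the margin
needed to compare the distances to the boundary along the axis of the cone. -/
structure BoundaryPartition (U O : Set (E n)) (c : ℝ) where
  ι : Type
  fintype : Fintype ι
  p : ι → E n
  N : ι → E n
  ρ : ι → ℝ
  χ : ι → E n → ℝ
  d : ℝ
  isConeAt : ∀ i, IsConeAt U (p i) (N i) (ρ i) c
  contDiff : ∀ i, ContDiff ℝ 1 (χ i)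
  hasCompactSupport : ∀ i, HasCompactSupport (χ i)
  nonneg : ∀ i x, 0 ≤ χ i x
  tsupport_subset : ∀ i, tsupport (χ i) ⊆ O
  tsupport_subset_ball : ∀ i, tsupport (χ i) ⊆ Metric.ball (p i) (ρ i / 6)
  d_pos : 0 < d
  sum_le_one : ∀ x, ∑ i, χ i x ≤ 1
  sum_eq_one : ∀ x, Metric.infDist x (frontier U) ≤ d → ∑ i, χ i x = 1

attribute [instance] BoundaryPartition.fintype

open scoped Manifold in
theorem exists_boundaryPartition (hU : HasCkBoundary 1 U) (hUo : IsOpen U)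
    (hcpt : IsCompact (frontier U)) (hne : (frontier U).Nonempty) (hO : IsOpen O)
    (hUO : frontier U ⊆ O) (hc : 0 < c) (hc1 : c < 1) : Nonempty (BoundaryPartition U O c) := by
  have hex : ∀ p : frontier U, ∃ (N : E n) (ρ : ℝ), IsConeAt U p N ρ c := fun p =>
    hU.exists_isConeAt hUo p.2 hc hc1
  choose N ρ hcone using hex
  let V : frontier U → Set (E n) := fun p => Metric.ball (p : E n) (ρ p / 6) ∩ O
  have hVo : ∀ p, IsOpen (V p) := fun p => Metric.isOpen_ball.inter hO
  obtain ⟨t, ht⟩ := hcpt.elim_finite_subcover V hVo fun x hx => Set.mem_iUnion.2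
    ⟨⟨x, hx⟩, Metric.mem_ball_self (div_pos (hcone ⟨x, hx⟩).radius_pos (by norm_num)), hUO hx⟩
  obtain ⟨d, hd, hdsub⟩ := hcpt.exists_cthickening_subset_open
    (isOpen_biUnion fun p (_ : p ∈ t) => hVo p) ht
  obtain ⟨f, hf⟩ := SmoothPartitionOfUnity.exists_isSubordinate 𝓘(ℝ, E n)
    (s := Metric.cthickening d (frontier U)) Metric.isClosed_cthickening (fun i : t => V i)
    (fun i => hVo i) (fun x hx => by
      obtain ⟨p, hp, hxp⟩ := Set.mem_iUnion₂.1 (hdsub hx)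
      exact Set.mem_iUnion.2 ⟨⟨p, hp⟩, hxp⟩)
  have hball : ∀ i, tsupport (f i) ⊆ Metric.ball (i : E n) (ρ i / 6) := fun i =>
    (hf i).trans Set.inter_subset_left
  refine ⟨⟨t, inferInstance, fun i => i.1, fun i => N i, fun i => ρ i, fun i => f i, d,
    fun i => hcone i, fun i => (f i).contMDiff.contDiff.of_le (by exact_mod_cast le_top),
    fun i => ?_, fun i x => f.nonneg i x, fun i => (hf i).trans Set.inter_subset_right, hball, hd,
    fun x => ?_, fun x hx => ?_⟩⟩
  · exact Metric.isCompact_of_isClosed_isBounded (isClosed_tsupport _)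
      (Metric.isBounded_ball.subset (hball i))
  · rw [← finsum_eq_sum_of_fintype]
    exact f.sum_le_one x
  · rw [← finsum_eq_sum_of_fintype]
    refine f.sum_eq_one ?_
    rwa [Metric.mem_cthickening_iff,
      ENNReal.le_ofReal_iff_toReal_le (Metric.infEDist_ne_top hne) hd.le]

theorem ae_surfaceMeasure_mem_frontier (U : Set (E n)) :
    ∀ᵐ x ∂surfaceMeasure U, x ∈ frontier U :=
  ae_restrict_mem isClosed_frontier.measurableSet

theorem volume_frontier_eq_zero (hn : 1 ≤ n) (U : Set (E n)) [IsFiniteMeasure (surfaceMeasure U)] :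
    volume (frontier U) = 0 := by
  have hfin := measure_lt_top (surfaceMeasure U) Set.univ
  rw [surfaceMeasure, Measure.restrict_apply_univ] at hfin
  have hzero := (Measure.euclideanHausdorffMeasure_zero_or_top (show n - 1 < n by omega)
    (frontier U)).resolve_right hfin.ne
  rwa [EuclideanSpace.euclideanHausdorffMeasure_eq_volume] at hzero

theorem tendsto_integral_phase_mul (hUo : IsOpen U) (hne : (frontier U).Nonempty)
    (hnull : volume (frontier U) = 0) {f : E n → ℝ} (hf : Integrable f) :
    Tendsto (fun ε => ∫ x, phase U ε x * f x) (𝓝[>] 0) (𝓝 (∫ x in U, f x)) := by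
  rw [← integral_indicator hUo.measurableSet]
  refine tendsto_integral_filter_of_dominated_convergence (fun x => ‖f x‖)
    (.of_forall fun ε => (continuous_phase U ε).aestronglyMeasurable.mul hf.1)
    (.of_forall fun ε => .of_forall fun x => ?_) hf.norm ?_
  · rw [norm_mul]
    exact mul_le_of_le_one_left (norm_nonneg _) (abs_phase_le_one x)
  · filter_upwards [measure_eq_zero_iff_ae_notMem.1 hnull] with x hx
    have hlim := (tendsto_phase hne hx).mul_const (f x)
    rwa [← Set.indicator_mul_left, funext fun x => one_mul (f x)] at hlim

namespace BoundaryPartition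

variable (P : BoundaryPartition U O c) {F : E n → ℝ}

/-- The sum of the functions of the partition, a cutoff function equal to `1` near the boundary. -/
def cutoff (x : E n) : ℝ := ∑ i, P.χ i x

/-- The flux `∑ᵢ -∫_U ∂(χᵢ F)/∂Nᵢ`, which approximates the surface integral of `F`. -/
def sharpFlux (F : E n → ℝ) : ℝ :=
  ∑ i, -∫ x in U, fderiv ℝ (fun x => P.χ i x * F x) x (P.N i)

/-- The flux `∑ᵢ -∫ φ_ε ∂(χᵢ F)/∂Nᵢ`, the diffuse counterpart of `sharpFlux`. -/
def diffuseFlux (ε : ℝ) (F : E n → ℝ) : ℝ :=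
  ∑ i, -∫ x, phase U ε x * fderiv ℝ (fun x => P.χ i x * F x) x (P.N i)

include P

theorem tsupport_subset_ball_radius (i : P.ι) :
    tsupport (P.χ i) ⊆ Metric.ball (P.p i) (P.ρ i) :=
  (P.tsupport_subset_ball i).trans
    (Metric.ball_subset_ball (by linarith [(P.isConeAt i).radius_pos]))

theorem cutoff_nonneg (x : E n) : 0 ≤ P.cutoff x := Finset.sum_nonneg fun i _ => P.nonneg i x

theorem cutoff_le_one (x : E n) : P.cutoff x ≤ 1 := P.sum_le_one x

theorem continuous_cutoff : Continuous P.cutoff :=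
  continuous_finsetSum _ fun i _ => (P.contDiff i).continuous

theorem ae_cutoff_eq_one : ∀ᵐ x ∂surfaceMeasure U, P.cutoff x = 1 := by
  filter_upwards [ae_surfaceMeasure_mem_frontier U] with x hx
  exact P.sum_eq_one x ((Metric.infDist_zero_of_mem hx).trans_le P.d_pos.le)

theorem integral_cutoff_mul {μ : Measure (E n)} (hF : ∀ i, Integrable (fun x => P.χ i x * F x) μ) :
    ∫ x, P.cutoff x * F x ∂μ = ∑ i, ∫ x, P.χ i x * F x ∂μ := by
  simp only [cutoff, Finset.sum_mul]
  exact integral_finsetSum _ fun i _ => hF i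

theorem isFiniteMeasure_surfaceMeasure : IsFiniteMeasure (surfaceMeasure U) := by
  refine ⟨?_⟩
  calc surfaceMeasure U Set.univ = ∫⁻ x, ∑ i, ENNReal.ofReal (P.χ i x) ∂surfaceMeasure U := by
        rw [← lintegral_one]
        refine lintegral_congr_ae ?_
        filter_upwards [P.ae_cutoff_eq_one] with x hx
        rw [← ENNReal.ofReal_sum_of_nonneg fun i _ => P.nonneg i x, ← cutoff, hx,
          ENNReal.ofReal_one]
    _ = ∑ i, ∫⁻ x, ENNReal.ofReal (P.χ i x) ∂surfaceMeasure U :=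
        lintegral_finsetSum _ fun i _ => (P.contDiff i).continuous.measurable.ennreal_ofReal
    _ < ⊤ := ENNReal.sum_lt_top.2 fun i _ =>
        ((P.isConeAt i).lintegral_surfaceMeasure_le (P.contDiff i) (P.hasCompactSupport i)
          (P.nonneg i) (P.tsupport_subset_ball_radius i)).trans_lt ENNReal.ofReal_lt_top

theorem hasCompactSupport_mul (i : P.ι) (F : E n → ℝ) :
    HasCompactSupport fun x => P.χ i x * F x :=
  (P.hasCompactSupport i).mul_right

theorem integrable_fderiv_mul (i : P.ι) (hF : ContDiff ℝ 1 F) (v : E n) :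
    Integrable fun x => fderiv ℝ (fun x => P.χ i x * F x) x v :=
  ((((P.contDiff i).mul hF).continuous_fderiv one_ne_zero).clm_apply
    continuous_const).integrable_of_hasCompactSupport
      ((P.hasCompactSupport_mul i F).fderiv_apply ℝ v)

theorem tendsto_diffuseFlux (hn : 1 ≤ n) (hUo : IsOpen U) (hne : (frontier U).Nonempty)
    (hF : ContDiff ℝ 1 F) :
    Tendsto (fun ε => P.diffuseFlux ε F) (𝓝[>] 0) (𝓝 (P.sharpFlux F)) := by
  have := P.isFiniteMeasure_surfaceMeasure
  exact tendsto_finsetSum _ fun i _ => (tendsto_integral_phase_mul hUo hne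
    (volume_frontier_eq_zero hn U) (P.integrable_fderiv_mul i hF (P.N i))).neg

theorem integral_surfaceMeasure_eq_sum (hF : Continuous F) :
    ∫ x, F x ∂surfaceMeasure U = ∑ i, ∫ x, P.χ i x * F x ∂surfaceMeasure U := by
  have := P.isFiniteMeasure_surfaceMeasure
  rw [← P.integral_cutoff_mul fun i => ((P.contDiff i).continuous.mul
    hF).integrable_of_hasCompactSupport (P.hasCompactSupport_mul i F)]
  refine integral_congr_ae ?_
  filter_upwards [P.ae_cutoff_eq_one] with x hx
  rw [hx, one_mul]

theorem sharpFlux_le_integral (hF : ContDiff ℝ 1 F) (hF0 : ∀ x, 0 ≤ F x) :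
    P.sharpFlux F ≤ ∫ x, F x ∂surfaceMeasure U := by
  rw [P.integral_surfaceMeasure_eq_sum hF.continuous]
  exact Finset.sum_le_sum fun i _ => (P.isConeAt i).neg_setIntegral_fderiv_le
    ((P.contDiff i).mul hF) (P.hasCompactSupport_mul i F)
    (fun x => mul_nonneg (P.nonneg i x) (hF0 x))
    ((tsupport_mul_subset_left (g := F)).trans (P.tsupport_subset_ball_radius i))

theorem integral_le_sharpFlux (hF : ContDiff ℝ 1 F) (hF0 : ∀ x, 0 ≤ F x) :
    ∫ x, F x ∂surfaceMeasure U ≤ c⁻¹ ^ (n - 1) * P.sharpFlux F := by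
  rw [P.integral_surfaceMeasure_eq_sum hF.continuous, sharpFlux, Finset.mul_sum]
  exact Finset.sum_le_sum fun i _ => (P.isConeAt i).integral_surfaceMeasure_le
    ((P.contDiff i).mul hF) (P.hasCompactSupport_mul i F)
    (fun x => mul_nonneg (P.nonneg i x) (hF0 x))
    ((tsupport_mul_subset_left (g := F)).trans (P.tsupport_subset_ball_radius i))

theorem integral_cutoff_mul_norm_gradient_phase (hF : Continuous F) {ε : ℝ} (hε : 0 < ε) :
    ∫ x, P.cutoff x * (F x * ‖gradient (phase U ε) x‖) =
      ∑ i, ∫ x, P.χ i x * F x * ‖gradient (phase U ε) x‖ := by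
  rw [P.integral_cutoff_mul fun i => ?_]
  · simp only [mul_assoc]
  · simp only [← mul_assoc]
    exact integrable_mul_norm_gradient_phase hε .rfl (((P.contDiff i).continuous.mul
      hF).integrable_of_hasCompactSupport (P.hasCompactSupport_mul i F))

theorem mul_integral_cutoff_le_diffuseFlux (hF : ContDiff ℝ 1 F) (hF0 : ∀ x, 0 ≤ F x) {ε : ℝ}
    (hε : 0 < ε) :
    c * ∫ x, P.cutoff x * (F x * ‖gradient (phase U ε) x‖) ≤ P.diffuseFlux ε F := by
  rw [P.integral_cutoff_mul_norm_gradient_phase hF.continuous hε, Finset.mul_sum]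
  exact Finset.sum_le_sum fun i _ => (P.isConeAt i).mul_integral_norm_gradient_phase_le hε
    ((P.contDiff i).mul hF) (P.hasCompactSupport_mul i F)
    (fun x => mul_nonneg (P.nonneg i x) (hF0 x))
    ((tsupport_mul_subset_left (g := F)).trans (P.tsupport_subset_ball i))

theorem diffuseFlux_le_integral_cutoff (hF : ContDiff ℝ 1 F) (hF0 : ∀ x, 0 ≤ F x) {ε : ℝ}
    (hε : 0 < ε) :
    P.diffuseFlux ε F ≤ ∫ x, P.cutoff x * (F x * ‖gradient (phase U ε) x‖) := by
  rw [P.integral_cutoff_mul_norm_gradient_phase hF.continuous hε]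
  exact Finset.sum_le_sum fun i _ => (P.isConeAt i).le_integral_norm_gradient_phase hε
    ((P.contDiff i).mul hF) (P.hasCompactSupport_mul i F)
    fun x => mul_nonneg (P.nonneg i x) (hF0 x)

theorem abs_integral_one_sub_cutoff_le {μ : Measure (E n)} (hμ : μ ≪ volume) {ε : ℝ}
    (hε : 0 < ε) (hF : Integrable F μ) :
    |∫ x, (1 - P.cutoff x) * (F x * ‖gradient (phase U ε) x‖) ∂μ| ≤
      ε * ((2 * P.d ^ 2)⁻¹ * ∫ x, |F x| ∂μ) := by
  have hd := P.d_pos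
  rw [← integral_const_mul, ← integral_const_mul, ← Real.norm_eq_abs]
  refine norm_integral_le_of_norm_le ((hF.abs.const_mul _).const_mul _) ?_
  filter_upwards [hμ.ae_le (ae_norm_gradient_phase_le_of_le_infDist (U := U) hε P.d_pos)] with x hx
  rw [norm_mul, norm_mul, norm_norm, Real.norm_of_nonneg (sub_nonneg.2 (P.cutoff_le_one x)),
    Real.norm_eq_abs]
  rcases le_or_gt P.d (Metric.infDist x (frontier U)) with hfar | hnear
  · calc (1 - P.cutoff x) * (|F x| * ‖gradient (phase U ε) x‖)
        ≤ 1 * (|F x| * (ε / (2 * P.d ^ 2))) := by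
          gcongr
          · exact sub_le_self _ (P.cutoff_nonneg x)
          · exact hx hfar
      _ = ε * ((2 * P.d ^ 2)⁻¹ * |F x|) := by ring
  · rw [cutoff, P.sum_eq_one x hnear.le, sub_self, zero_mul]
    positivity

theorem integral_mul_norm_gradient_phase_eq {μ : Measure (E n)} (hμ : μ ≪ volume) {ε : ℝ}
    (hε : 0 < ε) (hF : Integrable F μ) :
    ∫ x, F x * ‖gradient (phase U ε) x‖ ∂μ =
      (∫ x, P.cutoff x * (F x * ‖gradient (phase U ε) x‖) ∂μ) +
        ∫ x, (1 - P.cutoff x) * (F x * ‖gradient (phase U ε) x‖) ∂μ := by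
  have hint := integrable_mul_norm_gradient_phase (U := U) hε hμ hF
  have hcut : Integrable (fun x => P.cutoff x * (F x * ‖gradient (phase U ε) x‖)) μ :=
    hint.bdd_mul P.continuous_cutoff.aestronglyMeasurable (.of_forall fun x => by
      rw [Real.norm_of_nonneg (P.cutoff_nonneg x)]
      exact P.cutoff_le_one x)
  rw [← integral_add hcut ((hint.sub hcut).congr (.of_forall fun x => by
    simp only [Pi.sub_apply, sub_mul, one_mul]))]
  simp only [← add_mul, add_sub_cancel, one_mul]

theorem tendsto_integral_one_sub_cutoff (hF : Integrable F) :
    Tendsto (fun ε => ∫ x, (1 - P.cutoff x) * (F x * ‖gradient (phase U ε) x‖)) (𝓝[>] 0)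
      (𝓝 0) := by
  refine squeeze_zero_norm' (a := fun ε => ε * ((2 * P.d ^ 2)⁻¹ * ∫ x, |F x|)) ?_ ?_
  · filter_upwards [self_mem_nhdsWithin] with ε hε
    exact P.abs_integral_one_sub_cutoff_le .rfl hε hF
  · exact tendsto_nhdsWithin_of_tendsto_nhds (Continuous.tendsto' (by fun_prop) _ _ (zero_mul _))

theorem eventually_lt_integral (hn : 1 ≤ n) (hUo : IsOpen U) (hne : (frontier U).Nonempty)
    (hc : 0 < c) (hF : ContDiff ℝ 1 F) (hFi : Integrable F) (hF0 : ∀ x, 0 ≤ F x) {a : ℝ}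
    (ha : a < c ^ (n - 1) * ∫ x, F x ∂surfaceMeasure U) :
    ∀ᶠ ε in 𝓝[>] 0, a < ∫ x, F x * ‖gradient (phase U ε) x‖ := by
  have hflux : a < P.sharpFlux F + 0 := by
    have hle := P.integral_le_sharpFlux hF hF0
    rw [inv_pow, inv_mul_eq_div, le_div_iff₀' (pow_pos hc _)] at hle
    linarith
  filter_upwards [((P.tendsto_diffuseFlux hn hUo hne hF).add
    (P.tendsto_integral_one_sub_cutoff hFi)).eventually_const_lt hflux, self_mem_nhdsWithin]
    with ε hlt hε
  rw [P.integral_mul_norm_gradient_phase_eq .rfl hε hFi]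
  linarith [P.diffuseFlux_le_integral_cutoff hF hF0 hε]

theorem eventually_integral_lt (hn : 1 ≤ n) (hUo : IsOpen U) (hne : (frontier U).Nonempty)
    (hc : 0 < c) (hF : ContDiff ℝ 1 F) (hFi : Integrable F) (hF0 : ∀ x, 0 ≤ F x) {a : ℝ}
    (ha : c⁻¹ * ∫ x, F x ∂surfaceMeasure U < a) :
    ∀ᶠ ε in 𝓝[>] 0, ∫ x, F x * ‖gradient (phase U ε) x‖ < a := by
  have hflux : c⁻¹ * P.sharpFlux F + 0 < a := by
    rw [add_zero]
    exact (mul_le_mul_of_nonneg_left (P.sharpFlux_le_integral hF hF0)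
      (inv_nonneg.2 hc.le)).trans_lt ha
  filter_upwards [(((P.tendsto_diffuseFlux hn hUo hne hF).const_mul c⁻¹).add
    (P.tendsto_integral_one_sub_cutoff hFi)).eventually_lt_const hflux, self_mem_nhdsWithin]
    with ε hlt hε
  rw [P.integral_mul_norm_gradient_phase_eq .rfl hε hFi]
  have hcut := P.mul_integral_cutoff_le_diffuseFlux hF hF0 hε
  rw [← le_inv_mul_iff₀ hc] at hcut
  linarith

end BoundaryPartition

theorem tendsto_integral_mul_norm_gradient_phase (hn : 1 ≤ n) (hU : HasCkBoundary 1 U)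
    (hUo : IsOpen U) (hcpt : IsCompact (frontier U)) (hne : (frontier U).Nonempty) {F : E n → ℝ}
    (hF : ContDiff ℝ 1 F) (hFi : Integrable F) (hF0 : ∀ x, 0 ≤ F x) :
    Tendsto (fun ε => ∫ x, F x * ‖gradient (phase U ε) x‖) (𝓝[>] 0)
      (𝓝 (∫ x, F x ∂surfaceMeasure U)) := by
  have hrate : ∀ᶠ c : ℝ in 𝓝[<] 1, 0 < c ∧ c < 1 :=
    ((lt_mem_nhds zero_lt_one).filter_mono nhdsWithin_le_nhds).and self_mem_nhdsWithin
  have hpart : ∀ c : ℝ, 0 < c → c < 1 → Nonempty (BoundaryPartition U Set.univ c) :=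
    fun c hc hc1 => exists_boundaryPartition hU hUo hcpt hne isOpen_univ (Set.subset_univ _) hc hc1
  rw [tendsto_order]
  constructor
  · intro a ha
    have hlim : Tendsto (fun c : ℝ => c ^ (n - 1) * ∫ x, F x ∂surfaceMeasure U) (𝓝 1)
        (𝓝 (∫ x, F x ∂surfaceMeasure U)) :=
      Continuous.tendsto' (by fun_prop) _ _ (by rw [one_pow, one_mul])
    obtain ⟨c, hac, hc, hc1⟩ := (((hlim.mono_left nhdsWithin_le_nhds).eventually_const_lt ha).and
      hrate).exists
    exact (hpart c hc hc1).some.eventually_lt_integral hn hUo hne hc hF hFi hF0 hac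
  · intro a ha
    have hlim : Tendsto (fun c : ℝ => c⁻¹ * ∫ x, F x ∂surfaceMeasure U) (𝓝 1)
        (𝓝 (∫ x, F x ∂surfaceMeasure U)) := by
      have hinv := (tendsto_inv₀ (one_ne_zero (α := ℝ))).mul_const (∫ x, F x ∂surfaceMeasure U)
      rwa [inv_one, one_mul] at hinv
    obtain ⟨c, hac, hc, hc1⟩ := (((hlim.mono_left nhdsWithin_le_nhds).eventually_lt_const ha).and
      hrate).exists
    exact (hpart c hc hc1).some.eventually_integral_lt hn hUo hne hc hF hFi hF0 hac

end Partition

/-! ### Trace inequalities -/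

section TraceInequalities

theorem abs_fderiv_mul_sq_le {V : Type*} [NormedAddCommGroup V] [NormedSpace ℝ V] {χ v : V → ℝ}
    {x w : V} {B : ℝ} (hχ : DifferentiableAt ℝ χ x) (hv : DifferentiableAt ℝ v x)
    (hχ1 : |χ x| ≤ 1) (hB : ‖fderiv ℝ χ x‖ ≤ B) (hw : ‖w‖ = 1) :
    |fderiv ℝ (fun y => χ y * v y ^ 2) x w| ≤ (B + 2) * (v x ^ 2 + |v x| * ‖fderiv ℝ v x‖) := by
  have hB0 : 0 ≤ B := (norm_nonneg _).trans hB
  have hχw : |fderiv ℝ χ x w| ≤ B := by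
    simpa only [hw, mul_one, Real.norm_eq_abs] using ((fderiv ℝ χ x).le_opNorm w).trans
      (mul_le_mul_of_nonneg_right hB (norm_nonneg w))
  have hvw : |fderiv ℝ v x w| ≤ ‖fderiv ℝ v x‖ := by
    simpa only [hw, mul_one, Real.norm_eq_abs] using (fderiv ℝ v x).le_opNorm w
  have hprod : fderiv ℝ (fun y => χ y * v y ^ 2) x w =
      χ x * (2 * v x * fderiv ℝ v x w) + v x ^ 2 * fderiv ℝ χ x w := by
    have hfderiv : fderiv ℝ (fun y => χ y * v y ^ 2) x = _ :=
      (hχ.hasFDerivAt.mul (hv.hasFDerivAt.pow 2)).fderiv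
    rw [hfderiv]
    simp only [add_apply, smul_apply, smul_eq_mul, pow_one, Nat.add_one_sub_one, nsmul_eq_mul,
      Nat.cast_ofNat]
  calc |fderiv ℝ (fun y => χ y * v y ^ 2) x w|
      ≤ |χ x * (2 * v x * fderiv ℝ v x w)| + |v x ^ 2 * fderiv ℝ χ x w| :=
        hprod ▸ abs_add_le _ _
    _ = |χ x| * (2 * |v x| * |fderiv ℝ v x w|) + v x ^ 2 * |fderiv ℝ χ x w| := by
        simp only [abs_mul, abs_two, abs_pow, sq_abs]
    _ ≤ 1 * (2 * |v x| * ‖fderiv ℝ v x‖) + v x ^ 2 * B := by gcongr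
    _ ≤ (B + 2) * (v x ^ 2 + |v x| * ‖fderiv ℝ v x‖) := by
        have hcross : 0 ≤ |v x| * ‖fderiv ℝ v x‖ := by positivity
        nlinarith [sq_nonneg (v x), mul_nonneg hB0 hcross]

theorem continuous_sq_add_mul_norm_gradient {V : Type*} [NormedAddCommGroup V]
    [InnerProductSpace ℝ V] [CompleteSpace V] {v : V → ℝ} (hv : ContDiff ℝ 1 v) :
    Continuous fun x => v x ^ 2 + |v x| * ‖gradient v x‖ :=
  (hv.continuous.pow 2).add (hv.continuous.abs.mul (continuous_gradient hv).norm)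

namespace BoundaryPartition

variable {n : ℕ} {U O : Set (E n)} {c : ℝ} (P : BoundaryPartition U O c)

/-- The union of the supports of the functions of the partition. -/
def carrier : Set (E n) := ⋃ i, tsupport (P.χ i)

include P

theorem isCompact_carrier : IsCompact P.carrier := isCompact_iUnion P.hasCompactSupport

theorem carrier_subset : P.carrier ⊆ O := Set.iUnion_subset P.tsupport_subset

theorem abs_χ_le_one (i : P.ι) (x : E n) : |P.χ i x| ≤ 1 := by
  rw [abs_of_nonneg (P.nonneg i x)]
  exact (Finset.single_le_sum (fun j _ => P.nonneg j x) (Finset.mem_univ i)).trans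
    (P.sum_le_one x)

theorem exists_forall_norm_fderiv_le : ∃ B : ℝ, 0 ≤ B ∧ ∀ i x, ‖fderiv ℝ (P.χ i) x‖ ≤ B := by
  have hbound : ∀ i, ∃ B : ℝ, ∀ x, ‖fderiv ℝ (P.χ i) x‖ ≤ B := fun i =>
    ((P.hasCompactSupport i).fderiv ℝ).exists_bound_of_continuous
      ((P.contDiff i).continuous_fderiv one_ne_zero)
  choose B hB using hbound
  refine ⟨∑ i, |B i|, Finset.sum_nonneg fun i _ => abs_nonneg _, fun i x => ?_⟩
  exact ((hB i x).trans (le_abs_self _)).trans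
    (Finset.single_le_sum (f := fun j => |B j|) (fun j _ => abs_nonneg _) (Finset.mem_univ i))

variable {B : ℝ} {v : E n → ℝ}

theorem abs_fderiv_mul_sq_le (hB : ∀ i x, ‖fderiv ℝ (P.χ i) x‖ ≤ B) (hv : ContDiff ℝ 1 v) (i : P.ι)
    (x : E n) :
    |fderiv ℝ (fun x => P.χ i x * v x ^ 2) x (P.N i)| ≤
      (B + 2) * (v x ^ 2 + |v x| * ‖gradient v x‖) := by
  rw [norm_gradient]
  exact DiffuseDomain.abs_fderiv_mul_sq_le ((P.contDiff i).differentiable one_ne_zero x)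
    (hv.differentiable one_ne_zero x) (P.abs_χ_le_one i x) (hB i x) (P.isConeAt i).norm_axis

theorem diffuseFlux_sq_le (hB : ∀ i x, ‖fderiv ℝ (P.χ i) x‖ ≤ B) (hv : ContDiff ℝ 1 v) (ε : ℝ) :
    P.diffuseFlux ε (fun x => v x ^ 2) ≤ Fintype.card P.ι * ((B + 2) *
      ∫ x in P.carrier, (v x ^ 2 + |v x| * ‖gradient v x‖)) := by
  have hint : IntegrableOn (fun x => v x ^ 2 + |v x| * ‖gradient v x‖) P.carrier :=
    (continuous_sq_add_mul_norm_gradient hv).continuousOn.integrableOn_compact P.isCompact_carrier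
  have hcarrier := P.isCompact_carrier.measurableSet
  rw [← nsmul_eq_mul, ← Finset.card_univ]
  refine Finset.sum_le_card_nsmul _ _ _ fun i _ => (neg_le_abs _).trans ?_
  rw [← integral_const_mul, ← integral_indicator hcarrier, ← Real.norm_eq_abs]
  refine norm_integral_le_of_norm_le ((integrable_indicator_iff hcarrier).2
    (hint.const_mul (B + 2))) (.of_forall fun x => ?_)
  by_cases hx : x ∈ P.carrier
  · rw [Set.indicator_of_mem hx, norm_mul]
    exact (mul_le_of_le_one_left (norm_nonneg _) (abs_phase_le_one x)).trans
      (P.abs_fderiv_mul_sq_le hB hv i x)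
  · have hzero : fderiv ℝ (fun x => P.χ i x * v x ^ 2) x = 0 :=
      Function.notMem_support.1 fun h => hx (Set.mem_iUnion.2
        ⟨i, tsupport_mul_subset_left (support_fderiv_subset ℝ h)⟩)
    rw [Set.indicator_of_notMem hx, hzero, zero_apply, mul_zero, norm_zero]

theorem sharpFlux_sq_le (hU : Bornology.IsBounded U) (hB : ∀ i x, ‖fderiv ℝ (P.χ i) x‖ ≤ B)
    (hv : ContDiff ℝ 1 v) :
    P.sharpFlux (fun x => v x ^ 2) ≤ Fintype.card P.ι * ((B + 2) *
      ∫ x in U, (v x ^ 2 + |v x| * ‖gradient v x‖)) := by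
  have hint : IntegrableOn (fun x => v x ^ 2 + |v x| * ‖gradient v x‖) U :=
    ((continuous_sq_add_mul_norm_gradient hv).continuousOn.integrableOn_compact
      hU.isCompact_closure).mono_set subset_closure
  rw [← nsmul_eq_mul, ← Finset.card_univ]
  refine Finset.sum_le_card_nsmul _ _ _ fun i _ => (neg_le_abs _).trans ?_
  rw [← integral_const_mul, ← Real.norm_eq_abs]
  exact norm_integral_le_of_norm_le (hint.const_mul _)
    (.of_forall fun x => P.abs_fderiv_mul_sq_le hB hv i x)

theorem exists_diffuse_trace_bound (hc : 0 < c) :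
    ∃ C : ℝ, 0 ≤ C ∧ ∀ ε > 0, ∀ v : E n → ℝ, ContDiff ℝ 1 v →
      ∫ x, P.cutoff x * (v x ^ 2 * ‖gradient (phase U ε) x‖) ≤
        C * ∫ x in P.carrier, (v x ^ 2 + |v x| * ‖gradient v x‖) := by
  obtain ⟨B, hB0, hB⟩ := P.exists_forall_norm_fderiv_le
  refine ⟨c⁻¹ * (Fintype.card P.ι * (B + 2)), by positivity, fun ε hε v hv => ?_⟩
  rw [mul_assoc, mul_assoc, le_inv_mul_iff₀ hc]
  exact (P.mul_integral_cutoff_le_diffuseFlux (hv.pow 2) (fun x => sq_nonneg _) hε).trans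
    (P.diffuseFlux_sq_le hB hv ε)

theorem exists_trace_bound (hc : 0 < c) (hU : Bornology.IsBounded U) :
    ∃ C : ℝ, 0 ≤ C ∧ ∀ v : E n → ℝ, ContDiff ℝ 1 v →
      ∫ x, v x ^ 2 ∂surfaceMeasure U ≤ C * ∫ x in U, (v x ^ 2 + |v x| * ‖gradient v x‖) := by
  obtain ⟨B, hB0, hB⟩ := P.exists_forall_norm_fderiv_le
  refine ⟨c⁻¹ ^ (n - 1) * (Fintype.card P.ι * (B + 2)), by positivity, fun v hv => ?_⟩
  rw [mul_assoc, mul_assoc]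
  exact (P.integral_le_sharpFlux (hv.pow 2) fun x => sq_nonneg _).trans
    (mul_le_mul_of_nonneg_left (P.sharpFlux_sq_le hU hB hv) (by positivity))

end BoundaryPartition

end TraceInequalities

/-! ### Mollification -/

section Mollification

variable {V F : Type*} [NormedAddCommGroup V] [NormedSpace ℝ V] [FiniteDimensional ℝ V]
  [MeasurableSpace V] {μ : Measure V} [NormedAddCommGroup F] [NormedSpace ℝ F]

/-- The mollification `φ̂ ⋆ f` of `f`, where `φ̂` is the bump function `φ` scaled to have
`μ`-integral one. -/
def mollify (μ : Measure V) (φ : ContDiffBump (0 : V)) (f : V → F) : V → F :=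
  convolution (φ.normed μ) f (ContinuousLinearMap.lsmul ℝ ℝ) μ

theorem mollify_apply (φ : ContDiffBump (0 : V)) (f : V → F) (x : V) :
    mollify μ φ f x = ∫ t, φ.normed μ t • f (x - t) ∂μ :=
  convolution_lsmul

variable [BorelSpace V] [μ.IsAddHaarMeasure]

theorem lintegral_ofReal_normed (φ : ContDiffBump (0 : V)) :
    ∫⁻ t, ENNReal.ofReal (φ.normed μ t) ∂μ = 1 := by
  rw [← ofReal_integral_eq_lintegral_ofReal φ.integrable_normed (.of_forall φ.nonneg_normed),
    φ.integral_normed, ENNReal.ofReal_one]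

-- Jensen's inequality for the probability measure with density `φ.normed μ`.
theorem enorm_mollify_rpow_le (φ : ContDiffBump (0 : V)) {f : V → F}
    (hf : AEStronglyMeasurable f μ) {p : NNReal} (hp : 1 ≤ p) (x : V) :
    ‖mollify μ φ f x‖ₑ ^ (p : ℝ) ≤
      ∫⁻ t, ENNReal.ofReal (φ.normed μ t) * ‖f (x - t)‖ₑ ^ (p : ℝ) ∂μ := by
  set ρ : V → ENNReal := fun t => ENNReal.ofReal (φ.normed μ t)
  have hρ : Measurable ρ := φ.continuous_normed.measurable.ennreal_ofReal
  have : IsProbabilityMeasure (μ.withDensity ρ) := ⟨by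
    rw [withDensity_apply _ MeasurableSet.univ, Measure.restrict_univ, lintegral_ofReal_normed]⟩
  have hfx : AEStronglyMeasurable (fun t => f (x - t)) μ :=
    hf.comp_quasiMeasurePreserving (Measure.measurePreserving_sub_left μ x).quasiMeasurePreserving
  have hle : ‖mollify μ φ f x‖ₑ ≤ eLpNorm (fun t => f (x - t)) p (μ.withDensity ρ) := calc
    ‖mollify μ φ f x‖ₑ ≤ ∫⁻ t, ‖φ.normed μ t • f (x - t)‖ₑ ∂μ :=
        mollify_apply (μ := μ) φ f x ▸ enorm_integral_le_lintegral_enorm _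
    _ = eLpNorm (fun t => f (x - t)) 1 (μ.withDensity ρ) := by
        rw [eLpNorm_one_eq_lintegral_enorm,
          lintegral_withDensity_eq_lintegral_mul₀ hρ.aemeasurable hfx.enorm]
        refine lintegral_congr fun t => ?_
        rw [enorm_smul, Real.enorm_of_nonneg (φ.nonneg_normed t), Pi.mul_apply]
    _ ≤ eLpNorm (fun t => f (x - t)) p (μ.withDensity ρ) :=
        eLpNorm_le_eLpNorm_of_exponent_le (by exact_mod_cast hp)
          (hfx.mono_ac (withDensity_absolutelyContinuous _ _))
  calc ‖mollify μ φ f x‖ₑ ^ (p : ℝ)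
      ≤ eLpNorm (fun t => f (x - t)) p (μ.withDensity ρ) ^ (p : ℝ) := by gcongr
    _ = ∫⁻ t, ρ t * ‖f (x - t)‖ₑ ^ (p : ℝ) ∂μ := by
        rw [eLpNorm_nnreal_pow_eq_lintegral (one_pos.trans_le hp).ne',
          lintegral_withDensity_eq_lintegral_mul₀ hρ.aemeasurable (hfx.enorm.pow_const _)]
        rfl

theorem eLpNorm_mollify_le (φ : ContDiffBump (0 : V)) {f : V → F}
    (hf : AEStronglyMeasurable f μ) {p : NNReal} (hp : 1 ≤ p) :
    eLpNorm (mollify μ φ f) p μ ≤ eLpNorm f p μ := by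
  have hp0 : p ≠ 0 := (one_pos.trans_le hp).ne'
  have hφm : Measurable fun t => ENNReal.ofReal (φ.normed μ t) :=
    φ.continuous_normed.measurable.ennreal_ofReal
  refine (ENNReal.rpow_le_rpow_iff (z := p) (by positivity)).1 ?_
  rw [eLpNorm_nnreal_pow_eq_lintegral hp0, eLpNorm_nnreal_pow_eq_lintegral hp0]
  calc ∫⁻ x, ‖mollify μ φ f x‖ₑ ^ (p : ℝ) ∂μ
      ≤ ∫⁻ x, ∫⁻ t, ENNReal.ofReal (φ.normed μ t) * ‖f (x - t)‖ₑ ^ (p : ℝ) ∂μ ∂μ :=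
        lintegral_mono (enorm_mollify_rpow_le φ hf hp)
    _ = ∫⁻ t, ∫⁻ x, ENNReal.ofReal (φ.normed μ t) * ‖f (x - t)‖ₑ ^ (p : ℝ) ∂μ ∂μ :=
        lintegral_lintegral_swap <| (hφm.comp measurable_snd).aemeasurable.mul <|
          (hf.comp_quasiMeasurePreserving (quasiMeasurePreserving_sub μ μ)).enorm.pow_const _
    _ = ∫⁻ t, ENNReal.ofReal (φ.normed μ t) * ∫⁻ x, ‖f x‖ₑ ^ (p : ℝ) ∂μ ∂μ := by
        refine lintegral_congr fun t => ?_
        rw [lintegral_const_mul' _ _ ENNReal.ofReal_ne_top,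
          lintegral_sub_right_eq_self (fun x => ‖f x‖ₑ ^ (p : ℝ)) t]
    _ = ∫⁻ x, ‖f x‖ₑ ^ (p : ℝ) ∂μ := by
        rw [lintegral_mul_const _ hφm, lintegral_ofReal_normed, one_mul]

theorem integrable_normed_smul (φ : ContDiffBump (0 : V)) {f : V → F}
    (hf : LocallyIntegrable f μ) (x : V) :
    Integrable (fun t => φ.normed μ t • f (x - t)) μ :=
  φ.hasCompactSupport_normed.convolutionExists_left (ContinuousLinearMap.lsmul ℝ ℝ)
    φ.continuous_normed hf x

theorem mollify_sub (φ : ContDiffBump (0 : V)) {f g : V → F}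
    (hf : LocallyIntegrable f μ) (hg : LocallyIntegrable g μ) :
    mollify μ φ (f - g) = mollify μ φ f - mollify μ φ g := by
  funext x
  simp only [mollify_apply, Pi.sub_apply, smul_sub]
  exact integral_sub (integrable_normed_smul φ hf x) (integrable_normed_smul φ hg x)

theorem continuous_mollify (φ : ContDiffBump (0 : V)) {f : V → F}
    (hf : LocallyIntegrable f μ) : Continuous (mollify μ φ f) :=
  φ.hasCompactSupport_normed.continuous_convolution_left _ φ.continuous_normed hf

theorem contDiff_mollify (φ : ContDiffBump (0 : V)) {f : V → F}
    (hf : LocallyIntegrable f μ) : ContDiff ℝ ∞ (mollify μ φ f) :=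
  φ.hasCompactSupport_normed.contDiff_convolution_left _ φ.contDiff_normed hf

theorem support_mollify_subset_cthickening (φ : ContDiffBump (0 : V)) (f : V → F) :
    Function.support (mollify μ φ f) ⊆ Metric.cthickening φ.rOut (tsupport f) := by
  refine (support_convolution_subset _).trans ?_
  rw [ContDiffBump.support_normed_eq]
  rintro _ ⟨a, ha, b, hb, rfl⟩
  refine Metric.mem_cthickening_of_dist_le _ b _ _ (subset_tsupport f hb) ?_
  rw [dist_eq_norm, add_sub_cancel_right]
  exact (mem_ball_zero_iff.1 ha).le

variable [CompleteSpace F] {ι : Type*} {l : Filter ι} {φ : ι → ContDiffBump (0 : V)}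
  {p : NNReal}

theorem tendsto_eLpNorm_mollify_sub_of_continuous (hφ : Tendsto (fun i => (φ i).rOut) l (𝓝 0))
    {f : V → F} (hf : Continuous f) (hsupp : HasCompactSupport f) :
    Tendsto (fun i => eLpNorm (mollify μ (φ i) f - f) p μ) l (𝓝 0) := by
  set S := Metric.cthickening 1 (tsupport f)
  have hS : IsCompact S := hsupp.isCompact.cthickening
  have hSfin : μ S ^ (1 / (p : ENNReal).toReal) ≠ ⊤ :=
    ENNReal.rpow_ne_top_of_nonneg (by positivity) hS.measure_lt_top.ne
  have hlim : Tendsto (fun c : ℝ => ENNReal.ofReal c * μ S ^ (1 / (p : ENNReal).toReal))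
      (𝓝[>] 0) (𝓝 0) := by
    have hofReal : Tendsto ENNReal.ofReal (𝓝[>] 0) (𝓝 0) :=
      (ENNReal.continuous_ofReal.tendsto' 0 0 ENNReal.ofReal_zero).mono_left nhdsWithin_le_nhds
    simpa only [zero_mul] using ENNReal.Tendsto.mul_const hofReal (Or.inr hSfin)
  rw [ENNReal.tendsto_nhds_zero]
  intro θ hθ
  obtain ⟨c, hcθ, hc⟩ : ∃ c : ℝ, ENNReal.ofReal c * μ S ^ (1 / (p : ENNReal).toReal) ≤ θ ∧ 0 < c :=
    ((hlim.eventually_le_const hθ).and self_mem_nhdsWithin).exists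
  obtain ⟨δ, hδ, hfδ⟩ :=
    Metric.uniformContinuous_iff.1 (hsupp.uniformContinuous_of_continuous hf) c hc
  filter_upwards [hφ.eventually_lt_const hδ, hφ.eventually_le_const one_pos] with i hiδ hi1
  refine le_trans ?_ hcθ
  refine eLpNorm_sub_le_of_dist_bdd μ ENNReal.coe_ne_top hS.measurableSet hc.le (fun x => ?_) ?_ ?_
  · exact ContDiffBump.dist_normed_convolution_le hf.aestronglyMeasurable
      fun y hy => (hfδ ((Metric.mem_ball.1 hy).trans hiδ)).le
  · exact (support_mollify_subset_cthickening _ f).trans (Metric.cthickening_mono hi1 _)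
  · exact (subset_tsupport f).trans (Metric.self_subset_cthickening _)

theorem tendsto_eLpNorm_mollify_sub (hφ : Tendsto (fun i => (φ i).rOut) l (𝓝 0)) (hp : 1 ≤ p)
    {f : V → F} (hf : MemLp f p μ) :
    Tendsto (fun i => eLpNorm (mollify μ (φ i) f - f) p μ) l (𝓝 0) := by
  have hp' : (1 : ENNReal) ≤ p := by exact_mod_cast hp
  rw [ENNReal.tendsto_nhds_zero]
  intro θ hθ
  have hθ3 : θ / 3 ≠ 0 := (ENNReal.div_pos hθ.ne' (by finiteness)).ne'
  obtain ⟨h, hsupp, hle, hcont, hmem⟩ :=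
    hf.exists_hasCompactSupport_eLpNorm_sub_le ENNReal.coe_ne_top hθ3
  have hfl := hf.locallyIntegrable hp'
  have hhl := hmem.locallyIntegrable hp'
  filter_upwards [ENNReal.tendsto_nhds_zero.1
    (tendsto_eLpNorm_mollify_sub_of_continuous (μ := μ) (p := p) hφ hcont hsupp) (θ / 3)
    (pos_iff_ne_zero.2 hθ3)] with i hi
  have hdecomp : mollify μ (φ i) f - f =
      mollify μ (φ i) (f - h) + ((mollify μ (φ i) h - h) + (h - f)) := by
    rw [mollify_sub _ hfl hhl]
    abel
  have hm₁ := (continuous_mollify (φ i) (hfl.sub hhl)).aestronglyMeasurable (μ := μ)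
  have hm₂ := ((continuous_mollify (φ i) hhl).sub hcont).aestronglyMeasurable (μ := μ)
  have hm₃ : AEStronglyMeasurable (h - f) μ := hmem.1.sub hf.1
  calc eLpNorm (mollify μ (φ i) f - f) p μ
      ≤ eLpNorm (mollify μ (φ i) (f - h)) p μ +
        (eLpNorm (mollify μ (φ i) h - h) p μ + eLpNorm (h - f) p μ) :=
        hdecomp ▸ (eLpNorm_add_le hm₁ (hm₂.add hm₃) hp').trans
          (add_le_add le_rfl (eLpNorm_add_le hm₂ hm₃ hp'))
    _ ≤ θ / 3 + (θ / 3 + θ / 3) := by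
        gcongr
        · exact (eLpNorm_mollify_le _ (hf.1.sub hmem.1) hp).trans hle
        · rw [eLpNorm_sub_comm]
          exact hle
    _ = θ := by rw [← add_assoc, ENNReal.add_thirds]

end Mollification

/-! ### Weak gradients -/

section WeakGradient

variable {n : ℕ} {Ω U : Set (E n)} {u : E n → ℝ} {G : E n → E n}

theorem MemH1.memLp_weakGradient (h : MemH1 Ω u) :
    MemLp (weakGradient Ω u) 2 (volume.restrict Ω) := by
  rw [weakGradient, dif_pos h]
  exact h.2.choose_spec.1

theorem MemH1.isWeakGradient (h : MemH1 Ω u) : IsWeakGradient Ω u (weakGradient Ω u) := by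
  rw [weakGradient, dif_pos h]
  exact h.2.choose_spec.2

theorem IsWeakGradient.mono (h : IsWeakGradient Ω u G) (hU : U ⊆ Ω) : IsWeakGradient U u G := by
  intro φ hφ hc hs v
  have hzero {W : Set (E n)} (hW : U ⊆ W) {x : E n} (hx : x ∉ W) : x ∉ tsupport φ :=
    fun hxφ => hx (hW (hs hxφ))
  have hfderiv {W : Set (E n)} (hW : U ⊆ W) :
      ∫ x in W, u x * fderiv ℝ φ x v = ∫ x, u x * fderiv ℝ φ x v :=
    setIntegral_eq_integral_of_forall_compl_eq_zero fun x hx => by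
      rw [fderiv_of_notMem_tsupport ℝ (hzero hW hx), zero_apply, mul_zero]
  have hinner {W : Set (E n)} (hW : U ⊆ W) :
      ∫ x in W, inner ℝ (G x) v * φ x = ∫ x, inner ℝ (G x) v * φ x :=
    setIntegral_eq_integral_of_forall_compl_eq_zero fun x hx => by
      rw [image_eq_zero_of_notMem_tsupport (hzero hW hx), mul_zero]
  rw [hfderiv subset_rfl, hinner subset_rfl, ← hfderiv hU, ← hinner hU]
  exact h φ hφ hc (hs.trans hU) v

theorem MemH1.mono (h : MemH1 Ω u) (hU : U ⊆ Ω) : MemH1 U u :=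
  ⟨h.1.mono_measure (Measure.restrict_mono hU le_rfl), weakGradient Ω u,
    h.memLp_weakGradient.mono_measure (Measure.restrict_mono hU le_rfl), h.isWeakGradient.mono hU⟩

theorem IsWeakGradient.ae_eq (hU : IsOpen U) {G₁ G₂ : E n → E n} (h₁ : IsWeakGradient U u G₁)
    (h₂ : IsWeakGradient U u G₂) (hG₁ : MemLp G₁ 2 (volume.restrict U))
    (hG₂ : MemLp G₂ 2 (volume.restrict U)) : G₁ =ᵐ[volume.restrict U] G₂ := by
  have hloc : LocallyIntegrableOn (G₁ - G₂) U volume :=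
    locallyIntegrableOn_of_locallyIntegrable_restrict ((hG₁.sub hG₂).locallyIntegrable one_le_two)
  have hae : ∀ᵐ x, x ∈ U → (G₁ - G₂) x = 0 :=
    hU.ae_eq_zero_of_integral_contDiff_smul_eq_zero hloc fun φ hφ hc hs => by
      have hφ2 : MemLp φ 2 (volume.restrict U) :=
        (hφ.continuous.memLp_of_hasCompactSupport hc).restrict U
      have hint : Integrable (fun x => φ x • (G₁ - G₂) x) (volume.restrict U) :=
        memLp_one_iff_integrable.1 ((hG₁.sub hG₂).smul hφ2 (r := 1))
      rw [← setIntegral_eq_integral_of_forall_compl_eq_zero (s := U) fun x hx => by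
        rw [image_eq_zero_of_notMem_tsupport fun hxφ => hx (hs hxφ), zero_smul]]
      refine ext_inner_right ℝ fun v => ?_
      have hinner : ∀ x, inner ℝ v (φ x • (G₁ - G₂) x) =
          inner ℝ (G₁ x) v * φ x - inner ℝ (G₂ x) v * φ x := fun x => by
        rw [inner_smul_right, Pi.sub_apply, inner_sub_right, real_inner_comm,
          real_inner_comm v (G₂ x)]
        ring
      rw [inner_zero_left, real_inner_comm, ← integral_inner hint v]
      simp only [hinner]
      refine (integral_sub ((hG₁.inner_const v).integrable_mul hφ2)
        ((hG₂.inner_const v).integrable_mul hφ2)).trans (sub_eq_zero.2 (neg_injective ?_))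
      exact (h₁ φ hφ hc hs v).symm.trans (h₂ φ hφ hc hs v)
  rw [Filter.EventuallyEq, ae_restrict_iff' hU.measurableSet]
  filter_upwards [hae] with x hx hxU
  exact sub_eq_zero.1 (hx hxU)

theorem MemH1.weakGradient_ae_eq (hU : IsOpen U) (h : MemH1 Ω u) (hsub : U ⊆ Ω) :
    weakGradient U u =ᵐ[volume.restrict U] weakGradient Ω u :=
  (h.mono hsub).isWeakGradient.ae_eq hU (h.isWeakGradient.mono hsub)
    (h.mono hsub).memLp_weakGradient
    (h.memLp_weakGradient.mono_measure (Measure.restrict_mono hsub le_rfl))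

theorem fderiv_comp_const_sub {V F : Type*} [NormedAddCommGroup V] [NormedSpace ℝ V]
    [NormedAddCommGroup F] [NormedSpace ℝ F] {f : V → F} {a x : V}
    (hf : DifferentiableAt ℝ f (a - x)) :
    fderiv ℝ (fun y => f (a - y)) x = -fderiv ℝ f (a - x) := by
  have hcomp : fderiv ℝ (fun y => f (a - y)) x = _ :=
    (hf.hasFDerivAt.comp x ((hasFDerivAt_id x).const_sub a)).fderiv
  rw [hcomp, ContinuousLinearMap.comp_neg, ContinuousLinearMap.comp_id]

theorem fderiv_mollify (φ : ContDiffBump (0 : E n)) {f : E n → ℝ}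
    (hf : LocallyIntegrable f volume) (x v : E n) :
    fderiv ℝ (mollify volume φ f) x v = ∫ y, fderiv ℝ (φ.normed volume) (x - y) v * f y := by
  have hc : HasCompactSupport (φ.normed (volume : Measure (E n))) := φ.hasCompactSupport_normed
  have hd : ContDiff ℝ 1 (φ.normed (volume : Measure (E n))) := φ.contDiff_normed
  have hfderiv : fderiv ℝ (mollify volume φ f) x = _ :=
    (hc.hasFDerivAt_convolution_left (ContinuousLinearMap.lsmul ℝ ℝ) hd hf x).fderiv
  have hex := (hc.fderiv ℝ).convolutionExists_left
    (ContinuousLinearMap.precompL (E n) (ContinuousLinearMap.lsmul ℝ ℝ))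
    (hd.continuous_fderiv one_ne_zero) hf x
  rw [hfderiv, convolution_def, ContinuousLinearMap.integral_apply hex,
    ← integral_sub_left_eq_self _ volume x]
  simp only [ContinuousLinearMap.precompL_apply, sub_sub_cancel, ContinuousLinearMap.lsmul_apply,
    smul_eq_mul]

theorem tsupport_normed_sub_subset (φ : ContDiffBump (0 : E n)) (x : E n) :
    tsupport (fun y => φ.normed volume (x - y)) ⊆ Metric.closedBall x φ.rOut := by
  refine closure_minimal (fun y hy => ?_) Metric.isClosed_closedBall
  have hxy : x - y ∈ Function.support (φ.normed (volume : Measure (E n))) := hy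
  rw [φ.support_normed_eq, mem_ball_zero_iff] at hxy
  rw [Metric.mem_closedBall, dist_comm, dist_eq_norm]
  exact hxy.le

-- The weak gradient is tested against `y ↦ φ.normed (x - y)`, the kernel of the mollification.
theorem IsWeakGradient.gradient_mollify (hΩ : IsOpen Ω) (h : IsWeakGradient Ω u G)
    (hu : MemLp u 2 (volume.restrict Ω)) (hG : MemLp G 2 (volume.restrict Ω))
    (φ : ContDiffBump (0 : E n)) {x : E n} (hx : Metric.closedBall x φ.rOut ⊆ Ω) :
    gradient (mollify volume φ (Ω.indicator u)) x = mollify volume φ (Ω.indicator G) x := by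
  have hum := ((memLp_indicator_iff_restrict hΩ.measurableSet).2 hu).locallyIntegrable one_le_two
  have hGm := ((memLp_indicator_iff_restrict hΩ.measurableSet).2 hG).locallyIntegrable one_le_two
  let τ : E n → ℝ := fun y => φ.normed volume (x - y)
  have hτ : ContDiff ℝ ∞ τ := φ.contDiff_normed.comp (contDiff_const.sub contDiff_id)
  have hτs : tsupport τ ⊆ Metric.closedBall x φ.rOut := tsupport_normed_sub_subset φ x
  have hτc : HasCompactSupport τ :=
    (isCompact_closedBall x φ.rOut).of_isClosed_subset (isClosed_tsupport τ) hτs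
  have hφ : Differentiable ℝ (φ.normed (volume : Measure (E n))) :=
    φ.contDiff_normed.differentiable one_ne_zero
  refine ext_inner_right ℝ fun v => ?_
  have hfderiv : ∫ y, fderiv ℝ (φ.normed volume) (x - y) v * Ω.indicator u y =
      - ∫ y in Ω, u y * fderiv ℝ τ y v := by
    rw [← integral_neg, ← integral_indicator hΩ.measurableSet]
    refine integral_congr_ae (.of_forall fun y => ?_)
    by_cases hy : y ∈ Ω
    · simp only [τ, hy, Set.indicator_of_mem, fderiv_comp_const_sub (hφ _), neg_apply]
      ring
    · simp only [hy, not_false_eq_true, Set.indicator_of_notMem, mul_zero]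
  have hinner : inner ℝ (∫ t, φ.normed volume t • Ω.indicator G (x - t)) v =
      ∫ y in Ω, inner ℝ (G y) v * τ y := by
    rw [real_inner_comm, ← integral_inner (integrable_normed_smul φ hGm x) v,
      ← integral_sub_left_eq_self _ volume x, ← integral_indicator hΩ.measurableSet]
    refine integral_congr_ae (.of_forall fun y => ?_)
    by_cases hy : y ∈ Ω
    · simp only [τ, sub_sub_cancel, hy, Set.indicator_of_mem, inner_smul_right,
        real_inner_comm v (G y)]
      ring
    · simp only [sub_sub_cancel, hy, not_false_eq_true, Set.indicator_of_notMem, smul_zero,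
        inner_zero_right]
  rw [inner_gradient_left, fderiv_mollify φ hum, mollify_apply, hfderiv, hinner,
    h τ hτ hτc (hτs.trans hx) v, neg_neg]

end WeakGradient

/-! ### Strong and weak convergence in `L²` -/

section L2

variable {α ι H : Type*} [MeasurableSpace α] {μ ν : Measure α} {l : Filter ι}
  [NormedAddCommGroup H]

theorem tendsto_lpNorm_iff {p : ENNReal} {f : ι → α → H} (hf : ∀ i, MemLp (f i) p μ) :
    Tendsto (fun i => lpNorm (f i) p μ) l (𝓝 0) ↔
      Tendsto (fun i => eLpNorm (f i) p μ) l (𝓝 0) := by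
  simp only [← toReal_eLpNorm (hf _).1, ← ENNReal.toReal_zero]
  exact ENNReal.tendsto_toReal_iff (fun i => (hf i).2.ne) ENNReal.zero_ne_top

theorem tendsto_lpNorm_of_tendsto_lpNorm_sub {p : ENNReal} (hp : 1 ≤ p) {f : ι → α → H} {f₀ : α → H}
    (hf : ∀ i, MemLp (f i) p μ) (hf₀ : MemLp f₀ p μ)
    (h : Tendsto (fun i => lpNorm (f i - f₀) p μ) l (𝓝 0)) :
    Tendsto (fun i => lpNorm (f i) p μ) l (𝓝 (lpNorm f₀ p μ)) := by
  rw [tendsto_iff_norm_sub_tendsto_zero]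
  refine squeeze_zero (fun _ => norm_nonneg _) (fun i => abs_sub_le_iff.2 ⟨?_, ?_⟩) h
  · rw [sub_le_iff_le_add']
    exact lpNorm_le_lpNorm_add_lpNorm_sub' hf₀ hp
  · rw [sub_le_iff_le_add', lpNorm_sub_comm]
    exact lpNorm_le_lpNorm_add_lpNorm_sub' (hf i) hp

theorem lpNorm_mono_measure {p : ENNReal} {f : α → H} (hf : MemLp f p ν) (h : μ ≤ ν) :
    lpNorm f p μ ≤ lpNorm f p ν := by
  rw [← toReal_eLpNorm hf.1, ← toReal_eLpNorm (hf.1.mono_measure h)]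
  exact ENNReal.toReal_mono hf.2.ne (eLpNorm_mono_measure f h)

theorem lpNorm_congr_ae {p : ENNReal} {f g : α → H} (h : f =ᵐ[μ] g) :
    lpNorm f p μ = lpNorm g p μ := by
  rw [lpNorm, lpNorm, aestronglyMeasurable_congr h, eLpNorm_congr_ae h]

theorem norm_toLp_eq_lpNorm {p : ENNReal} {f : α → H} (hf : MemLp f p μ) :
    ‖hf.toLp‖ = lpNorm f p μ := by
  rw [Lp.norm_toLp, toReal_eLpNorm hf.1]

theorem lpNorm_two_sq {f : α → H} (hf : MemLp f 2 μ) : lpNorm f 2 μ ^ 2 = ∫ x, ‖f x‖ ^ 2 ∂μ := by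
  rw [lpNorm_eq_integral_norm_rpow_toReal two_ne_zero ENNReal.ofNat_ne_top hf.1]
  simp only [ENNReal.toReal_ofNat, Real.rpow_ofNat]
  rw [← one_div, ← Real.sqrt_eq_rpow, Real.sq_sqrt (integral_nonneg fun x => sq_nonneg ‖f x‖)]

theorem memLp_bdd_smul [NormedSpace ℝ H] {p : ENNReal} {m : α → ℝ} {f : α → H} {M : ℝ}
    (hm : AEStronglyMeasurable m μ) (hM : ∀ᵐ x ∂μ, ‖m x‖ ≤ M) (hf : MemLp f p μ) :
    MemLp (m • f) p μ := by
  refine hf.of_le_mul (c := M) (hm.smul hf.1) (hM.mono fun x hx => ?_)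
  rw [Pi.smul_apply', norm_smul]
  exact mul_le_mul_of_nonneg_right hx (norm_nonneg _)

theorem lpNorm_bdd_smul_le [NormedSpace ℝ H] {p : ENNReal} {m : α → ℝ} {f : α → H} {M : ℝ}
    (hm : AEStronglyMeasurable m μ) (hM : ∀ᵐ x ∂μ, ‖m x‖ ≤ M) (hf : MemLp f p μ) :
    lpNorm (m • f) p μ ≤ |M| * lpNorm f p μ := by
  rw [← toReal_eLpNorm (hm.smul hf.1), ← toReal_eLpNorm hf.1,
    ← ENNReal.toReal_ofReal (abs_nonneg M), ← ENNReal.toReal_mul]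
  refine ENNReal.toReal_mono (ENNReal.mul_ne_top ENNReal.ofReal_ne_top hf.2.ne)
    (eLpNorm_le_mul_eLpNorm_of_ae_le_mul (hM.mono fun x hx => ?_) p)
  rw [Pi.smul_apply', norm_smul]
  exact mul_le_mul_of_nonneg_right (hx.trans (le_abs_self M)) (norm_nonneg _)

variable [InnerProductSpace ℝ H]

theorem inner_toLp {f g : α → H} (hf : MemLp f 2 μ) (hg : MemLp g 2 μ) :
    inner ℝ hf.toLp hg.toLp = ∫ x, inner ℝ (f x) (g x) ∂μ := by
  rw [L2.inner_def]
  refine integral_congr_ae ?_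
  filter_upwards [hf.coeFn_toLp, hg.coeFn_toLp] with x hfx hgx
  rw [hfx, hgx]

theorem integrable_inner {f g : α → H} (hf : MemLp f 2 μ) (hg : MemLp g 2 μ) :
    Integrable (fun x => inner ℝ (f x) (g x)) μ := by
  refine (L2.integrable_inner (𝕜 := ℝ) hf.toLp hg.toLp).congr ?_
  filter_upwards [hf.coeFn_toLp, hg.coeFn_toLp] with x hfx hgx
  rw [hfx, hgx]

theorem abs_integral_inner_le {f g : α → H} (hf : MemLp f 2 μ) (hg : MemLp g 2 μ) :
    |∫ x, inner ℝ (f x) (g x) ∂μ| ≤ lpNorm f 2 μ * lpNorm g 2 μ := by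
  rw [← inner_toLp hf hg, ← norm_toLp_eq_lpNorm hf, ← norm_toLp_eq_lpNorm hg]
  exact abs_real_inner_le_norm _ _

theorem abs_integral_mul_le {f g : α → ℝ} (hf : MemLp f 2 μ) (hg : MemLp g 2 μ) :
    |∫ x, f x * g x ∂μ| ≤ lpNorm f 2 μ * lpNorm g 2 μ := by
  simpa only [Real.inner_apply] using abs_integral_inner_le hf hg

/-- Weak convergence in `L²(μ)` of a family which is bounded along the filter `l`. Along a general
filter, unlike along a sequence, boundedness is not automatic, and it is needed to pair with
strongly convergent families. -/
structure TendstoWeakly (μ : Measure α) (W : ι → α → H) (l : Filter ι) (G : α → H) : Prop where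
  memLp : MemLp G 2 μ
  exists_bound : ∃ R, ∀ᶠ i in l, MemLp (W i) 2 μ ∧ lpNorm (W i) 2 μ ≤ R
  tendsto_integral : ∀ Y, MemLp Y 2 μ →
    Tendsto (fun i => ∫ x, inner ℝ (W i x) (Y x) ∂μ) l (𝓝 (∫ x, inner ℝ (G x) (Y x) ∂μ))

theorem TendstoWeakly.tendsto_integral_inner {W Z : ι → α → H} {G Z₀ : α → H}
    (hW : TendstoWeakly μ W l G) (hZ : ∀ i, MemLp (Z i) 2 μ) (hZ₀ : MemLp Z₀ 2 μ)
    (hlim : Tendsto (fun i => lpNorm (Z i - Z₀) 2 μ) l (𝓝 0)) :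
    Tendsto (fun i => ∫ x, inner ℝ (W i x) (Z i x) ∂μ) l (𝓝 (∫ x, inner ℝ (G x) (Z₀ x) ∂μ)) := by
  obtain ⟨R, hR⟩ := hW.exists_bound
  have herr : Tendsto (fun i => ∫ x, inner ℝ (W i x) ((Z i - Z₀) x) ∂μ) l (𝓝 0) := by
    refine squeeze_zero_norm' (hR.mono fun i hi => ?_) (by simpa using hlim.const_mul R)
    exact (abs_integral_inner_le hi.1 ((hZ i).sub hZ₀)).trans
      (mul_le_mul_of_nonneg_right hi.2 lpNorm_nonneg)
  refine (add_zero (∫ x, inner ℝ (G x) (Z₀ x) ∂μ) ▸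
    (hW.tendsto_integral Z₀ hZ₀).add herr).congr' (hR.mono fun i hi => ?_)
  rw [← integral_add (integrable_inner hi.1 hZ₀) (integrable_inner hi.1 ((hZ i).sub hZ₀))]
  simp only [← inner_add_right, Pi.sub_apply, add_sub_cancel]

theorem tendstoWeakly_of_tendsto_lpNorm {f : ι → α → H} {f₀ : α → H}
    (hf : ∀ i, MemLp (f i) 2 μ) (hf₀ : MemLp f₀ 2 μ)
    (hlim : Tendsto (fun i => lpNorm (f i - f₀) 2 μ) l (𝓝 0)) : TendstoWeakly μ f l f₀ where
  memLp := hf₀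
  exists_bound := by
    refine ⟨lpNorm f₀ 2 μ + 1, (hlim.eventually_le_const one_pos).mono fun i hi => ⟨hf i, ?_⟩⟩
    exact (lpNorm_le_lpNorm_add_lpNorm_sub' hf₀ one_le_two).trans (by gcongr)
  tendsto_integral Y hY := by
    rw [tendsto_iff_norm_sub_tendsto_zero]
    refine squeeze_zero (fun _ => norm_nonneg _) (fun i => ?_)
      (by simpa using hlim.mul_const (lpNorm Y 2 μ))
    rw [← integral_sub (integrable_inner (hf i) hY) (integrable_inner hf₀ hY)]
    simp only [← inner_sub_left]
    exact abs_integral_inner_le ((hf i).sub hf₀) hY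

theorem abs_integral_inner_sub_le {f g f' g' : α → H} (hf : MemLp f 2 μ) (hg : MemLp g 2 μ)
    (hf' : MemLp f' 2 μ) (hg' : MemLp g' 2 μ) :
    |(∫ x, inner ℝ (f x) (g x) ∂μ) - ∫ x, inner ℝ (f' x) (g' x) ∂μ| ≤
      lpNorm (f - f') 2 μ * lpNorm g 2 μ + lpNorm f' 2 μ * lpNorm (g - g') 2 μ := by
  have hsplit : (∫ x, inner ℝ (f x) (g x) ∂μ) - ∫ x, inner ℝ (f' x) (g' x) ∂μ =
      (∫ x, inner ℝ ((f - f') x) (g x) ∂μ) + ∫ x, inner ℝ (f' x) ((g - g') x) ∂μ := by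
    rw [← integral_sub (integrable_inner hf hg) (integrable_inner hf' hg'),
      ← integral_add (integrable_inner (hf.sub hf') hg) (integrable_inner hf' (hg.sub hg'))]
    simp only [Pi.sub_apply, inner_sub_left, inner_sub_right, sub_add_sub_cancel]
  rw [hsplit]
  exact (abs_add_le _ _).trans
    (add_le_add (abs_integral_inner_le (hf.sub hf') hg) (abs_integral_inner_le hf' (hg.sub hg')))

theorem abs_integral_mul_sub_le {f g f' g' : α → ℝ} (hf : MemLp f 2 μ) (hg : MemLp g 2 μ)
    (hf' : MemLp f' 2 μ) (hg' : MemLp g' 2 μ) :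
    |(∫ x, f x * g x ∂μ) - ∫ x, f' x * g' x ∂μ| ≤
      lpNorm (f - f') 2 μ * lpNorm g 2 μ + lpNorm f' 2 μ * lpNorm (g - g') 2 μ := by
  simpa only [Real.inner_apply] using abs_integral_inner_sub_le hf hg hf' hg'

theorem integral_mul_eq_lpNorm_add_sq_sub {f g : α → ℝ} (hf : MemLp f 2 μ) (hg : MemLp g 2 μ) :
    ∫ x, f x * g x ∂μ = (lpNorm (f + g) 2 μ ^ 2 - lpNorm (f - g) 2 μ ^ 2) / 4 := by
  have hpol := re_inner_eq_norm_add_mul_self_sub_norm_sub_mul_self_div_four (𝕜 := ℝ)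
    hf.toLp hg.toLp
  rw [RCLike.re_to_real, inner_toLp, ← hf.toLp_add hg, ← hf.toLp_sub hg, norm_toLp_eq_lpNorm,
    norm_toLp_eq_lpNorm, ← sq, ← sq] at hpol
  simpa only [Real.inner_apply] using hpol

theorem tendsto_integral_mul {f g : ι → α → ℝ} {f₀ g₀ : α → ℝ}
    (hf : ∀ i, MemLp (f i) 2 μ) (hf₀ : MemLp f₀ 2 μ) (hg : ∀ i, MemLp (g i) 2 μ)
    (hg₀ : MemLp g₀ 2 μ) (hfl : Tendsto (fun i => lpNorm (f i - f₀) 2 μ) l (𝓝 0))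
    (hgl : Tendsto (fun i => lpNorm (g i - g₀) 2 μ) l (𝓝 0)) :
    Tendsto (fun i => ∫ x, f i x * g i x ∂μ) l (𝓝 (∫ x, f₀ x * g₀ x ∂μ)) := by
  simpa only [Real.inner_apply] using
    (tendstoWeakly_of_tendsto_lpNorm hf hf₀ hfl).tendsto_integral_inner hg hg₀ hgl

end L2

section BoundedFactor

variable {α ι H : Type*} [MeasurableSpace α] {μ : Measure α} {l : Filter ι}
  [NormedAddCommGroup H] [NormedSpace ℝ H] {m : ι → α → ℝ} {m₀ : α → ℝ} {M : ℝ}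

theorem tendsto_lpNorm_bdd_smul_sub_smul [l.IsCountablyGenerated]
    (hm : ∀ i, AEStronglyMeasurable (m i) μ) (hm₀ : AEStronglyMeasurable m₀ μ)
    (hM : ∀ i, ∀ᵐ x ∂μ, ‖m i x‖ ≤ M) (hM₀ : ∀ᵐ x ∂μ, ‖m₀ x‖ ≤ M)
    (hlim : ∀ᵐ x ∂μ, Tendsto (fun i => m i x) l (𝓝 (m₀ x))) {f : α → H} (hf : MemLp f 2 μ) :
    Tendsto (fun i => lpNorm (m i • f - m₀ • f) 2 μ) l (𝓝 0) := by
  have hmem := fun i => (memLp_bdd_smul (hm i) (hM i) hf).sub (memLp_bdd_smul hm₀ hM₀ hf)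
  have hsq : Tendsto (fun i => ∫ x, ‖m i x • f x - m₀ x • f x‖ ^ 2 ∂μ) l (𝓝 (∫ _, (0 : ℝ) ∂μ)) := by
    refine tendsto_integral_filter_of_dominated_convergence (fun x => (2 * M) ^ 2 * ‖f x‖ ^ 2)
      (.of_forall fun i => (hmem i).norm.integrable_sq.1) (.of_forall fun i => ?_)
      (hf.norm.integrable_sq.const_mul _) (hlim.mono fun x hx => ?_)
    · filter_upwards [hM i, hM₀] with x hx hx₀
      rw [norm_pow, norm_norm, ← sub_smul, norm_smul, mul_pow]
      gcongr
      exact (norm_sub_le _ _).trans (by linarith)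
    · simpa using ((hx.smul_const (f x)).sub_const (m₀ x • f x)).norm.pow 2
  rw [integral_zero] at hsq
  refine (Real.sqrt_zero ▸ hsq.sqrt).congr fun i => ?_
  rw [← Real.sqrt_sq (lpNorm_nonneg (p := 2) (μ := μ)), lpNorm_two_sq (hmem i)]
  rfl

theorem tendsto_lpNorm_bdd_smul_sub [l.IsCountablyGenerated]
    (hm : ∀ i, AEStronglyMeasurable (m i) μ) (hm₀ : AEStronglyMeasurable m₀ μ)
    (hM : ∀ i, ∀ᵐ x ∂μ, ‖m i x‖ ≤ M) (hM₀ : ∀ᵐ x ∂μ, ‖m₀ x‖ ≤ M)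
    (hlim : ∀ᵐ x ∂μ, Tendsto (fun i => m i x) l (𝓝 (m₀ x))) {f : ι → α → H} {f₀ : α → H}
    (hf : ∀ i, MemLp (f i) 2 μ) (hf₀ : MemLp f₀ 2 μ)
    (hfl : Tendsto (fun i => lpNorm (f i - f₀) 2 μ) l (𝓝 0)) :
    Tendsto (fun i => lpNorm (m i • f i - m₀ • f₀) 2 μ) l (𝓝 0) := by
  refine squeeze_zero (fun _ => lpNorm_nonneg) (fun i => ?_) (by
    simpa using (hfl.const_mul |M|).add
      (tendsto_lpNorm_bdd_smul_sub_smul hm hm₀ hM hM₀ hlim hf₀))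
  refine (lpNorm_sub_le_lpNorm_sub_add_lpNorm_sub (memLp_bdd_smul (hm i) (hM i) (hf i))
    (memLp_bdd_smul (hm i) (hM i) hf₀) one_le_two).trans (add_le_add_left ?_ _)
  rw [← smul_sub]
  exact lpNorm_bdd_smul_le (hm i) (hM i) ((hf i).sub hf₀)

theorem tendsto_integral_bdd_mul_mul [l.IsCountablyGenerated] {f g : ι → α → ℝ} {f₀ g₀ : α → ℝ}
    (hm : ∀ i, AEStronglyMeasurable (m i) μ) (hm₀ : AEStronglyMeasurable m₀ μ)
    (hM : ∀ i, ∀ᵐ x ∂μ, ‖m i x‖ ≤ M) (hM₀ : ∀ᵐ x ∂μ, ‖m₀ x‖ ≤ M)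
    (hlim : ∀ᵐ x ∂μ, Tendsto (fun i => m i x) l (𝓝 (m₀ x)))
    (hf : ∀ i, MemLp (f i) 2 μ) (hf₀ : MemLp f₀ 2 μ) (hg : ∀ i, MemLp (g i) 2 μ)
    (hg₀ : MemLp g₀ 2 μ) (hfl : Tendsto (fun i => lpNorm (f i - f₀) 2 μ) l (𝓝 0))
    (hgl : Tendsto (fun i => lpNorm (g i - g₀) 2 μ) l (𝓝 0)) :
    Tendsto (fun i => ∫ x, m i x * (f i x * g i x) ∂μ) l (𝓝 (∫ x, m₀ x * (f₀ x * g₀ x) ∂μ)) := by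
  simpa only [Pi.smul_apply', smul_eq_mul, mul_assoc] using
    tendsto_integral_mul (fun i => memLp_bdd_smul (hm i) (hM i) (hf i))
      (memLp_bdd_smul hm₀ hM₀ hf₀) hg hg₀
      (tendsto_lpNorm_bdd_smul_sub hm hm₀ hM hM₀ hlim hf hf₀ hfl) hgl

end BoundedFactor

/-! ### Smooth approximation in `H¹` -/

theorem tendsto_eLpNorm_sub_sub {α ι F : Type*} {m : MeasurableSpace α} [NormedAddCommGroup F]
    {μ : Measure α} {l : Filter ι} {p : ENNReal} (hp : 1 ≤ p) {f g : ι → α → F} {f₀ g₀ : α → F}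
    (hf : ∀ i, AEStronglyMeasurable (f i - f₀) μ) (hg : ∀ i, AEStronglyMeasurable (g i - g₀) μ)
    (hfl : Tendsto (fun i => eLpNorm (f i - f₀) p μ) l (𝓝 0))
    (hgl : Tendsto (fun i => eLpNorm (g i - g₀) p μ) l (𝓝 0)) :
    Tendsto (fun i => eLpNorm ((f i - g i) - (f₀ - g₀)) p μ) l (𝓝 0) := by
  refine tendsto_of_tendsto_of_tendsto_of_le_of_le tendsto_const_nhds
    (by simpa using hfl.add hgl) (fun _ => zero_le) fun i => ?_
  dsimp only
  rw [sub_sub_sub_comm]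
  exact eLpNorm_sub_le (hf i) (hg i) hp

theorem memLp_restrict_of_isBounded {X F : Type*} [PseudoMetricSpace X] [ProperSpace X]
    [SecondCountableTopology X] [MeasurableSpace X] [OpensMeasurableSpace X]
    [NormedAddCommGroup F] {μ : Measure X} [IsFiniteMeasureOnCompacts μ] {K : Set X}
    {p : ENNReal} {f : X → F} (hf : Continuous f) (hK : Bornology.IsBounded K) :
    MemLp f p (μ.restrict K) := by
  have hfin : IsFiniteMeasure (μ.restrict (closure K)) :=
    ⟨by simpa using hK.isCompact_closure.measure_lt_top⟩
  obtain ⟨C, hC⟩ := hK.isCompact_closure.exists_bound_of_continuousOn hf.continuousOn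
  refine (MemLp.of_bound hf.aestronglyMeasurable C ?_).mono_measure
    (Measure.restrict_mono subset_closure le_rfl)
  filter_upwards [ae_restrict_mem isClosed_closure.measurableSet] with x hx using hC x hx

theorem exists_seq_contDiffBump {F : Type*} (c : F) :
    ∃ φ : ℕ → ContDiffBump c, Tendsto (fun k => (φ k).rOut) atTop (𝓝 0) :=
  ⟨fun k => ⟨(1 / (k + 1)) / 2, 1 / (k + 1), by positivity,
    half_lt_self Nat.one_div_pos_of_nat⟩, tendsto_one_div_add_atTop_nhds_zero_nat⟩

/-- The smooth functions `w k` converge to `v` in `L²(K)` and their gradients converge to `V` in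
`L²(K)`. No regularity of `K` is assumed, so `V` is recorded separately from `v`. -/
structure H1Approx {n : ℕ} (K : Set (E n)) (v : E n → ℝ) (V : E n → E n) (w : ℕ → E n → ℝ) :
    Prop where
  memLp : MemLp v 2 (volume.restrict K)
  memLp_grad : MemLp V 2 (volume.restrict K)
  contDiff : ∀ k, ContDiff ℝ ∞ (w k)
  tendsto : Tendsto (fun k => eLpNorm (w k - v) 2 (volume.restrict K)) atTop (𝓝 0)
  tendsto_grad : Tendsto (fun k => eLpNorm (gradient (w k) - V) 2 (volume.restrict K)) atTop (𝓝 0)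

section H1Approx

variable {n : ℕ} {Ω K L : Set (E n)} {u v : E n → ℝ} {V W : E n → E n} {w z : ℕ → E n → ℝ}

theorem H1Approx.contDiff_one (h : H1Approx K v V w) (k : ℕ) : ContDiff ℝ 1 (w k) :=
  (h.contDiff k).of_le (by exact_mod_cast le_top)

theorem H1Approx.mono (h : H1Approx K v V w) (hLK : L ⊆ K) : H1Approx L v V w := by
  have hm : volume.restrict L ≤ volume.restrict K := Measure.restrict_mono hLK le_rfl
  exact ⟨h.memLp.mono_measure hm, h.memLp_grad.mono_measure hm, h.contDiff,
    tendsto_of_tendsto_of_tendsto_of_le_of_le tendsto_const_nhds h.tendsto (fun _ => zero_le)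
      (fun k => eLpNorm_mono_measure _ hm),
    tendsto_of_tendsto_of_tendsto_of_le_of_le tendsto_const_nhds h.tendsto_grad
      (fun _ => zero_le) (fun k => eLpNorm_mono_measure _ hm)⟩

theorem H1Approx.congr_grad (h : H1Approx K v V w) (hVW : V =ᵐ[volume.restrict K] W) :
    H1Approx K v W w :=
  ⟨h.memLp, h.memLp_grad.ae_eq hVW, h.contDiff, h.tendsto,
    h.tendsto_grad.congr fun _ => eLpNorm_congr_ae ((ae_eq_refl _).sub hVW)⟩

theorem H1Approx.sub (hv : H1Approx K v V w) (hu : H1Approx K u W z) :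
    H1Approx K (v - u) (V - W) (fun k => w k - z k) where
  memLp := hv.memLp.sub hu.memLp
  memLp_grad := hv.memLp_grad.sub hu.memLp_grad
  contDiff k := (hv.contDiff k).sub (hu.contDiff k)
  tendsto := tendsto_eLpNorm_sub_sub one_le_two
    (fun k => (hv.contDiff k).continuous.aestronglyMeasurable.sub hv.memLp.1)
    (fun k => (hu.contDiff k).continuous.aestronglyMeasurable.sub hu.memLp.1)
    hv.tendsto hu.tendsto
  tendsto_grad := by
    simp only [gradient_sub ((hv.contDiff_one _).differentiable one_ne_zero)
      ((hu.contDiff_one _).differentiable one_ne_zero)]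
    exact tendsto_eLpNorm_sub_sub one_le_two
      (fun k => (continuous_gradient (hv.contDiff_one k)).aestronglyMeasurable.sub hv.memLp_grad.1)
      (fun k => (continuous_gradient (hu.contDiff_one k)).aestronglyMeasurable.sub hu.memLp_grad.1)
      hv.tendsto_grad hu.tendsto_grad

theorem H1Approx.const (hK : Bornology.IsBounded K) (hv : ContDiff ℝ ∞ v) :
    H1Approx K v (gradient v) (fun _ => v) :=
  ⟨memLp_restrict_of_isBounded hv.continuous hK, memLp_restrict_of_isBounded
    (continuous_gradient (hv.of_le (by exact_mod_cast le_top))) hK, fun _ => hv, by simp, by simp⟩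

theorem H1Approx.memLp_seq (h : H1Approx K v V w) (hK : Bornology.IsBounded K) (k : ℕ) :
    MemLp (w k) 2 (volume.restrict K) :=
  memLp_restrict_of_isBounded (h.contDiff k).continuous hK

theorem H1Approx.memLp_grad_seq (h : H1Approx K v V w) (hK : Bornology.IsBounded K) (k : ℕ) :
    MemLp (gradient (w k)) 2 (volume.restrict K) :=
  memLp_restrict_of_isBounded (continuous_gradient (h.contDiff_one k)) hK

theorem H1Approx.tendsto_lpNorm (h : H1Approx K v V w) (hK : Bornology.IsBounded K) :
    Tendsto (fun k => lpNorm (w k - v) 2 (volume.restrict K)) atTop (𝓝 0) :=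
  (tendsto_lpNorm_iff fun k => (h.memLp_seq hK k).sub h.memLp).2 h.tendsto

theorem H1Approx.tendsto_lpNorm_grad (h : H1Approx K v V w) (hK : Bornology.IsBounded K) :
    Tendsto (fun k => lpNorm (gradient (w k) - V) 2 (volume.restrict K)) atTop (𝓝 0) :=
  (tendsto_lpNorm_iff fun k => (h.memLp_grad_seq hK k).sub h.memLp_grad).2 h.tendsto_grad

theorem tendsto_eLpNorm_mollify_indicator_sub {F : Type*} [NormedAddCommGroup F] [NormedSpace ℝ F]
    [CompleteSpace F] {f : E n → F} {φ : ℕ → ContDiffBump (0 : E n)}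
    (hφ : Tendsto (fun k => (φ k).rOut) atTop (𝓝 0)) (hΩ : MeasurableSet Ω) (hK : MeasurableSet K)
    (hKΩ : K ⊆ Ω) (hf : MemLp f 2 (volume.restrict Ω)) :
    Tendsto (fun k => eLpNorm (mollify volume (φ k) (Ω.indicator f) - f) 2 (volume.restrict K))
      atTop (𝓝 0) := by
  have hind : MemLp (Ω.indicator f) 2 volume := (memLp_indicator_iff_restrict hΩ).2 hf
  refine tendsto_of_tendsto_of_tendsto_of_le_of_le tendsto_const_nhds
    (tendsto_eLpNorm_mollify_sub (p := 2) hφ one_le_two hind) (fun _ => zero_le) fun k => ?_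
  refine le_trans (le_of_eq (eLpNorm_congr_ae ?_)) (eLpNorm_mono_measure _ Measure.restrict_le_self)
  filter_upwards [ae_restrict_mem hK] with x hx
  simp only [Pi.sub_apply, Set.indicator_of_mem (hKΩ hx)]

theorem MemH1.exists_h1Approx (hΩ : IsOpen Ω) (hK : IsCompact K) (hKΩ : K ⊆ Ω) (hu : MemH1 Ω u) :
    ∃ w : ℕ → E n → ℝ, H1Approx K u (weakGradient Ω u) w := by
  have hm : volume.restrict K ≤ volume.restrict Ω := Measure.restrict_mono hKΩ le_rfl
  obtain ⟨φ, hφ⟩ := exists_seq_contDiffBump (0 : E n)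
  refine ⟨fun k => mollify volume (φ k) (Ω.indicator u), hu.1.mono_measure hm,
    hu.memLp_weakGradient.mono_measure hm, fun k => contDiff_mollify (φ k)
      (((memLp_indicator_iff_restrict hΩ.measurableSet).2 hu.1).locallyIntegrable one_le_two),
    tendsto_eLpNorm_mollify_indicator_sub hφ hΩ.measurableSet hK.measurableSet hKΩ hu.1, ?_⟩
  obtain ⟨δ, hδ, hδΩ⟩ := hK.exists_cthickening_subset_open hΩ hKΩ
  refine (tendsto_eLpNorm_mollify_indicator_sub hφ hΩ.measurableSet hK.measurableSet hKΩ
    hu.memLp_weakGradient).congr' ?_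
  filter_upwards [hφ.eventually (gt_mem_nhds hδ)] with k hk
  refine eLpNorm_congr_ae ?_
  filter_upwards [ae_restrict_mem hK.measurableSet] with x hx
  rw [Pi.sub_apply, Pi.sub_apply, hu.isWeakGradient.gradient_mollify hΩ hu.1 hu.memLp_weakGradient]
  exact (Metric.closedBall_subset_cthickening hx _).trans
    ((Metric.cthickening_mono hk.le K).trans hδΩ)

end H1Approx

/-- The norm `‖v‖ + ‖V‖` of the pair `(v, V)` in `L²(K)`; for `V = ∇v` it is equivalent to the
`H¹(K)` norm of `v`. -/
def h1Norm {n : ℕ} (K : Set (E n)) (v : E n → ℝ) (V : E n → E n) : ℝ :=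
  lpNorm v 2 (volume.restrict K) + lpNorm V 2 (volume.restrict K)

section H1Norm

variable {n : ℕ} {K L : Set (E n)} {u v : E n → ℝ} {V W : E n → E n} {w : ℕ → E n → ℝ}

theorem h1Norm_nonneg (K : Set (E n)) (v : E n → ℝ) (V : E n → E n) : 0 ≤ h1Norm K v V :=
  add_nonneg lpNorm_nonneg lpNorm_nonneg

theorem h1Norm_sub_comm (K : Set (E n)) (u v : E n → ℝ) (V W : E n → E n) :
    h1Norm K (u - v) (V - W) = h1Norm K (v - u) (W - V) := by
  rw [h1Norm, h1Norm, lpNorm_sub_comm u, lpNorm_sub_comm V]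

theorem h1Norm_sub_le {u₁ u₂ : E n → ℝ} {V₁ V₂ : E n → E n} (hv : MemLp v 2 (volume.restrict K))
    (hV : MemLp V 2 (volume.restrict K)) (hu₁ : MemLp u₁ 2 (volume.restrict K))
    (hV₁ : MemLp V₁ 2 (volume.restrict K)) :
    h1Norm K (u₁ - u₂) (V₁ - V₂) ≤ h1Norm K (u₁ - v) (V₁ - V) + h1Norm K (u₂ - v) (V₂ - V) := by
  rw [h1Norm_sub_comm K u₂ v V₂ V]
  have h := lpNorm_sub_le_lpNorm_sub_add_lpNorm_sub hu₁ hv one_le_two (h := u₂)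
  have hgrad := lpNorm_sub_le_lpNorm_sub_add_lpNorm_sub hV₁ hV one_le_two (h := V₂)
  rw [h1Norm, h1Norm, h1Norm]
  linarith

theorem h1Norm_mono (hLK : L ⊆ K) (hv : MemLp v 2 (volume.restrict K))
    (hV : MemLp V 2 (volume.restrict K)) : h1Norm L v V ≤ h1Norm K v V :=
  add_le_add (lpNorm_mono_measure hv (Measure.restrict_mono hLK le_rfl))
    (lpNorm_mono_measure hV (Measure.restrict_mono hLK le_rfl))

theorem H1Approx.tendsto_h1Norm_sub (h : H1Approx K v V w) (hK : Bornology.IsBounded K) :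
    Tendsto (fun k => h1Norm K (w k - v) (gradient (w k) - V)) atTop (𝓝 0) := by
  simpa only [h1Norm, add_zero] using (h.tendsto_lpNorm hK).add (h.tendsto_lpNorm_grad hK)

theorem H1Approx.tendsto_h1Norm (h : H1Approx K v V w) (hK : Bornology.IsBounded K) :
    Tendsto (fun k => h1Norm K (w k) (gradient (w k))) atTop (𝓝 (h1Norm K v V)) :=
  (tendsto_lpNorm_of_tendsto_lpNorm_sub one_le_two (h.memLp_seq hK) h.memLp
    (h.tendsto_lpNorm hK)).add (tendsto_lpNorm_of_tendsto_lpNorm_sub one_le_two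
    (h.memLp_grad_seq hK) h.memLp_grad (h.tendsto_lpNorm_grad hK))

end H1Norm

theorem integral_sq_add_mul_le {n : ℕ} {K : Set (E n)} {v : E n → ℝ} {V : E n → E n}
    (hv : MemLp v 2 (volume.restrict K)) (hV : MemLp V 2 (volume.restrict K)) :
    ∫ x in K, (v x ^ 2 + |v x| * ‖V x‖) ≤ lpNorm v 2 (volume.restrict K) * h1Norm K v V := by
  have hprod : Integrable (fun x => |v x| * ‖V x‖) (volume.restrict K) :=
    hv.norm.integrable_mul hV.norm
  have hmul := (le_abs_self _).trans (abs_integral_mul_le hv.norm hV.norm)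
  rw [lpNorm_norm hv.1, lpNorm_norm hV.1] at hmul
  have hsq := lpNorm_two_sq hv
  simp only [Real.norm_eq_abs, sq_abs] at hmul hsq
  rw [integral_add hv.integrable_sq hprod, h1Norm, mul_add, ← sq, hsq]
  gcongr

/-! ### Diffuse and sharp traces -/

theorem le_sqrt_mul_add_of_sq_le {a C x y : ℝ} (hx : 0 ≤ x) (hy : 0 ≤ y) (hC : 0 ≤ C)
    (h : a ^ 2 ≤ C * (x * (x + y))) : a ≤ √C * (x + y) := by
  refine le_of_sq_le_sq ?_ (by positivity)
  rw [mul_pow, Real.sq_sqrt hC]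
  refine h.trans (mul_le_mul_of_nonneg_left ?_ hC)
  rw [sq]
  gcongr
  exact le_add_of_nonneg_right hy

namespace BoundaryPartition

variable {n : ℕ} {U O : Set (E n)} {c : ℝ} (P : BoundaryPartition U O c)

theorem cutoff_eq_zero {x : E n} (hx : x ∉ P.carrier) : P.cutoff x = 0 :=
  Finset.sum_eq_zero fun i _ => image_eq_zero_of_notMem_tsupport
    fun h => hx (Set.mem_iUnion.2 ⟨i, h⟩)

/-- The diffuse surface measure `|∇φ_ε| dx`, localized near the boundary by the cutoff. -/
def diffuseMeasure (ε : ℝ) : Measure (E n) :=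
  volume.withDensity fun x => ENNReal.ofReal (P.cutoff x * ‖gradient (phase U ε) x‖)

theorem integral_diffuseMeasure (ε : ℝ) (F : E n → ℝ) :
    ∫ x, F x ∂P.diffuseMeasure ε = ∫ x, P.cutoff x * (F x * ‖gradient (phase U ε) x‖) := by
  have hmeas : Measurable fun x => P.cutoff x * ‖gradient (phase U ε) x‖ :=
    P.continuous_cutoff.measurable.mul (measurable_norm_gradient _)
  rw [diffuseMeasure, integral_withDensity_eq_integral_toReal_smul hmeas.ennreal_ofReal
    (.of_forall fun _ => ENNReal.ofReal_lt_top)]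
  refine integral_congr_ae (.of_forall fun x => ?_)
  dsimp only
  rw [ENNReal.toReal_ofReal (mul_nonneg (P.cutoff_nonneg x) (norm_nonneg _)), smul_eq_mul]
  ring

theorem diffuseMeasure_le {ε : ℝ} (hε : 0 < ε) :
    P.diffuseMeasure ε ≤ ENNReal.ofReal (2 * ε)⁻¹ • volume.restrict P.carrier := by
  rw [← withDensity_const, ← withDensity_indicator P.isCompact_carrier.measurableSet]
  refine withDensity_mono ?_
  filter_upwards [ae_norm_gradient_phase_le_inv (U := U) hε] with x hx
  by_cases hxP : x ∈ P.carrier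
  · rw [Set.indicator_of_mem hxP]
    exact ENNReal.ofReal_le_ofReal
      ((mul_le_of_le_one_left (norm_nonneg _) (P.cutoff_le_one x)).trans hx)
  · rw [Set.indicator_of_notMem hxP, P.cutoff_eq_zero hxP, zero_mul, ENNReal.ofReal_zero]

theorem memLp_diffuseMeasure {ε : ℝ} (hε : 0 < ε) {v : E n → ℝ}
    (hv : MemLp v 2 (volume.restrict P.carrier)) : MemLp v 2 (P.diffuseMeasure ε) :=
  hv.of_measure_le_smul ENNReal.ofReal_ne_top (P.diffuseMeasure_le hε)

theorem tendsto_eLpNorm_diffuseMeasure {ε : ℝ} (hε : 0 < ε) {f : ℕ → E n → ℝ}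
    (h : Tendsto (fun k => eLpNorm (f k) 2 (volume.restrict P.carrier)) atTop (𝓝 0)) :
    Tendsto (fun k => eLpNorm (f k) 2 (P.diffuseMeasure ε)) atTop (𝓝 0) := by
  have htop : ENNReal.ofReal (2 * ε)⁻¹ ^ (1 / 2 : ENNReal).toReal ≠ ⊤ := by finiteness
  have hmul := ENNReal.Tendsto.const_mul h (.inr htop)
  rw [mul_zero] at hmul
  exact tendsto_of_tendsto_of_tendsto_of_le_of_le tendsto_const_nhds hmul (fun _ => zero_le)
    fun k => eLpNorm_le_of_measure_le_smul (P.diffuseMeasure_le hε)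

theorem exists_lpNorm_diffuseMeasure_sq_le (hc : 0 < c) :
    ∃ C : ℝ, 0 ≤ C ∧ ∀ ε > 0, ∀ v V w, H1Approx P.carrier v V w →
      lpNorm v 2 (P.diffuseMeasure ε) ^ 2 ≤
        C * (lpNorm v 2 (volume.restrict P.carrier) * h1Norm P.carrier v V) := by
  obtain ⟨C, hC0, hC⟩ := P.exists_diffuse_trace_bound hc
  refine ⟨C, hC0, fun ε hε v V w h => ?_⟩
  have hb := P.isCompact_carrier.isBounded
  have hw := h.memLp_seq hb
  have hsmooth : ∀ k, lpNorm (w k) 2 (P.diffuseMeasure ε) ^ 2 ≤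
      C * (lpNorm (w k) 2 (volume.restrict P.carrier) *
        h1Norm P.carrier (w k) (gradient (w k))) := fun k => by
    rw [lpNorm_two_sq (P.memLp_diffuseMeasure hε (hw k)), P.integral_diffuseMeasure]
    simp only [Real.norm_eq_abs, sq_abs]
    exact (hC ε hε (w k) (h.contDiff_one k)).trans
      (mul_le_mul_of_nonneg_left (integral_sq_add_mul_le (hw k) (h.memLp_grad_seq hb k)) hC0)
  have hlim := tendsto_lpNorm_of_tendsto_lpNorm_sub one_le_two hw h.memLp (h.tendsto_lpNorm hb)
  have hlimν := tendsto_lpNorm_of_tendsto_lpNorm_sub one_le_two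
    (fun k => P.memLp_diffuseMeasure hε (hw k)) (P.memLp_diffuseMeasure hε h.memLp)
    ((tendsto_lpNorm_iff fun k => P.memLp_diffuseMeasure hε ((hw k).sub h.memLp)).2
      (P.tendsto_eLpNorm_diffuseMeasure hε h.tendsto))
  exact le_of_tendsto_of_tendsto' (hlimν.pow 2)
    ((hlim.mul (h.tendsto_h1Norm hb)).const_mul C) hsmooth

theorem exists_lpNorm_diffuseMeasure_le (hc : 0 < c) :
    ∃ A : ℝ, 0 ≤ A ∧ ∀ ε > 0, ∀ v V w, H1Approx P.carrier v V w →
      lpNorm v 2 (P.diffuseMeasure ε) ≤ A * h1Norm P.carrier v V := by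
  obtain ⟨C, hC0, hC⟩ := P.exists_lpNorm_diffuseMeasure_sq_le hc
  exact ⟨√C, Real.sqrt_nonneg _, fun ε hε v V w h =>
    le_sqrt_mul_add_of_sq_le lpNorm_nonneg lpNorm_nonneg hC0 (hC ε hε v V w h)⟩

end BoundaryPartition

section Trace

variable {n : ℕ} {U O : Set (E n)} {c : ℝ} {u v : E n → ℝ} {V : E n → E n} {w z : ℕ → E n → ℝ}

theorem isCompact_frontier_of_isBounded {X : Type*} [PseudoMetricSpace X] [ProperSpace X]
    {U : Set X} (hU : Bornology.IsBounded U) : IsCompact (frontier U) :=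
  hU.isCompact_closure.of_isClosed_subset isClosed_frontier frontier_subset_closure

theorem memLp_surfaceMeasure (hU : Bornology.IsBounded U) [IsFiniteMeasure (surfaceMeasure U)]
    {p : ENNReal} {f : E n → ℝ} (hf : Continuous f) : MemLp f p (surfaceMeasure U) := by
  obtain ⟨C, hC⟩ :=
    (isCompact_frontier_of_isBounded hU).exists_bound_of_continuousOn hf.continuousOn
  refine MemLp.of_bound hf.aestronglyMeasurable C ?_
  filter_upwards [ae_surfaceMeasure_mem_frontier U] with x hx using hC x hx

theorem isTrace_trace (h : ∃ t, IsTrace U u t) : IsTrace U u (trace U u) := by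
  rw [trace, dif_pos h]
  exact h.choose_spec

namespace BoundaryPartition

theorem exists_lpNorm_surfaceMeasure_le (P : BoundaryPartition U O c) (hc : 0 < c)
    (hU : Bornology.IsBounded U) :
    ∃ C : ℝ, 0 ≤ C ∧ ∀ v : E n → ℝ, ContDiff ℝ 1 v →
      lpNorm v 2 (surfaceMeasure U) ≤ C * h1Norm U v (gradient v) := by
  have := P.isFiniteMeasure_surfaceMeasure
  obtain ⟨C, hC0, hC⟩ := P.exists_trace_bound hc hU
  refine ⟨√C, Real.sqrt_nonneg _, fun v hv =>
    le_sqrt_mul_add_of_sq_le lpNorm_nonneg lpNorm_nonneg hC0 ?_⟩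
  rw [lpNorm_two_sq (memLp_surfaceMeasure hU hv.continuous)]
  simp only [Real.norm_eq_abs, sq_abs]
  exact (hC v hv).trans (mul_le_mul_of_nonneg_left (integral_sq_add_mul_le
    (memLp_restrict_of_isBounded hv.continuous hU)
    (memLp_restrict_of_isBounded (continuous_gradient hv) hU)) hC0)

theorem tendsto_lpNorm_surfaceMeasure_sub (P : BoundaryPartition U O c) (hc : 0 < c)
    (hU : Bornology.IsBounded U) (hw : H1Approx U v V w)
    (hz : H1Approx U v V z) :
    Tendsto (fun q : ℕ × ℕ => lpNorm (w q.1 - z q.2) 2 (surfaceMeasure U)) (atTop ×ˢ atTop)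
      (𝓝 0) := by
  obtain ⟨C, hC0, hC⟩ := P.exists_lpNorm_surfaceMeasure_le hc hU
  have hlim := (((hw.tendsto_h1Norm_sub hU).comp tendsto_fst).add
    ((hz.tendsto_h1Norm_sub hU).comp (tendsto_snd (f := (atTop : Filter ℕ))))).const_mul C
  rw [add_zero, mul_zero] at hlim
  refine squeeze_zero (fun _ => lpNorm_nonneg) (fun q => ?_) hlim
  refine (hC (w q.1 - z q.2) ((hw.contDiff_one q.1).sub (hz.contDiff_one q.2))).trans
    (mul_le_mul_of_nonneg_left ?_ hC0)
  rw [gradient_sub ((hw.contDiff_one q.1).differentiable one_ne_zero)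
    ((hz.contDiff_one q.2).differentiable one_ne_zero)]
  exact h1Norm_sub_le hw.memLp hw.memLp_grad (hw.memLp_seq hU _) (hw.memLp_grad_seq hU _)

theorem exists_tendsto_lpNorm_surfaceMeasure_sub (P : BoundaryPartition U O c) (hc : 0 < c)
    (hU : Bornology.IsBounded U) (hw : H1Approx U v V w) :
    ∃ t, MemLp t 2 (surfaceMeasure U) ∧
      Tendsto (fun k => eLpNorm (w k - t) 2 (surfaceMeasure U)) atTop (𝓝 0) := by
  have := P.isFiniteMeasure_surfaceMeasure
  have hm : ∀ k, MemLp (w k) 2 (surfaceMeasure U) := fun k =>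
    memLp_surfaceMeasure hU (hw.contDiff k).continuous
  have hcauchy : CauchySeq fun k => (hm k).toLp (w k) := by
    rw [Lp.cauchySeq_Lp_iff_cauchySeq_eLpNorm, ← prod_atTop_atTop_eq]
    refine ((tendsto_lpNorm_iff fun q : ℕ × ℕ => (hm q.1).sub (hm q.2)).1
      (P.tendsto_lpNorm_surfaceMeasure_sub hc hU hw hw)).congr fun q => eLpNorm_congr_ae ?_
    exact ((hm q.1).coeFn_toLp.sub (hm q.2).coeFn_toLp).symm
  obtain ⟨t, ht⟩ := cauchySeq_tendsto_of_complete hcauchy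
  rw [Lp.tendsto_Lp_iff_tendsto_eLpNorm'] at ht
  exact ⟨t, Lp.memLp t, ht.congr fun k => eLpNorm_congr_ae
    ((hm k).coeFn_toLp.sub (ae_eq_refl _))⟩

theorem isTrace_trace_of_h1Approx (P : BoundaryPartition U O c) (hc : 0 < c)
    (hU : Bornology.IsBounded U) (hu : MemH1 U u) (hw : H1Approx U u (weakGradient U u) w) :
    IsTrace U u (trace U u) := by
  obtain ⟨t, ht, htl⟩ := P.exists_tendsto_lpNorm_surfaceMeasure_sub hc hU hw
  exact isTrace_trace ⟨t, hu, ht, w, hw.contDiff, hw.tendsto, hw.tendsto_grad, htl⟩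

theorem memLp_trace (P : BoundaryPartition U O c) (hc : 0 < c)
    (hU : Bornology.IsBounded U) (hu : MemH1 U u) (hw : H1Approx U u (weakGradient U u) w) :
    MemLp (trace U u) 2 (surfaceMeasure U) :=
  (P.isTrace_trace_of_h1Approx hc hU hu hw).2.1

/-- By definition the trace is the limit of one approximating sequence; the trace inequality makes
it the limit of all of them. -/
theorem tendsto_lpNorm_sub_trace (P : BoundaryPartition U O c) (hc : 0 < c)
    (hU : Bornology.IsBounded U) (hu : MemH1 U u) (hw : H1Approx U u (weakGradient U u) w) :
    Tendsto (fun k => lpNorm (w k - trace U u) 2 (surfaceMeasure U)) atTop (𝓝 0) := by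
  have := P.isFiniteMeasure_surfaceMeasure
  obtain ⟨-, ht, z, hz, hz₀, hz₁, hzt⟩ := P.isTrace_trace_of_h1Approx hc hU hu hw
  have hzm : ∀ k, MemLp (z k) 2 (surfaceMeasure U) := fun k =>
    memLp_surfaceMeasure hU (hz k).continuous
  have happrox : H1Approx U u (weakGradient U u) z := ⟨hw.memLp, hw.memLp_grad, hz, hz₀, hz₁⟩
  have hwz : Tendsto (fun k => lpNorm (w k - z k) 2 (surfaceMeasure U)) atTop (𝓝 0) := by
    simpa only [Function.comp_def, Function.diag] using
      (P.tendsto_lpNorm_surfaceMeasure_sub hc hU hw happrox).comp (tendsto_diag (f := atTop))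
  have hsum := hwz.add ((tendsto_lpNorm_iff fun k => (hzm k).sub ht).2 hzt)
  rw [add_zero] at hsum
  refine squeeze_zero (fun _ => lpNorm_nonneg) (fun k => ?_) hsum
  exact lpNorm_sub_le_lpNorm_sub_add_lpNorm_sub
    (memLp_surfaceMeasure hU (hw.contDiff k).continuous) (hzm k) one_le_two

end BoundaryPartition

end Trace

/-! ### The boundary term -/

namespace BoundaryPartition

variable {n : ℕ} {U O : Set (E n)} {c : ℝ} {u v g : E n → ℝ} {V G : E n → E n}
  {us gs : ℕ → E n → ℝ} (P : BoundaryPartition U O c)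

theorem contDiff_cutoff : ContDiff ℝ 1 P.cutoff := ContDiff.sum fun i _ => P.contDiff i

theorem hasCompactSupport_cutoff : HasCompactSupport P.cutoff :=
  HasCompactSupport.intro P.isCompact_carrier fun _ => P.cutoff_eq_zero

theorem memLp_diffuseMeasure_of_continuous {ε : ℝ} (hε : 0 < ε) (hu : Continuous u) :
    MemLp u 2 (P.diffuseMeasure ε) :=
  P.memLp_diffuseMeasure hε (memLp_restrict_of_isBounded hu P.isCompact_carrier.isBounded)

theorem tendsto_lpNorm_diffuseMeasure_sq (hn : 1 ≤ n) (hU : HasCkBoundary 1 U) (hUo : IsOpen U)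
    (hbdd : Bornology.IsBounded U) (hne : (frontier U).Nonempty) (hu : ContDiff ℝ 1 u) :
    Tendsto (fun ε => lpNorm u 2 (P.diffuseMeasure ε) ^ 2) (𝓝[>] 0)
      (𝓝 (lpNorm u 2 (surfaceMeasure U) ^ 2)) := by
  have := P.isFiniteMeasure_surfaceMeasure
  have hF : ContDiff ℝ 1 fun x => P.cutoff x * u x ^ 2 := P.contDiff_cutoff.mul (hu.pow 2)
  have hlim := tendsto_integral_mul_norm_gradient_phase hn hU hUo
    (isCompact_frontier_of_isBounded hbdd) hne hF
    (hF.continuous.integrable_of_hasCompactSupport P.hasCompactSupport_cutoff.mul_right)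
    fun x => mul_nonneg (P.cutoff_nonneg x) (sq_nonneg _)
  have hsharp : ∫ x, P.cutoff x * u x ^ 2 ∂surfaceMeasure U =
      lpNorm u 2 (surfaceMeasure U) ^ 2 := by
    rw [lpNorm_two_sq (memLp_surfaceMeasure hbdd hu.continuous)]
    refine integral_congr_ae (P.ae_cutoff_eq_one.mono fun x hx => ?_)
    simp only [hx, one_mul, Real.norm_eq_abs, sq_abs]
  rw [hsharp] at hlim
  refine hlim.congr' (eventually_mem_nhdsWithin.mono fun ε hε => ?_)
  dsimp only
  rw [lpNorm_two_sq (P.memLp_diffuseMeasure_of_continuous hε hu.continuous),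
    P.integral_diffuseMeasure]
  simp only [Real.norm_eq_abs, sq_abs, mul_assoc]

theorem tendsto_integral_mul_diffuseMeasure (hn : 1 ≤ n) (hU : HasCkBoundary 1 U) (hUo : IsOpen U)
    (hbdd : Bornology.IsBounded U) (hne : (frontier U).Nonempty) (hu : ContDiff ℝ 1 u)
    (hv : ContDiff ℝ 1 v) :
    Tendsto (fun ε => ∫ x, u x * v x ∂P.diffuseMeasure ε) (𝓝[>] 0)
      (𝓝 (∫ x, u x * v x ∂surfaceMeasure U)) := by
  have := P.isFiniteMeasure_surfaceMeasure
  have hadd := P.tendsto_lpNorm_diffuseMeasure_sq hn hU hUo hbdd hne (hu.add hv)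
  have hsub := P.tendsto_lpNorm_diffuseMeasure_sq hn hU hUo hbdd hne (hu.sub hv)
  rw [integral_mul_eq_lpNorm_add_sq_sub (memLp_surfaceMeasure hbdd hu.continuous)
    (memLp_surfaceMeasure hbdd hv.continuous)]
  refine ((hadd.sub hsub).div_const 4).congr' (eventually_mem_nhdsWithin.mono fun ε hε => ?_)
  exact (integral_mul_eq_lpNorm_add_sq_sub
    (P.memLp_diffuseMeasure_of_continuous hε hu.continuous)
    (P.memLp_diffuseMeasure_of_continuous hε hv.continuous)).symm

theorem exists_abs_integral_diffuseMeasure_sub_le (hc : 0 < c) :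
    ∃ A : ℝ, ∀ ε > 0, ∀ g G gs u V us, H1Approx P.carrier g G gs → H1Approx P.carrier u V us →
      ∀ j, |(∫ x, gs j x * us j x ∂P.diffuseMeasure ε) - ∫ x, g x * u x ∂P.diffuseMeasure ε| ≤
        A * (h1Norm P.carrier (gs j - g) (gradient (gs j) - G) *
            h1Norm P.carrier (us j) (gradient (us j)) +
          h1Norm P.carrier g G * h1Norm P.carrier (us j - u) (gradient (us j) - V)) := by
  obtain ⟨A, -, hA⟩ := P.exists_lpNorm_diffuseMeasure_le hc
  refine ⟨A * A, fun ε hε g G gs u V us hg hu j => ?_⟩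
  have hconst := fun {v V w} (h : H1Approx P.carrier v V w) =>
    H1Approx.const P.isCompact_carrier.isBounded (h.contDiff j)
  have hν := fun {v V w} (h : H1Approx P.carrier v V w) => P.memLp_diffuseMeasure hε h.memLp
  have hmul : ∀ {a b x y : ℝ}, 0 ≤ a → 0 ≤ b → a ≤ A * x → b ≤ A * y → a * b ≤ A * A * (x * y) :=
    fun ha hb hx hy => (mul_le_mul hx hy hb (ha.trans hx)).trans_eq (mul_mul_mul_comm ..)
  refine (abs_integral_mul_sub_le (hν (hconst hg)) (hν (hconst hu)) (hν hg) (hν hu)).trans ?_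
  rw [mul_add]
  exact add_le_add
    (hmul lpNorm_nonneg lpNorm_nonneg (hA ε hε _ _ _ ((hconst hg).sub hg))
      (hA ε hε _ _ _ (hconst hu)))
    (hmul lpNorm_nonneg lpNorm_nonneg (hA ε hε _ _ _ hg) (hA ε hε _ _ _ ((hconst hu).sub hu)))

theorem tendstoUniformlyOnFilter_integral_diffuseMeasure (hc : 0 < c)
    (hg : H1Approx P.carrier g G gs) (hu : H1Approx P.carrier u V us) :
    TendstoUniformlyOnFilter (fun j ε => ∫ x, gs j x * us j x ∂P.diffuseMeasure ε)
      (fun ε => ∫ x, g x * u x ∂P.diffuseMeasure ε) atTop (𝓝[>] 0) := by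
  obtain ⟨A, hA⟩ := P.exists_abs_integral_diffuseMeasure_sub_le hc
  have hb := P.isCompact_carrier.isBounded
  have herr := (((hg.tendsto_h1Norm_sub hb).mul (hu.tendsto_h1Norm hb)).add
    ((hu.tendsto_h1Norm_sub hb).const_mul (h1Norm P.carrier g G))).const_mul A
  rw [zero_mul, mul_zero, add_zero, mul_zero] at herr
  rw [Metric.tendstoUniformlyOnFilter_iff]
  intro η hη
  filter_upwards [(herr.eventually_lt_const hη).prod_mk (self_mem_nhdsWithin (s := Set.Ioi 0))]
    with ⟨j, ε⟩ ⟨hj, hε⟩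
  rw [dist_comm, Real.dist_eq]
  exact (hA ε hε g G gs u V us hg hu j).trans_lt hj

theorem tendsto_integral_trace_mul_trace (P : BoundaryPartition U O c) (hc : 0 < c)
    (hU : Bornology.IsBounded U)
    (hg : MemH1 U g) (hu : MemH1 U u) (hgs : H1Approx U g (weakGradient U g) gs)
    (hus : H1Approx U u (weakGradient U u) us) :
    Tendsto (fun j => ∫ x, gs j x * us j x ∂surfaceMeasure U) atTop
      (𝓝 (∫ x, trace U g x * trace U u x ∂surfaceMeasure U)) := by
  have := P.isFiniteMeasure_surfaceMeasure
  exact tendsto_integral_mul (fun j => memLp_surfaceMeasure hU (hgs.contDiff j).continuous)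
    (P.memLp_trace hc hU hg hgs) (fun j => memLp_surfaceMeasure hU (hus.contDiff j).continuous)
    (P.memLp_trace hc hU hu hus) (P.tendsto_lpNorm_sub_trace hc hU hg hgs)
    (P.tendsto_lpNorm_sub_trace hc hU hu hus)

theorem tendsto_integral_diffuseMeasure_trace (hc : 0 < c) (hn : 1 ≤ n) (hU : HasCkBoundary 1 U)
    (hUo : IsOpen U) (hO : IsOpen O) (hbdd : Bornology.IsBounded U) (hne : (frontier U).Nonempty)
    (hsub : closure U ⊆ O) (hg : MemH1 O g) (hu : MemH1 O u) :
    Tendsto (fun ε => ∫ x, g x * u x ∂P.diffuseMeasure ε) (𝓝[>] 0)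
      (𝓝 (∫ x, trace U g x * trace U u x ∂surfaceMeasure U)) := by
  have hUO : U ⊆ O := subset_closure.trans hsub
  have hK : IsCompact (P.carrier ∪ closure U) := P.isCompact_carrier.union hbdd.isCompact_closure
  have hKO : P.carrier ∪ closure U ⊆ O := Set.union_subset P.carrier_subset hsub
  have happrox : ∀ {v : E n → ℝ}, MemH1 O v → ∃ w,
      H1Approx P.carrier v (weakGradient O v) w ∧ H1Approx U v (weakGradient U v) w := fun hv => by
    obtain ⟨w, hw⟩ := hv.exists_h1Approx hO hK hKO
    exact ⟨w, hw.mono Set.subset_union_left,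
      (hw.mono (subset_closure.trans Set.subset_union_right)).congr_grad
        (hv.weakGradient_ae_eq hUo hUO).symm⟩
  obtain ⟨gs, hgs, hgsU⟩ := happrox hg
  obtain ⟨us, hus, husU⟩ := happrox hu
  have hunif := P.tendstoUniformlyOnFilter_integral_diffuseMeasure hc hgs hus
  exact hunif.tendsto_of_eventually_tendsto
    (.of_forall fun j => P.tendsto_integral_mul_diffuseMeasure hn hU hUo hbdd hne
      (hgs.contDiff_one j) (hus.contDiff_one j))
    (P.tendsto_integral_trace_mul_trace hc hbdd (hg.mono hUO) (hu.mono hUO) hgsU husU)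

theorem setIntegral_mul_norm_gradient_phase_eq {ε : ℝ} (hε : 0 < ε) {F : E n → ℝ}
    (hF : IntegrableOn F O) :
    ∫ x in O, F x * ‖gradient (phase U ε) x‖ = (∫ x, F x ∂P.diffuseMeasure ε) +
      ∫ x in O, (1 - P.cutoff x) * (F x * ‖gradient (phase U ε) x‖) := by
  rw [P.integral_mul_norm_gradient_phase_eq Measure.restrict_le_self.absolutelyContinuous hε hF,
    P.integral_diffuseMeasure, setIntegral_eq_integral_of_forall_compl_eq_zero]
  intro x hx
  rw [P.cutoff_eq_zero fun h => hx (P.carrier_subset h), zero_mul]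

theorem abs_setIntegral_one_sub_cutoff_le {ε : ℝ} (hε : 0 < ε)
    (hg : MemLp g 2 (volume.restrict O)) (hu : MemLp u 2 (volume.restrict O)) :
    |∫ x in O, (1 - P.cutoff x) * (g x * u x * ‖gradient (phase U ε) x‖)| ≤
      ε * ((2 * P.d ^ 2)⁻¹ *
        (lpNorm g 2 (volume.restrict O) * lpNorm u 2 (volume.restrict O))) := by
  have hgu : ∫ x in O, |(g * u) x| ≤
      lpNorm g 2 (volume.restrict O) * lpNorm u 2 (volume.restrict O) := by
    have h := (le_abs_self _).trans (abs_integral_mul_le hg.norm hu.norm)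
    rw [lpNorm_norm hg.1, lpNorm_norm hu.1] at h
    simpa only [Pi.mul_apply, abs_mul, Real.norm_eq_abs] using h
  refine (P.abs_integral_one_sub_cutoff_le Measure.restrict_le_self.absolutelyContinuous hε
    (hg.integrable_mul hu)).trans ?_
  gcongr

theorem tendsto_integral_boundary (P : BoundaryPartition U O c) (hc : 0 < c) (hn : 1 ≤ n)
    (hU : HasCkBoundary 1 U) (hUo : IsOpen U) (hO : IsOpen O) (hbdd : Bornology.IsBounded U)
    (hne : (frontier U).Nonempty) (hsub : closure U ⊆ O) (hg : MemH1 O g) (hu : MemH1 O u) :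
    Tendsto (fun ε => ∫ x in O, g x * u x * ‖gradient (phase U ε) x‖) (𝓝[>] 0)
      (𝓝 (∫ x, trace U g x * trace U u x ∂surfaceMeasure U)) := by
  have hfar : Tendsto (fun ε => ∫ x in O,
      (1 - P.cutoff x) * (g x * u x * ‖gradient (phase U ε) x‖)) (𝓝[>] 0) (𝓝 0) := by
    have hid : Tendsto id (𝓝[>] (0 : ℝ)) (𝓝 0) := tendsto_nhdsWithin_of_tendsto_nhds tendsto_id
    have hbound := hid.mul_const ((2 * P.d ^ 2)⁻¹ *
      (lpNorm g 2 (volume.restrict O) * lpNorm u 2 (volume.restrict O)))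
    rw [zero_mul] at hbound
    exact squeeze_zero_norm' (eventually_mem_nhdsWithin.mono fun ε hε =>
      P.abs_setIntegral_one_sub_cutoff_le hε hg.1 hu.1) hbound
  have hnear := P.tendsto_integral_diffuseMeasure_trace hc hn hU hUo hO hbdd hne hsub hg hu
  have hsum := hnear.add hfar
  rw [add_zero] at hsum
  refine hsum.congr' (eventually_mem_nhdsWithin.mono fun ε hε => ?_)
  exact (P.setIntegral_mul_norm_gradient_phase_eq hε (hg.1.integrable_mul hu.1)).symm

theorem exists_abs_integral_boundary_le (hc : 0 < c) (hO : IsOpen O) (hg : MemH1 O g) :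
    ∃ C : ℝ, 0 ≤ C ∧ ∀ ε ∈ Set.Ioo (0 : ℝ) 1, ∀ v V w, H1Approx P.carrier v V w →
      MemLp v 2 (volume.restrict O) → MemLp V 2 (volume.restrict O) →
      |∫ x in O, g x * v x * ‖gradient (phase U ε) x‖| ≤
        C * (√(lpNorm v 2 (volume.restrict O) * h1Norm O v V) +
          lpNorm v 2 (volume.restrict O)) := by
  obtain ⟨A, hA0, hA⟩ := P.exists_lpNorm_diffuseMeasure_le hc
  obtain ⟨B, hB0, hB⟩ := P.exists_lpNorm_diffuseMeasure_sq_le hc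
  obtain ⟨gs, hgs⟩ := hg.exists_h1Approx hO P.isCompact_carrier P.carrier_subset
  set a := A * h1Norm P.carrier g (weakGradient O g) * √B
  set b := (2 * P.d ^ 2)⁻¹ * lpNorm g 2 (volume.restrict O)
  have ha : 0 ≤ a := mul_nonneg (mul_nonneg hA0 (h1Norm_nonneg _ _ _)) (Real.sqrt_nonneg _)
  have hb : 0 ≤ b := mul_nonneg (by positivity) lpNorm_nonneg
  refine ⟨a + b, add_nonneg ha hb, fun ε hε v V w h hv hV => ?_⟩
  have hv_near : lpNorm v 2 (P.diffuseMeasure ε) ≤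
      √B * √(lpNorm v 2 (volume.restrict O) * h1Norm O v V) := by
    rw [← Real.sqrt_mul hB0]
    refine Real.le_sqrt_of_sq_le ((hB ε hε.1 v V w h).trans (mul_le_mul_of_nonneg_left ?_ hB0))
    exact mul_le_mul (lpNorm_mono_measure hv (Measure.restrict_mono P.carrier_subset le_rfl))
      (h1Norm_mono P.carrier_subset hv hV) (h1Norm_nonneg _ _ _) lpNorm_nonneg
  have hnear : |∫ x, g x * v x ∂P.diffuseMeasure ε| ≤
      a * √(lpNorm v 2 (volume.restrict O) * h1Norm O v V) := by
    refine (abs_integral_mul_le (P.memLp_diffuseMeasure hε.1 hgs.memLp)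
      (P.memLp_diffuseMeasure hε.1 h.memLp)).trans ?_
    rw [mul_assoc (A * _)]
    exact mul_le_mul (hA ε hε.1 _ _ _ hgs) hv_near lpNorm_nonneg
      (mul_nonneg hA0 (h1Norm_nonneg _ _ _))
  have hfar : |∫ x in O, (1 - P.cutoff x) * (g x * v x * ‖gradient (phase U ε) x‖)| ≤
      b * lpNorm v 2 (volume.restrict O) := by
    refine (P.abs_setIntegral_one_sub_cutoff_le hε.1 hg.1 hv).trans ?_
    rw [← mul_assoc (2 * P.d ^ 2)⁻¹]
    exact mul_le_of_le_one_left (mul_nonneg hb lpNorm_nonneg) hε.2.le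
  rw [P.setIntegral_mul_norm_gradient_phase_eq hε.1 (F := fun x => g x * v x)
    (hg.1.integrable_mul hv), mul_add]
  refine (abs_add_le _ _).trans (add_le_add
    (hnear.trans (mul_le_mul_of_nonneg_right (le_add_of_nonneg_right hb) (Real.sqrt_nonneg _)))
    (hfar.trans (mul_le_mul_of_nonneg_right (le_add_of_nonneg_left ha) lpNorm_nonneg)))

end BoundaryPartition

/-! ### Weak limits of gradients -/

theorem exists_tendsto_inner_of_norm_le {H ι : Type*} [NormedAddCommGroup H]
    [InnerProductSpace ℝ H] [CompleteSpace H] (𝓤 : Ultrafilter ι) {x : ι → H} {R : ℝ}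
    (hx : ∀ᶠ i in 𝓤, ‖x i‖ ≤ R) :
    ∃ y : H, ∀ z : H, Tendsto (fun i => inner ℝ (x i) z) 𝓤 (𝓝 (inner ℝ y z)) := by
  let F : ι → WeakDual ℝ H := fun i => StrongDual.toWeakDual (InnerProductSpace.toDual ℝ H (x i))
  have hF : ∀ᶠ i in 𝓤, F i ∈ WeakDual.toStrongDual ⁻¹' Metric.closedBall (0 : StrongDual ℝ H) R :=
    hx.mono fun i hi => by simpa [F] using hi
  obtain ⟨ℓ, -, hℓ⟩ := (WeakDual.isCompact_closedBall 0 R).ultrafilter_le_nhds (𝓤.map F)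
    (le_principal_iff.2 hF)
  refine ⟨(InnerProductSpace.toDual ℝ H).symm (WeakDual.toStrongDual ℓ), fun z => ?_⟩
  rw [InnerProductSpace.toDual_symm_apply]
  exact ((WeakDual.eval_continuous z).tendsto ℓ).comp (show Tendsto F 𝓤 (𝓝 ℓ) from hℓ)

theorem exists_tendstoWeakly {α ι H : Type*} [MeasurableSpace α] {μ : Measure α}
    [NormedAddCommGroup H] [InnerProductSpace ℝ H] [CompleteSpace H] (𝓤 : Ultrafilter ι)
    {W : ι → α → H} {R : ℝ} (hW : ∀ᶠ i in 𝓤, MemLp (W i) 2 μ ∧ lpNorm (W i) 2 μ ≤ R) :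
    ∃ G : α → H, TendstoWeakly μ W 𝓤 G := by
  classical
  let X : ι → Lp H 2 μ := fun i => if hi : MemLp (W i) 2 μ then hi.toLp else 0
  have hX : ∀ᶠ i in 𝓤, ‖X i‖ ≤ R := hW.mono fun i hi => by
    simpa only [X, dif_pos hi.1, norm_toLp_eq_lpNorm] using hi.2
  obtain ⟨Y, hY⟩ := exists_tendsto_inner_of_norm_le 𝓤 hX
  refine ⟨Y, Lp.memLp Y, ⟨R, hW⟩, fun Z hZ => ?_⟩
  have hYZ := inner_toLp (Lp.memLp Y) hZ
  rw [Lp.toLp_coeFn] at hYZ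
  rw [← hYZ]
  refine (hY hZ.toLp).congr' (hW.mono fun i hi => ?_)
  simp only [X, dif_pos hi.1, inner_toLp hi.1 hZ]

theorem IsWeakGradient.of_tendsto {n : ℕ} {Ω : Set (E n)} {ι : Type*} {l : Filter ι} [l.NeBot]
    {u : E n → ℝ} {v : ι → E n → ℝ} {G : E n → E n} {W : ι → E n → E n}
    (hW : ∀ᶠ i in l, IsWeakGradient Ω (v i) (W i))
    (hu : MemLp u 2 (volume.restrict Ω)) (hv : ∀ i, MemLp (v i) 2 (volume.restrict Ω))
    (hvu : Tendsto (fun i => lpNorm (v i - u) 2 (volume.restrict Ω)) l (𝓝 0))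
    (hWG : TendstoWeakly (volume.restrict Ω) W l G) : IsWeakGradient Ω u G := by
  intro φ hφ hφc hφs y
  have hd : MemLp (fun x => fderiv ℝ φ x y) 2 (volume.restrict Ω) :=
    (((hφ.continuous_fderiv (by simp)).clm_apply continuous_const).memLp_of_hasCompactSupport
      (hφc.fderiv_apply (𝕜 := ℝ) y)).restrict Ω
  have hφy : MemLp (fun x => φ x • y) 2 (volume.restrict Ω) :=
    ((hφ.continuous.smul continuous_const).memLp_of_hasCompactSupport hφc.smul_right).restrict Ω
  have hleft := tendsto_integral_mul hv hu (fun _ => hd) hd hvu (by simp)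
  have hright := (hWG.tendsto_integral _ hφy).neg
  simp only [inner_smul_right, mul_comm (φ _)] at hright
  exact tendsto_nhds_unique (hleft.congr' (hW.mono fun i hi => hi φ hφ hφc hφs y)) hright

/-! ### Coefficients -/

theorem frontier_nonempty_of_isBounded {X : Type*} [NormedAddCommGroup X] [NormedSpace ℝ X]
    [Nontrivial X] {U : Set X} (hne : U.Nonempty) (hbdd : Bornology.IsBounded U) :
    (frontier U).Nonempty :=
  nonempty_frontier_iff.2 ⟨hne, fun h => NormedSpace.unbounded_univ ℝ X (h ▸ hbdd)⟩

theorem isOpen_cuboid {n : ℕ} (a b : Fin n → ℝ) : IsOpen (cuboid a b) := by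
  simp only [cuboid, Set.ofPred_forall]
  refine isOpen_iInter_of_finite fun i => ?_
  have hi : Continuous fun x : E n => x i := by fun_prop
  exact (isOpen_lt continuous_const hi).inter (isOpen_lt hi continuous_const)

section Coefficients

variable {n : ℕ} {Ω U : Set (E n)} {s t : E n → ℝ} {x : E n} {μ : Measure (E n)}

theorem diffuseCoeff_mem_uIcc (U : Set (E n)) (ε : ℝ) (s t : E n → ℝ) (x : E n) :
    diffuseCoeff U ε s t x ∈ Set.uIcc (s x) (t x) := by
  rw [← segment_eq_uIcc]
  refine ⟨phase U ε x, 1 - phase U ε x, phase_nonneg x, sub_nonneg.2 (phase_le_one x),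
    add_sub_cancel _ _, ?_⟩
  simp only [smul_eq_mul, diffuseCoeff]
  ring

theorem min_le_diffuseCoeff (U : Set (E n)) (ε : ℝ) (s t : E n → ℝ) (x : E n) :
    min (s x) (t x) ≤ diffuseCoeff U ε s t x :=
  (diffuseCoeff_mem_uIcc U ε s t x).1

theorem abs_diffuseCoeff_le (U : Set (E n)) (ε : ℝ) (s t : E n → ℝ) (x : E n) :
    |diffuseCoeff U ε s t x| ≤ max |s x| |t x| := by
  obtain ⟨h₁, h₂⟩ | ⟨h₁, h₂⟩ := Set.mem_uIcc.1 (diffuseCoeff_mem_uIcc U ε s t x)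
  · exact abs_le_max_abs_abs h₁ h₂
  · rw [max_comm]
    exact abs_le_max_abs_abs h₁ h₂

theorem abs_sharpCoeff_le (Ω U : Set (E n)) (s t : E n → ℝ) (x : E n) :
    |sharpCoeff Ω U s t x| ≤ max |s x| |t x| := by
  by_cases hx : x ∈ U
  · rw [sharpCoeff, Set.indicator_of_mem hx,
      Set.indicator_of_notMem fun h => h.2 (subset_closure hx), add_zero]
    exact le_max_left _ _
  · rw [sharpCoeff, Set.indicator_of_notMem hx, zero_add]
    exact (norm_indicator_le_norm_self t x).trans (le_max_right _ _)

theorem sharpCoeff_eq (hx : x ∈ Ω) (hxf : x ∉ frontier U) :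
    sharpCoeff Ω U s t x = t x + (s x - t x) * U.indicator (fun _ => 1) x := by
  by_cases hU : x ∈ U
  · rw [sharpCoeff, Set.indicator_of_mem hU, Set.indicator_of_mem hU,
      Set.indicator_of_notMem fun h => h.2 (subset_closure hU)]
    ring
  · have hc : x ∉ closure U := fun h =>
      (closure_eq_self_union_frontier U ▸ h : x ∈ U ∪ frontier U).elim hU hxf
    rw [sharpCoeff, Set.indicator_of_notMem hU, Set.indicator_of_notMem hU,
      Set.indicator_of_mem (Set.mem_sdiff_of_mem hx hc)]
    ring

theorem memLp_sharpCoeff {p : ENNReal} (hΩ : MeasurableSet Ω) (hU : MeasurableSet U)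
    (hs : MemLp s p μ) (ht : MemLp t p μ) : MemLp (sharpCoeff Ω U s t) p μ :=
  (hs.indicator hU).add (ht.indicator (hΩ.diff isClosed_closure.measurableSet))

theorem memLp_phase_smul {p : ENNReal} {f : E n → ℝ} (U : Set (E n)) (ε : ℝ) (hf : MemLp f p μ) :
    MemLp (phase U ε • f) p μ :=
  memLp_bdd_smul (continuous_phase U ε).aestronglyMeasurable
    (.of_forall fun x => abs_phase_le_one x) hf

theorem diffuseCoeff_eq (U : Set (E n)) (ε : ℝ) (s t : E n → ℝ) :
    diffuseCoeff U ε s t = t + phase U ε • (s - t) := by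
  funext x
  simp only [diffuseCoeff, Pi.add_apply, smul_eq_mul, Pi.mul_apply, Pi.sub_apply, mul_comm]

theorem memLp_diffuseCoeff {p : ENNReal} (U : Set (E n)) (ε : ℝ) (hs : MemLp s p μ)
    (ht : MemLp t p μ) : MemLp (diffuseCoeff U ε s t) p μ := by
  rw [diffuseCoeff_eq]
  exact ht.add (memLp_phase_smul U ε (hs.sub ht))

theorem lpNorm_diffuseCoeff_le {p : ENNReal} (hp : 1 ≤ p) (U : Set (E n)) (ε : ℝ)
    (hs : MemLp s p μ) (ht : MemLp t p μ) :
    lpNorm (diffuseCoeff U ε s t) p μ ≤ lpNorm t p μ + lpNorm (s - t) p μ := by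
  have h := lpNorm_bdd_smul_le (continuous_phase U ε).aestronglyMeasurable
    (.of_forall fun x => abs_phase_le_one x) (hs.sub ht)
  rw [abs_one, one_mul] at h
  rw [diffuseCoeff_eq]
  exact (lpNorm_add_le ht hp).trans (add_le_add_right h _)

theorem ae_mem_and_notMem_frontier (hΩ : MeasurableSet Ω) (hnull : volume (frontier U) = 0) :
    ∀ᵐ x ∂volume.restrict Ω, x ∈ Ω ∧ x ∉ frontier U :=
  (ae_restrict_mem hΩ).and (ae_restrict_of_ae (measure_eq_zero_iff_ae_notMem.1 hnull))

theorem ae_tendsto_diffuseCoeff (hΩ : MeasurableSet Ω) (hne : (frontier U).Nonempty)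
    (hnull : volume (frontier U) = 0) (s t : E n → ℝ) :
    ∀ᵐ x ∂volume.restrict Ω, Tendsto (fun ε => diffuseCoeff U ε s t x) (𝓝[>] 0)
      (𝓝 (sharpCoeff Ω U s t x)) := by
  filter_upwards [ae_mem_and_notMem_frontier hΩ hnull] with x ⟨hx, hxf⟩
  rw [sharpCoeff_eq hx hxf]
  exact ((tendsto_phase hne hxf).const_mul _).const_add _

end Coefficients

section CoefficientLimits

variable {n : ℕ} {Ω U : Set (E n)} {ι : Type*} {l : Filter ι} [l.IsCountablyGenerated] {e : ι → ℝ}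

theorem tendsto_lpNorm_diffuseCoeff_sub {s t : E n → ℝ} (hΩ : MeasurableSet Ω)
    (hU : MeasurableSet U) (hne : (frontier U).Nonempty) (hnull : volume (frontier U) = 0)
    (hs : MemLp s 2 (volume.restrict Ω)) (ht : MemLp t 2 (volume.restrict Ω))
    (he : Tendsto e l (𝓝[>] 0)) :
    Tendsto (fun i => lpNorm (diffuseCoeff U (e i) s t - sharpCoeff Ω U s t) 2
      (volume.restrict Ω)) l (𝓝 0) := by
  have hphase := tendsto_lpNorm_bdd_smul_sub_smul (m := fun i => phase U (e i))
    (fun i => (continuous_phase U (e i)).aestronglyMeasurable)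
    (measurable_const.indicator hU).aestronglyMeasurable
    (fun i => .of_forall fun x => abs_phase_le_one x)
    (.of_forall fun x => (norm_indicator_le_norm_self (fun _ => (1 : ℝ)) x).trans_eq norm_one)
    ((ae_mem_and_notMem_frontier hΩ hnull).mono fun _ hx => (tendsto_phase hne hx.2).comp he)
    (hs.sub ht)
  refine hphase.congr fun i => lpNorm_congr_ae ?_
  filter_upwards [ae_mem_and_notMem_frontier hΩ hnull] with x ⟨hx, hxf⟩
  rw [diffuseCoeff_eq, Pi.sub_apply, Pi.sub_apply, sharpCoeff_eq hx hxf]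
  simp only [Pi.add_apply, Pi.sub_apply, smul_eq_mul, Pi.mul_apply]
  ring

variable (hΩ : MeasurableSet Ω) (hU : MeasurableSet U) (hne : (frontier U).Nonempty)
  (hnull : volume (frontier U) = 0) (he : Tendsto e l (𝓝[>] 0)) (s t : ℝ)
include hΩ hU hne hnull he

theorem tendsto_lpNorm_diffuseCoeff_smul_sub {H : Type*} [NormedAddCommGroup H] [NormedSpace ℝ H]
    {G : E n → H} (hG : MemLp G 2 (volume.restrict Ω)) :
    Tendsto (fun i => lpNorm (diffuseCoeff U (e i) (fun _ => s) (fun _ => t) • G -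
      sharpCoeff Ω U (fun _ => s) (fun _ => t) • G) 2 (volume.restrict Ω)) l (𝓝 0) :=
  tendsto_lpNorm_bdd_smul_sub_smul
    (fun i => (memLp_diffuseCoeff U (e i) (memLp_top_const s) (memLp_top_const t)).1)
    (memLp_sharpCoeff hΩ hU (memLp_top_const s) (memLp_top_const t)).1
    (fun i => .of_forall fun x => abs_diffuseCoeff_le U (e i) _ _ x)
    (.of_forall fun x => abs_sharpCoeff_le Ω U _ _ x)
    ((ae_tendsto_diffuseCoeff hΩ hne hnull _ _).mono fun _ hx => hx.comp he) hG

theorem tendsto_integral_diffuseCoeff_mul_sq {v : ι → E n → ℝ} {v₀ : E n → ℝ}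
    (hv : ∀ i, MemLp (v i) 2 (volume.restrict Ω)) (hv₀ : MemLp v₀ 2 (volume.restrict Ω))
    (hlim : Tendsto (fun i => lpNorm (v i - v₀) 2 (volume.restrict Ω)) l (𝓝 0)) :
    Tendsto (fun i => ∫ x in Ω, diffuseCoeff U (e i) (fun _ => s) (fun _ => t) x * v i x ^ 2) l
      (𝓝 (∫ x in Ω, sharpCoeff Ω U (fun _ => s) (fun _ => t) x * v₀ x ^ 2)) := by
  simp only [sq]
  exact tendsto_integral_bdd_mul_mul
    (fun i => (memLp_diffuseCoeff U (e i) (memLp_top_const s) (memLp_top_const t)).1)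
    (memLp_sharpCoeff hΩ hU (memLp_top_const s) (memLp_top_const t)).1
    (fun i => .of_forall fun x => abs_diffuseCoeff_le U (e i) _ _ x)
    (.of_forall fun x => abs_sharpCoeff_le Ω U _ _ x)
    ((ae_tendsto_diffuseCoeff hΩ hne hnull _ _).mono fun _ hx => hx.comp he)
    hv hv₀ hv hv₀ hlim hlim

theorem TendstoWeakly.tendsto_integral_diffuseCoeff_mul_inner {l' : Filter ι} (hl : l' ≤ l)
    {W : ι → E n → E n} {G Z : E n → E n} (hW : TendstoWeakly (volume.restrict Ω) W l' G)
    (hZ : MemLp Z 2 (volume.restrict Ω)) :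
    Tendsto (fun i => ∫ x in Ω, diffuseCoeff U (e i) (fun _ => s) (fun _ => t) x *
        inner ℝ (W i x) (Z x)) l'
      (𝓝 (∫ x in Ω, sharpCoeff Ω U (fun _ => s) (fun _ => t) x * inner ℝ (G x) (Z x))) := by
  simpa only [Pi.smul_apply', inner_smul_right] using hW.tendsto_integral_inner
    (fun i => memLp_bdd_smul
      (memLp_diffuseCoeff U (e i) (memLp_top_const s) (memLp_top_const t)).1
      (.of_forall fun x => abs_diffuseCoeff_le U (e i) _ _ x) hZ)
    (memLp_bdd_smul (memLp_sharpCoeff hΩ hU (memLp_top_const s) (memLp_top_const t)).1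
      (.of_forall fun x => abs_sharpCoeff_le Ω U _ _ x) hZ)
    ((tendsto_lpNorm_diffuseCoeff_smul_sub hΩ hU hne hnull he s t hZ).mono_left hl)

end CoefficientLimits

/-! ### Energies -/

theorem le_of_mul_sq_le_add_mul {a A C D : ℝ} (ha : 0 < a) (hA : 0 ≤ A) (hC : 0 ≤ C)
    (h : a * D ^ 2 ≤ A + C * D) : D ≤ 1 + (A + C) / a := by
  have hAC : 0 ≤ (A + C) / a := by positivity
  rcases le_or_gt D 1 with hD | hD
  · linarith
  · suffices D ≤ (A + C) / a by linarith
    rw [le_div_iff₀ ha]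
    nlinarith

theorem sqrt_mul_add_le_add {N D : ℝ} (hN : 0 ≤ N) (hD : 0 ≤ D) : √(N * (N + D)) ≤ N + D := by
  rw [Real.sqrt_le_left (by positivity), sq]
  exact mul_le_mul_of_nonneg_right (by linarith) (by positivity)

section BoundedCoefficient

variable {α H : Type*} [MeasurableSpace α] {μ : Measure α} [NormedAddCommGroup H] {D : α → ℝ}
  {V W : α → H}

theorem integrable_mul_of_memLp_top {F : α → ℝ} (hD : MemLp D ⊤ μ) (hF : Integrable F μ) :
    Integrable (fun x => D x * F x) μ :=
  hD.integrable_mul (memLp_one_iff_integrable.2 hF)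

theorem integrable_mul_norm_sq (hD : MemLp D ⊤ μ) (hW : MemLp W 2 μ) :
    Integrable (fun x => D x * ‖W x‖ ^ 2) μ :=
  integrable_mul_of_memLp_top hD ((memLp_two_iff_integrable_sq_norm hW.1).1 hW)

theorem mul_lpNorm_sq_le_integral {m : ℝ} (hD : MemLp D ⊤ μ) (hm : ∀ x, m ≤ D x)
    (hW : MemLp W 2 μ) : m * lpNorm W 2 μ ^ 2 ≤ ∫ x, D x * ‖W x‖ ^ 2 ∂μ := by
  rw [lpNorm_two_sq hW, ← integral_const_mul]
  exact integral_mono (((memLp_two_iff_integrable_sq_norm hW.1).1 hW).const_mul m)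
    (integrable_mul_norm_sq hD hW) fun x => mul_le_mul_of_nonneg_right (hm x) (sq_nonneg _)

theorem abs_integral_bdd_mul_sq_le {M : ℝ} {v : α → ℝ} (hD : AEStronglyMeasurable D μ)
    (hM : ∀ᵐ x ∂μ, ‖D x‖ ≤ M) (hv : MemLp v 2 μ) :
    |∫ x, D x * v x ^ 2 ∂μ| ≤ |M| * lpNorm v 2 μ ^ 2 :=
  calc |∫ x, D x * v x ^ 2 ∂μ| = |∫ x, (D • v) x * v x ∂μ| := by
        simp only [Pi.smul_apply', smul_eq_mul, sq, mul_assoc]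
    _ ≤ lpNorm (D • v) 2 μ * lpNorm v 2 μ := abs_integral_mul_le (memLp_bdd_smul hD hM hv) hv
    _ ≤ |M| * lpNorm v 2 μ * lpNorm v 2 μ := by
        exact mul_le_mul_of_nonneg_right (lpNorm_bdd_smul_le hD hM hv) lpNorm_nonneg
    _ = |M| * lpNorm v 2 μ ^ 2 := by ring

theorem integral_inner_sub_half_le [InnerProductSpace ℝ H] (hD : MemLp D ⊤ μ) (hD₀ : ∀ x, 0 ≤ D x)
    (hW : MemLp W 2 μ) (hV : MemLp V 2 μ) :
    (∫ x, D x * inner ℝ (W x) (V x) ∂μ) - 1 / 2 * ∫ x, D x * ‖V x‖ ^ 2 ∂μ ≤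
      1 / 2 * ∫ x, D x * ‖W x‖ ^ 2 ∂μ := by
  have hWV := integrable_mul_of_memLp_top hD (integrable_inner hW hV)
  have hVV := (integrable_mul_norm_sq hD hV).const_mul (1 / 2)
  rw [← integral_const_mul, ← integral_const_mul, ← integral_sub hWV hVV]
  refine integral_mono (hWV.sub hVV) ((integrable_mul_norm_sq hD hW).const_mul _) fun x => ?_
  have hexpand := norm_sub_sq_real (W x) (V x)
  have hsq := mul_nonneg (hD₀ x) (sq_nonneg ‖W x - V x‖)
  rw [hexpand] at hsq
  linarith

end BoundedCoefficient

section EnergyParts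

variable {n : ℕ} {Ω : Set (E n)} {D c f u : E n → ℝ}

/-- The weighted Dirichlet energy `½ ∫_Ω D |∇u|²` of `u ∈ H¹(Ω)`. -/
def gradientEnergy (Ω : Set (E n)) (D u : E n → ℝ) : ℝ :=
  1 / 2 * ∫ x in Ω, D x * ‖weakGradient Ω u x‖ ^ 2

/-- The mass and load terms `½ ∫_Ω c u² - ∫_Ω f u` of the energies, continuous on `L²(Ω)`. -/
def lowerOrderEnergy (Ω : Set (E n)) (c f u : E n → ℝ) : ℝ :=
  1 / 2 * (∫ x in Ω, c x * u x ^ 2) - ∫ x in Ω, f x * u x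

theorem integrable_and_integral_bulk_eq (hD : MemLp D ⊤ (volume.restrict Ω))
    (hc : MemLp c ⊤ (volume.restrict Ω)) (hf : MemLp f 2 (volume.restrict Ω)) (hu : MemH1 Ω u) :
    IntegrableOn (fun x => 1 / 2 * (D x * ‖weakGradient Ω u x‖ ^ 2 + c x * u x ^ 2) - f x * u x)
      Ω ∧
    ∫ x in Ω, (1 / 2 * (D x * ‖weakGradient Ω u x‖ ^ 2 + c x * u x ^ 2) - f x * u x) =
      gradientEnergy Ω D u + lowerOrderEnergy Ω c f u := by
  have hgrad := integrable_mul_norm_sq hD hu.memLp_weakGradient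
  have hmass := integrable_mul_of_memLp_top hc hu.1.integrable_sq
  have hload : Integrable (fun x => f x * u x) (volume.restrict Ω) := hf.integrable_mul hu.1
  have hquad := (hgrad.fun_add hmass).const_mul (1 / 2)
  refine ⟨hquad.sub hload, ?_⟩
  rw [integral_sub hquad hload, integral_const_mul, integral_add hgrad hmass, gradientEnergy,
    lowerOrderEnergy]
  ring

theorem abs_lowerOrderEnergy_le {M : ℝ} (hc : AEStronglyMeasurable c (volume.restrict Ω))
    (hM : ∀ᵐ x ∂volume.restrict Ω, ‖c x‖ ≤ M) (hf : MemLp f 2 (volume.restrict Ω))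
    (hu : MemLp u 2 (volume.restrict Ω)) :
    |lowerOrderEnergy Ω c f u| ≤ 1 / 2 * (|M| * lpNorm u 2 (volume.restrict Ω) ^ 2) +
      lpNorm f 2 (volume.restrict Ω) * lpNorm u 2 (volume.restrict Ω) := by
  refine (abs_sub _ _).trans (add_le_add ?_ (abs_integral_mul_le hf hu))
  rw [abs_mul, abs_of_pos one_half_pos]
  exact mul_le_mul_of_nonneg_left (abs_integral_bdd_mul_sq_le hc hM hu) one_half_pos.le

end EnergyParts

section Energies

variable {n : ℕ} {Ω U : Set (E n)} {α β γ : ℝ} {h q g u : E n → ℝ}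

/-- The diffuse energy `F_ε[u]` of `u ∈ H¹(Ω)` as a real number, split into its gradient, lower
order and boundary parts. -/
def diffuseIntegral (Ω U : Set (E n)) (α β γ : ℝ) (h q g : E n → ℝ) (ε : ℝ) (u : E n → ℝ) : ℝ :=
  gradientEnergy Ω (diffuseCoeff U ε (fun _ => 1) fun _ => α) u +
    lowerOrderEnergy Ω (diffuseCoeff U ε (fun _ => γ) fun _ => β) (diffuseCoeff U ε q h) u +
    ∫ x in Ω, g x * u x * ‖gradient (phase U ε) x‖

/-- The sharp energy `F₀[u]` of `u ∈ H¹(Ω)` as a real number, split into its gradient, lower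
order and boundary parts. -/
def sharpIntegral (Ω U : Set (E n)) (α β γ : ℝ) (h q g u : E n → ℝ) : ℝ :=
  gradientEnergy Ω (sharpCoeff Ω U (fun _ => 1) fun _ => α) u +
    lowerOrderEnergy Ω (sharpCoeff Ω U (fun _ => γ) fun _ => β) (sharpCoeff Ω U q h) u +
    ∫ x, trace U g x * trace U u x ∂surfaceMeasure U

theorem integrableOn_boundaryTerm {ε : ℝ} (hε : 0 < ε) (hg : MemLp g 2 (volume.restrict Ω))
    (hu : MemLp u 2 (volume.restrict Ω)) :
    IntegrableOn (fun x => g x * u x * ‖gradient (phase U ε) x‖) Ω :=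
  integrable_mul_norm_gradient_phase hε Measure.restrict_le_self.absolutelyContinuous
    (hg.integrable_mul hu)

theorem diffuseEnergy_eq_diffuseIntegral {ε : ℝ} (hε : 0 < ε)
    (hh : MemLp h 2 (volume.restrict Ω)) (hq : MemLp q 2 (volume.restrict Ω))
    (hg : MemLp g 2 (volume.restrict Ω)) {u : Lp ℝ 2 (volume.restrict Ω)} (hu : MemH1 Ω u) :
    diffuseEnergy Ω U α β γ h q g ε u = (diffuseIntegral Ω U α β γ h q g ε u : EReal) := by
  obtain ⟨hint, hbulk⟩ := integrable_and_integral_bulk_eq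
    (memLp_diffuseCoeff U ε (memLp_top_const 1) (memLp_top_const α))
    (memLp_diffuseCoeff U ε (memLp_top_const γ) (memLp_top_const β))
    (memLp_diffuseCoeff U ε hq hh) hu
  rw [diffuseEnergy, if_pos hu, diffuseIntegral, ← hbulk,
    integral_add hint (integrableOn_boundaryTerm hε hg hu.1)]

theorem sharpEnergy_eq_sharpIntegral (hΩ : MeasurableSet Ω) (hU : MeasurableSet U)
    (hh : MemLp h 2 (volume.restrict Ω)) (hq : MemLp q 2 (volume.restrict Ω))
    {u : Lp ℝ 2 (volume.restrict Ω)} (hu : MemH1 Ω u) :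
    sharpEnergy Ω U α β γ h q g u = (sharpIntegral Ω U α β γ h q g u : EReal) := by
  rw [sharpEnergy, if_pos hu, sharpIntegral, (integrable_and_integral_bulk_eq
    (memLp_sharpCoeff hΩ hU (memLp_top_const 1) (memLp_top_const α))
    (memLp_sharpCoeff hΩ hU (memLp_top_const γ) (memLp_top_const β))
    (memLp_sharpCoeff hΩ hU hq hh) hu).2]

theorem abs_lowerOrderEnergy_diffuseCoeff_le (U : Set (E n)) (ε s t : ℝ)
    (hh : MemLp h 2 (volume.restrict Ω)) (hq : MemLp q 2 (volume.restrict Ω))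
    (hu : MemLp u 2 (volume.restrict Ω)) :
    |lowerOrderEnergy Ω (diffuseCoeff U ε (fun _ => s) fun _ => t) (diffuseCoeff U ε q h) u| ≤
      1 / 2 * (abs (max |s| |t|) * lpNorm u 2 (volume.restrict Ω) ^ 2) +
      (lpNorm h 2 (volume.restrict Ω) + lpNorm (q - h) 2 (volume.restrict Ω)) *
        lpNorm u 2 (volume.restrict Ω) :=
  (abs_lowerOrderEnergy_le (memLp_diffuseCoeff U ε (memLp_top_const s) (memLp_top_const t)).1
    (.of_forall fun x => abs_diffuseCoeff_le U ε _ _ x) (memLp_diffuseCoeff U ε hq hh) hu).trans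
      (add_le_add_right (mul_le_mul_of_nonneg_right
        (lpNorm_diffuseCoeff_le one_le_two U ε hq hh) lpNorm_nonneg) _)

end Energies

section EnergyLimits

variable {n : ℕ} {Ω U : Set (E n)} {α β γ : ℝ} {h q g u : E n → ℝ} {ι : Type*} {l : Filter ι}
  [l.IsCountablyGenerated] {e : ι → ℝ} {v : ι → E n → ℝ}
  (hΩ : MeasurableSet Ω) (hU : MeasurableSet U) (hne : (frontier U).Nonempty)
  (hnull : volume (frontier U) = 0) (he : Tendsto e l (𝓝[>] 0))
include hΩ hU hne hnull he

theorem tendsto_gradientEnergy_diffuseCoeff (s t : ℝ) (hu : MemH1 Ω u) :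
    Tendsto (fun i => gradientEnergy Ω (diffuseCoeff U (e i) (fun _ => s) fun _ => t) u) l
      (𝓝 (gradientEnergy Ω (sharpCoeff Ω U (fun _ => s) fun _ => t) u)) :=
  (tendsto_integral_diffuseCoeff_mul_sq hΩ hU hne hnull he s t
    (fun _ => hu.memLp_weakGradient.norm) hu.memLp_weakGradient.norm
    (by simp [tendsto_const_nhds])).const_mul _

theorem tendsto_lowerOrderEnergy_diffuseCoeff (s t : ℝ)
    (hh : MemLp h 2 (volume.restrict Ω)) (hq : MemLp q 2 (volume.restrict Ω))
    (hv : ∀ i, MemLp (v i) 2 (volume.restrict Ω)) (hu : MemLp u 2 (volume.restrict Ω))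
    (hvu : Tendsto (fun i => lpNorm (v i - u) 2 (volume.restrict Ω)) l (𝓝 0)) :
    Tendsto (fun i => lowerOrderEnergy Ω (diffuseCoeff U (e i) (fun _ => s) fun _ => t)
        (diffuseCoeff U (e i) q h) (v i)) l
      (𝓝 (lowerOrderEnergy Ω (sharpCoeff Ω U (fun _ => s) fun _ => t) (sharpCoeff Ω U q h) u)) :=
  ((tendsto_integral_diffuseCoeff_mul_sq hΩ hU hne hnull he s t hv hu hvu).const_mul _).sub
    (tendsto_integral_mul (fun i => memLp_diffuseCoeff U (e i) hq hh)
      (memLp_sharpCoeff hΩ hU hq hh) hv hu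
      (tendsto_lpNorm_diffuseCoeff_sub hΩ hU hne hnull hq hh he) hvu)

theorem tendsto_linearized_gradientEnergy (s t : ℝ) {l' : Filter ι} (hl : l' ≤ l) (hu : MemH1 Ω u)
    {W : ι → E n → E n} (hW : TendstoWeakly (volume.restrict Ω) W l' (weakGradient Ω u)) :
    Tendsto (fun i => (∫ x in Ω, diffuseCoeff U (e i) (fun _ => s) (fun _ => t) x *
        inner ℝ (W i x) (weakGradient Ω u x)) -
        gradientEnergy Ω (diffuseCoeff U (e i) (fun _ => s) fun _ => t) u) l'
      (𝓝 (gradientEnergy Ω (sharpCoeff Ω U (fun _ => s) fun _ => t) u)) := by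
  have hlim := (hW.tendsto_integral_diffuseCoeff_mul_inner hΩ hU hne hnull he s t hl
    hu.memLp_weakGradient).sub
      ((tendsto_gradientEnergy_diffuseCoeff hΩ hU hne hnull he s t hu).mono_left hl)
  convert hlim using 2
  simp only [gradientEnergy, real_inner_self_eq_norm_sq]
  ring

end EnergyLimits

/-! ### Γ-convergence -/

theorem memH1_and_tendstoWeakly_weakGradient {n : ℕ} {Ω : Set (E n)} (hΩ : IsOpen Ω) {ι : Type*}
    (𝓤 : Ultrafilter ι) {u : E n → ℝ} {v : ι → E n → ℝ} {R : ℝ}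
    (hu : MemLp u 2 (volume.restrict Ω)) (hv : ∀ i, MemLp (v i) 2 (volume.restrict Ω))
    (hvu : Tendsto (fun i => lpNorm (v i - u) 2 (volume.restrict Ω)) 𝓤 (𝓝 0))
    (hR : ∀ᶠ i in 𝓤, MemH1 Ω (v i) ∧ lpNorm (weakGradient Ω (v i)) 2 (volume.restrict Ω) ≤ R) :
    MemH1 Ω u ∧
      TendstoWeakly (volume.restrict Ω) (fun i => weakGradient Ω (v i)) 𝓤 (weakGradient Ω u) := by
  obtain ⟨G, hG⟩ := exists_tendstoWeakly 𝓤 (hR.mono fun i hi => ⟨hi.1.memLp_weakGradient, hi.2⟩)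
  have hGu : IsWeakGradient Ω u G :=
    .of_tendsto (hR.mono fun i hi => hi.1.isWeakGradient) hu hv hvu hG
  have huH : MemH1 Ω u := ⟨hu, G, hG.memLp, hGu⟩
  have hae := hGu.ae_eq hΩ huH.isWeakGradient hG.memLp huH.memLp_weakGradient
  refine ⟨huH, huH.memLp_weakGradient, hG.exists_bound, fun Y hY => ?_⟩
  convert hG.tendsto_integral Y hY using 2
  exact integral_congr_ae (hae.symm.mono fun x hx => congrArg (inner ℝ · (Y x)) hx)

namespace BoundaryPartition

variable {n : ℕ} {Ω U : Set (E n)} {c : ℝ} (P : BoundaryPartition U Ω c) {α β γ : ℝ}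
  {h q g u : E n → ℝ}

include P in
/- The boundary term is only linear in `‖∇v‖`, so it cannot compensate the quadratic gradient
energy. -/
theorem exists_mul_lpNorm_weakGradient_sq_le (hc : 0 < c) (hΩ : IsOpen Ω)
    (hh : MemLp h 2 (volume.restrict Ω)) (hq : MemLp q 2 (volume.restrict Ω)) (hg : MemH1 Ω g)
    (α β γ : ℝ) {B : ℝ} (hB : 0 ≤ B) :
    ∃ A C : ℝ, 0 ≤ A ∧ 0 ≤ C ∧ ∀ ε ∈ Set.Ioo (0 : ℝ) 1, ∀ v, MemH1 Ω v →
      lpNorm v 2 (volume.restrict Ω) ≤ B →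
      1 / 2 * min 1 α * lpNorm (weakGradient Ω v) 2 (volume.restrict Ω) ^ 2 ≤
        diffuseIntegral Ω U α β γ h q g ε v + A +
          C * lpNorm (weakGradient Ω v) 2 (volume.restrict Ω) := by
  obtain ⟨C, hC, hbdry⟩ := P.exists_abs_integral_boundary_le hc hΩ hg
  set κ := lpNorm h 2 (volume.restrict Ω) + lpNorm (q - h) 2 (volume.restrict Ω)
  have hκ : 0 ≤ κ := add_nonneg lpNorm_nonneg lpNorm_nonneg
  refine ⟨1 / 2 * (abs (max |γ| |β|) * B ^ 2) + κ * B + C * (2 * B), C, by positivity, hC,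
    fun ε hε v hv hvB => ?_⟩
  obtain ⟨w, hw⟩ := hv.exists_h1Approx hΩ P.isCompact_carrier P.carrier_subset
  have hboundary := (abs_le.1 (hbdry ε hε v _ w hw hv.1 hv.memLp_weakGradient)).1
  have hlower := (abs_le.1 (abs_lowerOrderEnergy_diffuseCoeff_le U ε γ β hh hq hv.1)).1
  have hgrad := mul_lpNorm_sq_le_integral
    (memLp_diffuseCoeff U ε (memLp_top_const 1) (memLp_top_const α))
    (min_le_diffuseCoeff U ε _ _) hv.memLp_weakGradient
  rw [h1Norm] at hboundary
  rw [diffuseIntegral, gradientEnergy]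
  set N := lpNorm v 2 (volume.restrict Ω)
  have hN : 0 ≤ N := lpNorm_nonneg
  have hsqrt := sqrt_mul_add_le_add hN
    (lpNorm_nonneg : 0 ≤ lpNorm (weakGradient Ω v) 2 (volume.restrict Ω))
  have hboundary' := mul_le_mul_of_nonneg_left (add_le_add hsqrt hvB) hC
  have hNB := mul_le_mul_of_nonneg_left hvB hC
  have hmass : abs (max |γ| |β|) * N ^ 2 ≤ abs (max |γ| |β|) * B ^ 2 := by gcongr
  have hload := mul_le_mul_of_nonneg_left hvB hκ
  linarith

include P in
theorem exists_lpNorm_weakGradient_le (hc : 0 < c) (hΩ : IsOpen Ω) (hα : 0 < α)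
    (hh : MemLp h 2 (volume.restrict Ω)) (hq : MemLp q 2 (volume.restrict Ω)) (hg : MemH1 Ω g)
    (β γ L : ℝ) {B : ℝ} (hB : 0 ≤ B) :
    ∃ R : ℝ, ∀ ε ∈ Set.Ioo (0 : ℝ) 1, ∀ v, MemH1 Ω v → lpNorm v 2 (volume.restrict Ω) ≤ B →
      diffuseIntegral Ω U α β γ h q g ε v ≤ L →
      lpNorm (weakGradient Ω v) 2 (volume.restrict Ω) ≤ R := by
  obtain ⟨A, C, hA, hC, hle⟩ := P.exists_mul_lpNorm_weakGradient_sq_le hc hΩ hh hq hg α β γ hB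
  refine ⟨1 + (|L| + A + C) / (1 / 2 * min 1 α), fun ε hε v hv hvB hL =>
    le_of_mul_sq_le_add_mul (by positivity) (by positivity) hC ((hle ε hε v hv hvB).trans ?_)⟩
  gcongr
  exact hL.trans (le_abs_self L)

section BoundaryLimit

variable (hc : 0 < c) (hΩ : IsOpen Ω) (hg : MemH1 Ω g) (hu : MemH1 Ω u) {ι : Type*} {l : Filter ι}
  {e : ι → ℝ} (he : Tendsto e l (𝓝[>] 0)) {v : ι → E n → ℝ} {R : ℝ}
  (hvu : Tendsto (fun i => lpNorm (v i - u) 2 (volume.restrict Ω)) l (𝓝 0))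
  (hR : ∀ᶠ i in l, MemH1 Ω (v i) ∧ lpNorm (weakGradient Ω (v i)) 2 (volume.restrict Ω) ≤ R)
include P hc hΩ hg hu he hvu hR

theorem tendsto_integral_boundary_sub :
    Tendsto (fun i => ∫ x in Ω, g x * (v i - u) x * ‖gradient (phase U (e i)) x‖) l (𝓝 0) := by
  obtain ⟨C, hC, hbdry⟩ := P.exists_abs_integral_boundary_le hc hΩ hg
  obtain ⟨z, hz⟩ := hu.exists_h1Approx hΩ P.isCompact_carrier P.carrier_subset
  let R' := R + lpNorm (weakGradient Ω u) 2 (volume.restrict Ω)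
  have hlim : Tendsto (fun i => C * (√(lpNorm (v i - u) 2 (volume.restrict Ω) *
      (lpNorm (v i - u) 2 (volume.restrict Ω) + R')) + lpNorm (v i - u) 2 (volume.restrict Ω)))
      l (𝓝 0) := by
    simpa using ((hvu.mul (hvu.add_const R')).sqrt.add hvu).const_mul C
  refine squeeze_zero_norm' ?_ hlim
  filter_upwards [hR, he.eventually (Ioo_mem_nhdsGT one_pos)] with i ⟨hvi, hRi⟩ hεi
  obtain ⟨w, hw⟩ := hvi.exists_h1Approx hΩ P.isCompact_carrier P.carrier_subset
  have hgrad : lpNorm (weakGradient Ω (v i) - weakGradient Ω u) 2 (volume.restrict Ω) ≤ R' :=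
    (lpNorm_sub_le hvi.memLp_weakGradient one_le_two).trans (add_le_add_left hRi _)
  refine (hbdry _ hεi _ _ _ (hw.sub hz) (hvi.1.sub hu.1)
    (hvi.memLp_weakGradient.sub hu.memLp_weakGradient)).trans ?_
  rw [h1Norm]
  have hnonneg : 0 ≤ lpNorm (v i - u) 2 (volume.restrict Ω) := lpNorm_nonneg
  gcongr

theorem tendsto_integral_boundary_of_tendsto (hn : 1 ≤ n) (hU : HasCkBoundary 1 U) (hUo : IsOpen U)
    (hbdd : Bornology.IsBounded U) (hne : (frontier U).Nonempty) (hsub : closure U ⊆ Ω) :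
    Tendsto (fun i => ∫ x in Ω, g x * v i x * ‖gradient (phase U (e i)) x‖) l
      (𝓝 (∫ x, trace U g x * trace U u x ∂surfaceMeasure U)) := by
  have hsum := ((P.tendsto_integral_boundary hc hn hU hUo hΩ hbdd hne hsub hg hu).comp he).add
    (P.tendsto_integral_boundary_sub hc hΩ hg hu he hvu hR)
  rw [add_zero] at hsum
  refine hsum.congr' ?_
  filter_upwards [hR, he.eventually self_mem_nhdsWithin] with i ⟨hvi, _⟩ hεi
  have hεi : 0 < e i := hεi
  rw [Function.comp_apply, ← integral_add (integrableOn_boundaryTerm hεi hg.1 hu.1)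
    (integrableOn_boundaryTerm hεi hg.1 (hvi.1.sub hu.1))]
  congr 1 with x
  rw [Pi.sub_apply]
  ring

end BoundaryLimit

section Limits

variable (hc : 0 < c) (hn : 1 ≤ n) (hU : HasCkBoundary 1 U) (hUo : IsOpen U) (hΩ : IsOpen Ω)
  (hbdd : Bornology.IsBounded U) (hne : (frontier U).Nonempty) (hsub : closure U ⊆ Ω)
  (hh : MemLp h 2 (volume.restrict Ω)) (hq : MemLp q 2 (volume.restrict Ω)) (hg : MemH1 Ω g)
include P hc hn hU hUo hΩ hbdd hne hsub hh hq hg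

theorem tendsto_diffuseIntegral (hu : MemH1 Ω u) :
    Tendsto (fun ε => diffuseIntegral Ω U α β γ h q g ε u) (𝓝[>] 0)
      (𝓝 (sharpIntegral Ω U α β γ h q g u)) := by
  have := P.isFiniteMeasure_surfaceMeasure
  have hnull := volume_frontier_eq_zero hn U
  exact ((tendsto_gradientEnergy_diffuseCoeff hΩ.measurableSet hUo.measurableSet hne hnull
      tendsto_id 1 α hu).add
    (tendsto_lowerOrderEnergy_diffuseCoeff hΩ.measurableSet hUo.measurableSet hne hnull
      tendsto_id γ β hh hq (fun _ => hu.1) hu.1 (by simp))).add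
    (P.tendsto_integral_boundary hc hn hU hUo hΩ hbdd hne hsub hg hu)

variable {ι : Type*} {l : Filter ι} [l.IsCountablyGenerated] {e : ι → ℝ} {v : ι → E n → ℝ} {L : ℝ}
  (hα : 0 < α) (he : Tendsto e l (𝓝[>] 0)) (hv : ∀ i, MemLp (v i) 2 (volume.restrict Ω))
  (hvu : Tendsto (fun i => lpNorm (v i - u) 2 (volume.restrict Ω)) l (𝓝 0))
include hα he hv hvu

/- Convexity of `W ↦ D_ε |W|²` bounds the gradient energy of `v i` below by its linearization at
`∇u`, which is continuous along weak limits. -/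
theorem sharpIntegral_le_of_ultrafilter (hu : MemH1 Ω u) {𝓤 : Ultrafilter ι} (h𝓤 : ↑𝓤 ≤ l) {R : ℝ}
    (hW : TendstoWeakly (volume.restrict Ω) (fun i => weakGradient Ω (v i)) 𝓤 (weakGradient Ω u))
    (hR : ∀ᶠ i in 𝓤, MemH1 Ω (v i) ∧ lpNorm (weakGradient Ω (v i)) 2 (volume.restrict Ω) ≤ R)
    (hL : ∀ᶠ i in 𝓤, diffuseIntegral Ω U α β γ h q g (e i) (v i) ≤ L) :
    sharpIntegral Ω U α β γ h q g u ≤ L := by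
  have := P.isFiniteMeasure_surfaceMeasure
  have hnull := volume_frontier_eq_zero hn U
  have hgrad := tendsto_linearized_gradientEnergy hΩ.measurableSet hUo.measurableSet hne hnull he
    1 α h𝓤 hu hW
  have hlower := (tendsto_lowerOrderEnergy_diffuseCoeff hΩ.measurableSet hUo.measurableSet hne
    hnull he γ β hh hq hv hu.1 hvu).mono_left h𝓤
  have hboundary := P.tendsto_integral_boundary_of_tendsto hc hΩ hg hu (he.mono_left h𝓤)
    (hvu.mono_left h𝓤) hR hn hU hUo hbdd hne hsub
  refine le_of_tendsto ((hgrad.add hlower).add hboundary) ?_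
  filter_upwards [hR, hL] with i ⟨hvi, _⟩ hLi
  have hconvex := integral_inner_sub_half_le
    (memLp_diffuseCoeff U (e i) (memLp_top_const 1) (memLp_top_const α))
    (fun x => (lt_min one_pos hα).le.trans
      (min_le_diffuseCoeff U (e i) (fun _ => 1) (fun _ => α) x))
    hvi.memLp_weakGradient hu.memLp_weakGradient
  refine le_trans ?_ hLi
  rw [diffuseIntegral, gradientEnergy, gradientEnergy]
  linarith

theorem memH1_and_sharpIntegral_le (hu : MemLp u 2 (volume.restrict Ω))
    (hL : ∃ᶠ i in l, MemH1 Ω (v i) ∧ diffuseIntegral Ω U α β γ h q g (e i) (v i) ≤ L) :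
    MemH1 Ω u ∧ sharpIntegral Ω U α β γ h q g u ≤ L := by
  obtain ⟨R, hR⟩ := P.exists_lpNorm_weakGradient_le hc hΩ hα hh hq hg β γ L
    (add_nonneg lpNorm_nonneg zero_le_one : 0 ≤ lpNorm u 2 (volume.restrict Ω) + 1)
  have hnorm : ∀ᶠ i in l, lpNorm (v i) 2 (volume.restrict Ω) <
      lpNorm u 2 (volume.restrict Ω) + 1 :=
    (tendsto_lpNorm_of_tendsto_lpNorm_sub one_le_two hv hu hvu).eventually_lt_const
      (lt_add_one _)
  have hpos := he.eventually (Ioo_mem_nhdsGT one_pos)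
  obtain ⟨𝓤, hle⟩ := exists_ultrafilter_iff.2
    (frequently_mem_iff_neBot.1 (hL.and_eventually (hnorm.and hpos)))
  have h𝓤 : ↑𝓤 ≤ l := hle.trans inf_le_left
  have hevent := le_principal_iff.1 (hle.trans inf_le_right)
  have hbound : ∀ᶠ i in 𝓤, MemH1 Ω (v i) ∧
      lpNorm (weakGradient Ω (v i)) 2 (volume.restrict Ω) ≤ R :=
    mem_of_superset hevent fun i hi => ⟨hi.1.1, hR _ hi.2.2 _ hi.1.1 hi.2.1.le hi.1.2⟩
  obtain ⟨huH, hW⟩ := memH1_and_tendstoWeakly_weakGradient hΩ 𝓤 hu hv (hvu.mono_left h𝓤) hbound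
  exact ⟨huH, P.sharpIntegral_le_of_ultrafilter hc hn hU hUo hΩ hbdd hne hsub hh hq hg hα he hv
    hvu huH h𝓤 hW hbound (mem_of_superset hevent fun _ hi => hi.1.2)⟩

end Limits

section Sequences

variable (hc : 0 < c) (hn : 1 ≤ n) (hU : HasCkBoundary 1 U) (hUo : IsOpen U) (hΩ : IsOpen Ω)
  (hbdd : Bornology.IsBounded U) (hne : (frontier U).Nonempty) (hsub : closure U ⊆ Ω)
  (hh : MemLp h 2 (volume.restrict Ω)) (hq : MemLp q 2 (volume.restrict Ω)) (hg : MemH1 Ω g)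
  {ι : Type*} {l : Filter ι} {e : ι → ℝ} (he : Tendsto e l (𝓝[>] 0))
include P hc hn hU hUo hΩ hbdd hne hsub hh hq hg he

theorem sharpEnergy_le_liminf [l.IsCountablyGenerated] (hα : 0 < α)
    {v : ι → Lp ℝ 2 (volume.restrict Ω)} {u : Lp ℝ 2 (volume.restrict Ω)}
    (hvu : Tendsto v l (𝓝 u)) :
    sharpEnergy Ω U α β γ h q g u ≤
      liminf (fun i => diffuseEnergy Ω U α β γ h q g (e i) (v i)) l := by
  by_contra! hlt
  obtain ⟨L, hL, hLu⟩ := EReal.lt_iff_exists_real_btwn.1 hlt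
  have hfreq : ∃ᶠ i in l, MemH1 Ω (v i) ∧ diffuseIntegral Ω U α β γ h q g (e i) (v i) ≤ L := by
    refine ((frequently_lt_of_liminf_lt (by isBoundedDefault) hL).and_eventually
      (he.eventually self_mem_nhdsWithin)).mono fun i ⟨hi, hεi⟩ => ?_
    by_cases hvi : MemH1 Ω (v i)
    · rw [diffuseEnergy_eq_diffuseIntegral hεi hh hq hg.1 hvi] at hi
      exact ⟨hvi, (EReal.coe_lt_coe_iff.1 hi).le⟩
    · rw [diffuseEnergy, if_neg hvi] at hi
      exact absurd hi not_top_lt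
  have hconv : Tendsto (fun i => lpNorm (⇑(v i) - ⇑u) 2 (volume.restrict Ω)) l (𝓝 0) :=
    (tendsto_iff_dist_tendsto_zero.1 hvu).congr fun i => (Lp.dist_def _ _).trans
      (toReal_eLpNorm ((Lp.memLp (v i)).sub (Lp.memLp u)).1)
  obtain ⟨hu, hle⟩ := P.memH1_and_sharpIntegral_le hc hn hU hUo hΩ hbdd hne hsub hh hq hg hα he
    (fun i => Lp.memLp (v i)) hconv (Lp.memLp u) hfreq
  rw [sharpEnergy_eq_sharpIntegral hΩ.measurableSet hUo.measurableSet hh hq hu] at hLu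
  exact hle.not_gt (EReal.coe_lt_coe_iff.1 hLu)

theorem limsup_diffuseEnergy_le_sharpEnergy (u : Lp ℝ 2 (volume.restrict Ω)) :
    limsup (fun i => diffuseEnergy Ω U α β γ h q g (e i) u) l ≤
      sharpEnergy Ω U α β γ h q g u := by
  by_cases hu : MemH1 Ω u
  · rw [sharpEnergy_eq_sharpIntegral hΩ.measurableSet hUo.measurableSet hh hq hu]
    have hlim := EReal.tendsto_coe.2 ((P.tendsto_diffuseIntegral (α := α) (β := β) (γ := γ) hc hn hU
      hUo hΩ hbdd hne hsub hh hq hg hu).comp he)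
    have heq : ∀ᶠ i in l, diffuseEnergy Ω U α β γ h q g (e i) u =
        (diffuseIntegral Ω U α β γ h q g (e i) u : EReal) :=
      (he.eventually self_mem_nhdsWithin).mono fun i hi =>
        diffuseEnergy_eq_diffuseIntegral hi hh hq hg.1 hu
    obtain rfl | hl := l.eq_or_neBot
    · simp
    · exact (hlim.congr' (heq.mono fun _ hi => hi.symm)).limsup_eq.le
  · rw [sharpEnergy, if_neg hu]
    exact le_top

end Sequences

end BoundaryPartition

end DiffuseDomain

end

theorem theorem1_general {n : ℕ} (hn : 1 ≤ n) {Ω U : Set (DiffuseDomain.E n)} (hΩ : IsOpen Ω)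
    (hU : IsOpen U) (hU_bdd : Bornology.IsBounded U) (hU_ne : U.Nonempty)
    (hU_C1 : DiffuseDomain.HasCkBoundary 1 U) (hU_sub : closure U ⊆ Ω) {α : ℝ} (hα : 0 < α)
    (β γ : ℝ) {h q g : DiffuseDomain.E n → ℝ} (hh : MemLp h 2 (volume.restrict Ω))
    (hq : MemLp q 2 (volume.restrict Ω)) (hg : DiffuseDomain.MemH1 Ω g) :
    DiffuseDomain.GammaConverges (DiffuseDomain.diffuseEnergy Ω U α β γ h q g)
      (DiffuseDomain.sharpEnergy Ω U α β γ h q g) := by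
  have : Nonempty (Fin n) := ⟨⟨0, hn⟩⟩
  have hne := DiffuseDomain.frontier_nonempty_of_isBounded hU_ne hU_bdd
  obtain ⟨P⟩ := DiffuseDomain.exists_boundaryPartition hU_C1 hU
    (DiffuseDomain.isCompact_frontier_of_isBounded hU_bdd) hne hΩ
    (frontier_subset_closure.trans hU_sub) one_half_pos one_half_lt_one
  intro e he_mem he
  have he' : Tendsto e atTop (𝓝[>] 0) :=
    tendsto_nhdsWithin_iff.2 ⟨he, .of_forall fun k => (he_mem k).1⟩
  exact ⟨fun u v hvu => P.sharpEnergy_le_liminf one_half_pos hn hU_C1 hU hΩ hU_bdd hne hU_sub hh hq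
      hg he' hα hvu,
    fun u => ⟨fun _ => u, tendsto_const_nhds, P.limsup_diffuseEnergy_le_sharpEnergy one_half_pos hn
      hU_C1 hU hΩ hU_bdd hne hU_sub hh hq hg he' u⟩⟩

theorem theorem1 {n : ℕ} (hn : 1 ≤ n) (a b : Fin n → ℝ)
    (Ω₁ : Set (DiffuseDomain.E n)) (hΩ₁_open : IsOpen Ω₁) (hΩ₁_bdd : Bornology.IsBounded Ω₁)
    (hΩ₁_ne : Ω₁.Nonempty) (hΩ₁_C3 : DiffuseDomain.HasCkBoundary 3 Ω₁)
    (hΩ₁_sub : closure Ω₁ ⊆ DiffuseDomain.cuboid a b)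
    (α β γ : ℝ) (hα : 0 < α) (hβ : 0 < β) (hγ : 0 < γ)
    (h q g : DiffuseDomain.E n → ℝ)
    (hh : MemLp h 2 (volume.restrict (DiffuseDomain.cuboid a b)))
    (hq : MemLp q 2 (volume.restrict (DiffuseDomain.cuboid a b)))
    (hg : DiffuseDomain.MemH1 (DiffuseDomain.cuboid a b) g) :
    DiffuseDomain.GammaConverges
      (DiffuseDomain.diffuseEnergy (DiffuseDomain.cuboid a b) Ω₁ α β γ h q g)
      (DiffuseDomain.sharpEnergy (DiffuseDomain.cuboid a b) Ω₁ α β γ h q g) :=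
  theorem1_general hn (DiffuseDomain.isOpen_cuboid a b) hΩ₁_open hΩ₁_bdd hΩ₁_ne
    (hΩ₁_C3.of_le (by norm_num)) hΩ₁_sub hα β γ hh hq hg
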